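/- Let $n\ge 2$, let $M$ be a smooth manifold of dimension $n+3$, and let $D\subset TM$ be a smooth rank 2 distribution. Define its small derived flag by $D^1=D$, $D^{i+1}=D^i+[D,D^i]$, and call $p\in M$ generic if there is a neighbourhood of $p$ on which $\dim D^i$ is constant for every $i$. Then the generic points form an open dense subset of $M$, and for every generic point $p$ the following are equivalent. (A) $D$ is associated near $p$ with a Lagrangian $f(x,y,y',\dots,y^{(n)})\,dx$ with $\frac{\partial^2 f}{\partial y_n^2}\neq 0$: there are smooth local coordinates $(x,y_0,\dots,y_n,z)$ around $p$ and a smooth function $f(x,y_0,\dots,y_n)$ with nowhere vanishing $\frac{\partial^2 f}{\partial y_n^2}$ such that $D$ is spanned near $p$ by $$X_1=\frac{\partial}{\partial x}+y_1\frac{\partial}{\partial y_0}+\dots+y_n\frac{\partial}{\partial y_{n-1}}+f\frac{\partial}{\partial z},\qquad X_2=\frac{\partial}{\partial y_n}.$$ (B) There is an open neighbourhood $U$ of $p$ such that 1. $\dim D^3=5$ on $U$; 2. there is an infinitesimal symmetry $X$ of $D$ on $U$ (that is, a smooth vector field with $[X,D]\subset D$), nowhere zero and lying in $D^3$, such that the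 space of integral curves of $X$ in $U$ is a smooth manifold $N$ of dimension $n+2$ with smooth submersive quotient map $\pi\colon U\to N$, and $\pi_*D$ is a Goursat distribution on $N$. Here a Goursat distribution on $N$ is a smooth rank 2 distribution $E$ such that, with $E_1=E$ and $E_{i+1}=E_i+[E_i,E_i]$, one has $\dim E_i=i+1$ at every point of $N$ for $1\le i\le n+1$. -/

import Mathlib

open Set Module
open scoped Manifold ContDiff Topology

noncomputable section

/-- Vector fields on a `d`-dimensional manifold, as functions. A field that only matters on an open
set `U` is a total function whose values outside `U` are irrelevant. -/
abbrev VField (d : ℕ) (M : Type*) [TopologicalSpace M]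
    [ChartedSpace (EuclideanSpace ℝ (Fin d)) M] : Type _ :=
  (x : M) → TangentSpace (𝓡 d) x

/-- The vector field `X` is smooth (`C^∞`) on `U`. -/
def VField.SmoothOn {d : ℕ} {M : Type*} [TopologicalSpace M]
    [ChartedSpace (EuclideanSpace ℝ (Fin d)) M] [IsManifold (𝓡 d) ∞ M]
    (X : VField d M) (U : Set M) : Prop :=
  ContMDiffOn (𝓡 d) (𝓡 d).tangent ∞ (fun x => (⟨x, X x⟩ : TangentBundle (𝓡 d) M)) U

/-- A rank 2 vector distribution on the smooth `d`-dimensional manifold `M`: a smooth subbundle of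
rank 2 of the tangent bundle, i.e. a field of tangent planes that is locally spanned by two smooth,
pointwise linearly independent vector fields. -/
structure RankTwoDistribution (d : ℕ) (M : Type*) [TopologicalSpace M]
    [ChartedSpace (EuclideanSpace ℝ (Fin d)) M] [IsManifold (𝓡 d) ∞ M] where
  /-- The plane at a point. -/
  fiber : (x : M) → Submodule ℝ (TangentSpace (𝓡 d) x)
  exists_frame : ∀ p : M, ∃ U : Set M, IsOpen U ∧ p ∈ U ∧ ∃ X Y : VField d M,
    X.SmoothOn U ∧ Y.SmoothOn U ∧ ∀ x ∈ U,
      LinearIndependent ℝ ![X x, Y x] ∧ fiber x = Submodule.span ℝ {X x, Y x}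

namespace RankTwoDistribution

section

variable {d : ℕ} {M : Type*} [TopologicalSpace M]
  [ChartedSpace (EuclideanSpace ℝ (Fin d)) M] [IsManifold (𝓡 d) ∞ M]

/-- `X` is a smooth section of `D` over `U`. -/
def IsSectionOn (D : RankTwoDistribution d M) (U : Set M) (X : VField d M) : Prop :=
  X.SmoothOn U ∧ ∀ x ∈ U, X x ∈ D.fiber x

/-- The fields over the open set `U` that belong to the `i`-th term of the small derived flag:
`D^1 = D` and `D^{i+1} = D^i + [D, D^i]` (with `D^0 = 0`). -/
def derivedSections (D : RankTwoDistribution d M) (U : Set M) : ℕ → Submodule ℝ (VField d M)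
  | 0 => ⊥
  | 1 => Submodule.span ℝ {X | D.IsSectionOn U X}
  | i + 2 => D.derivedSections U (i + 1) ⊔ Submodule.span ℝ
      {Z | ∃ X Y : VField d M, D.IsSectionOn U X ∧ Y ∈ D.derivedSections U (i + 1) ∧
        Z = VectorField.mlieBracket (𝓡 d) X Y}

/-- The subspace `D^i(p)` of the tangent space at `p`: the values at `p` of the fields that belong
to `D^i` over a neighbourhood of `p`. -/
def derivedFlag (D : RankTwoDistribution d M) (i : ℕ) (p : M) :
    Submodule ℝ (TangentSpace (𝓡 d) p) :=
  Submodule.span ℝ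
    {v | ∃ U : Set M, IsOpen U ∧ p ∈ U ∧ ∃ X ∈ D.derivedSections U i, X p = v}

/-- The fields over the open set `U` that belong to the `i`-th term of the sequence of Lie squares:
`D_1 = D` and `D_{i+1} = D_i + [D_i, D_i]` (with `D_0 = 0`). -/
def lieSquareSections (D : RankTwoDistribution d M) (U : Set M) : ℕ → Submodule ℝ (VField d M)
  | 0 => ⊥
  | 1 => Submodule.span ℝ {X | D.IsSectionOn U X}
  | i + 2 => D.lieSquareSections U (i + 1) ⊔ Submodule.span ℝ
      {Z | ∃ X Y : VField d M, X ∈ D.lieSquareSections U (i + 1) ∧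
        Y ∈ D.lieSquareSections U (i + 1) ∧ Z = VectorField.mlieBracket (𝓡 d) X Y}

/-- The subspace `D_i(p)` of the tangent space at `p`. -/
def lieSquareFlag (D : RankTwoDistribution d M) (i : ℕ) (p : M) :
    Submodule ℝ (TangentSpace (𝓡 d) p) :=
  Submodule.span ℝ
    {v | ∃ U : Set M, IsOpen U ∧ p ∈ U ∧ ∃ X ∈ D.lieSquareSections U i, X p = v}

/-- A Goursat distribution of rank 2: at every point the dimensions of `D_1, D_2, D_3, …` are
`2, 3, 4, …`, growing by one until they reach the dimension `d` of the manifold. -/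
def IsGoursat (D : RankTwoDistribution d M) : Prop :=
  ∀ i : ℕ, 1 ≤ i → i + 1 ≤ d → ∀ p : M, finrank ℝ (D.lieSquareFlag i p) = i + 1

/-- The generic (regular) points of `D`: those near which the dimension of every term `D^i` of the
small derived flag is constant. -/
def genericPoints (D : RankTwoDistribution d M) : Set M :=
  {p | ∃ U : Set M, IsOpen U ∧ p ∈ U ∧
    ∀ i : ℕ, ∀ q ∈ U, finrank ℝ (D.derivedFlag i q) = finrank ℝ (D.derivedFlag i p)}

/-- `X` is an infinitesimal symmetry of `D` on the open set `U`: `[X, D] ⊆ D`. -/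
def IsInfinitesimalSymmetryOn (D : RankTwoDistribution d M) (U : Set M) (X : VField d M) : Prop :=
  X.SmoothOn U ∧ ∀ V : Set M, IsOpen V → V ⊆ U → ∀ Y : VField d M, D.IsSectionOn V Y →
    ∀ q ∈ V, VectorField.mlieBracket (𝓡 d) X Y q ∈ D.fiber q

end

end RankTwoDistribution

/-- `q` and `q'` lie on the same integral curve of `X` inside `U`. -/
def SameIntegralCurve {d : ℕ} {M : Type*} [TopologicalSpace M]
    [ChartedSpace (EuclideanSpace ℝ (Fin d)) M]
    (X : VField d M) (U : Set M) (q q' : M) : Prop :=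
  ∃ (γ : ℝ → M) (a b : ℝ), (∀ t ∈ uIcc a b, γ t ∈ U) ∧ IsMIntegralCurveOn γ X (uIcc a b) ∧
    γ a = q ∧ γ b = q'

/-- `π` exhibits the `e`-dimensional manifold `N` as the quotient of `U` by the foliation of
integral curves of the nowhere vanishing field `X`: it restricts to a smooth surjective submersion
`U → N` whose fibres are exactly the integral curves of `X` in `U`. -/
structure IsQuotientByIntegralCurves {d e : ℕ} {M N : Type*} [TopologicalSpace M]
    [ChartedSpace (EuclideanSpace ℝ (Fin d)) M] [TopologicalSpace N]
    [ChartedSpace (EuclideanSpace ℝ (Fin e)) N]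
    (X : VField d M) (U : Set M) (π : M → N) : Prop where
  ne_zero : ∀ q ∈ U, X q ≠ 0
  smooth : ContMDiffOn (𝓡 d) (𝓡 e) ∞ π U
  submersion : ∀ q ∈ U, Function.Surjective (mfderiv (𝓡 d) (𝓡 e) π q)
  surjective : π '' U = univ
  fibres : ∀ q ∈ U, ∀ q' ∈ U, π q = π q' ↔ SameIntegralCurve X U q q'

/-- Factorization of `U` by the foliation of integral curves of `X` sends `D` to a Goursat
distribution `E` on the quotient manifold `N` (of dimension `e`). -/
def SendsToGoursat (e : ℕ) {d : ℕ} {M : Type*} [TopologicalSpace M]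
    [ChartedSpace (EuclideanSpace ℝ (Fin d)) M] [IsManifold (𝓡 d) ∞ M]
    (D : RankTwoDistribution d M) (U : Set M) (X : VField d M) : Prop :=
  ∃ (N : Type) (_ : TopologicalSpace N) (_ : ChartedSpace (EuclideanSpace ℝ (Fin e)) N)
    (_ : IsManifold (𝓡 e) ∞ N) (_ : T2Space N) (π : M → N) (E : RankTwoDistribution e N),
    IsQuotientByIntegralCurves (e := e) X U π ∧
    (∀ q ∈ U, (D.fiber q).map (mfderiv (𝓡 d) (𝓡 e) π q).toLinearMap = E.fiber (π q)) ∧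
    E.IsGoursat

/-! ### Distributions associated with Lagrangians

The space `J^n(ℝ, ℝ) × ℝ` is `ℝ^{n+3}` with coordinates `(x, y_0, …, y_n, z)`, in this order. The jet
space `J^n(ℝ, ℝ)`, with coordinates `(x, y_0, …, y_n)`, is `ℝ × ℝ^{n+1}`. -/

/-- The projection `(x, y_0, …, y_n, z) ↦ (x, y_0, …, y_n)`. -/
def jetPart {n : ℕ} (w : EuclideanSpace ℝ (Fin (n + 3))) : ℝ × (Fin (n + 1) → ℝ) :=
  (w 0, fun i => w i.castSucc.succ)

/-- `∂²f / ∂y_n²` at `(x, y_0, …, y_n)`. -/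
def secondTopPartial {n : ℕ} (f : ℝ × (Fin (n + 1) → ℝ) → ℝ) (j : ℝ × (Fin (n + 1) → ℝ)) : ℝ :=
  iteratedDeriv 2 (fun t : ℝ => f (j.1, Function.update j.2 (Fin.last n) t)) (j.2 (Fin.last n))

/-- `X₁ = ∂/∂x + y_1 ∂/∂y_0 + … + y_n ∂/∂y_{n-1} + f ∂/∂z`. -/
def lagrangianField₁ {n : ℕ} (f : ℝ × (Fin (n + 1) → ℝ) → ℝ) (w : EuclideanSpace ℝ (Fin (n + 3))) :
    EuclideanSpace ℝ (Fin (n + 3)) :=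
  EuclideanSpace.single 0 1
    + (∑ i : Fin n, (jetPart w).2 i.succ •
        EuclideanSpace.single (i.castSucc.castSucc.succ : Fin (n + 3)) (1 : ℝ))
    + f (jetPart w) • EuclideanSpace.single (Fin.last (n + 2)) 1

/-- `X₂ = ∂/∂y_n`. -/
def lagrangianField₂ (n : ℕ) : EuclideanSpace ℝ (Fin (n + 3)) :=
  EuclideanSpace.single ((Fin.last n).castSucc.succ : Fin (n + 3)) 1

/-- Near `p` the distribution `D` is associated with a Lagrangian `f(x, y, …, y^{(n)}) dx` satisfying
`∂²f/∂y_n² ≠ 0`: there are smooth local coordinates `(x, y_0, …, y_n, z)` around `p` in which `D` is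
spanned by `X₁` and `X₂`. -/
def IsLagrangianNear {n : ℕ} {M : Type*} [TopologicalSpace M]
    [ChartedSpace (EuclideanSpace ℝ (Fin (n + 3))) M] [IsManifold (𝓡 (n + 3)) ∞ M]
    (D : RankTwoDistribution (n + 3) M) (p : M) : Prop :=
  ∃ (Ω : Set (ℝ × (Fin (n + 1) → ℝ))) (f : ℝ × (Fin (n + 1) → ℝ) → ℝ),
    IsOpen Ω ∧ ContDiffOn ℝ ∞ f Ω ∧ (∀ j ∈ Ω, secondTopPartial f j ≠ 0) ∧
    ∃ φ ∈ IsManifold.maximalAtlas (𝓡 (n + 3)) ∞ M, p ∈ φ.source ∧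
      ∀ q ∈ φ.source, jetPart (φ q) ∈ Ω ∧
        (D.fiber q).map (mfderiv (𝓡 (n + 3)) (𝓡 (n + 3)) φ q).toLinearMap =
          (Submodule.span ℝ {lagrangianField₁ f (φ q), lagrangianField₂ n} :
            Submodule ℝ (EuclideanSpace ℝ (Fin (n + 3))))

end

/-! The distribution of a Lagrangian is the contact distribution on the jet space with one extra
coordinate `z`, whose velocity is `f`. Since `f` does not involve `z`, the field `∂/∂z` is a
symmetry, and dividing by it gives back the contact distribution. The two conditions in (B) record
the nondegeneracy of `f`: one has `[X₂, [X₂, X₁]] = (∂²f/∂y_n²) ∂/∂z`, so if this derivative is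
nonzero then `∂/∂z` lies in `D^3`, and together with `X₁`, `X₂`, `∂/∂y_{n-1}` and `∂/∂y_{n-2}` it
makes `dim D^3 = 5`. This settles (A) ⇒ (B) (`exists_symmetry_of_isLagrangianNear`).

For (B) ⇒ (A) the Goursat distribution `E` on the quotient must be brought to contact form near
`π(p)`. The Goursat condition constrains only the Lie squares `E_i`, and by itself it allows
singular points at which the contact normal form fails; genericity of `p` excludes them. The kernel
of `dπ` is spanned by `X`, which lies in `D^3` and hence in every `D^i` with `i ≥ 3`, so for these
`i` the dimension of `E^i` at `π(q)` is `dim D^i(q) - 1`, and it is locally constant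
(`eventually_finrank_wordSpan_of_related`). With constant ranks, an equality `E^{i+1} = E^i` would
make `E^i` involutive and would stop the Lie squares as well. Hence the small growth vector is `2,
3, …, n + 2`, the two flags agree, and iterated brackets provide an adapted frame `g 0, …, g (n +
1)` (`exists_isGoursatFrame`).

The Goursat normal form (`exists_jet_coordinates`) is then built from two first integrals. The
hyperplane field spanned by `g 0, …, g n` has an involutive Cauchy characteristic of rank `n - 1`,
and `x` is a first integral of it with `dx(g 0) = 1` at the point. The components of `g 1, …, g n`
along `ker dx` again span an involutive bundle, and `y = y_0` is a first integral of that. The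
functions `y_k` are the successive total derivatives of `y`. The matrix of the `dy_k` on the
vertical fields is triangular, and a zero on its diagonal would contradict the growth of the small
flag, so `x, y_0, …, y_n` are coordinates.

Upstairs, the pulled back functions satisfy the contact relations on `D`, and `(dx, dy_n)` is
injective on `D` because `X` is transversal to `D`. Let `T` and `Y` be the sections of `D` with
`(dx, dy_n)` equal to `(1, 0)` and `(0, 1)`. Their brackets with the symmetry `X` lie in `D` and are
killed by `dx` and `dy_n`, so they vanish. A function `z` with `Xz = 1` and `Yz = 0` completes the
coordinates. There `X = ∂/∂z`, `Y = ∂/∂y_n`, and the Lagrangian is `f = Tz`, which is independent of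
`z` because `X` and `T` commute. Finally `dim D^3 = 5` forces `∂²f/∂y_n² ≠ 0`.

Openness of the generic set is immediate; density follows from lower semicontinuity of ranks
(`dense_genericPoints`). The analytic input is the Frobenius theorem (`exists_firstIntegral`),
deduced from smooth flows of commuting fields, which are obtained by the inverse function theorem in
a Banach space of curves. -/

noncomputable section

/-! ### The superposition operator on spaces of continuous maps -/

section Superposition

variable {K E F : Type} [TopologicalSpace K] [CompactSpace K]
  [NormedAddCommGroup E] [NormedSpace ℝ E] [NormedAddCommGroup F] [NormedSpace ℝ F]

/-- Pointwise application of a continuous family of operators to a continuous map. -/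
def ContinuousMap.applyCLM : C(K, E →L[ℝ] F) →L[ℝ] C(K, E) →L[ℝ] C(K, F) :=
  LinearMap.mkContinuous₂
    (LinearMap.mk₂ ℝ (fun (A : C(K, E →L[ℝ] F)) (h : C(K, E)) =>
        (⟨fun t => A t (h t), A.continuous.clm_apply h.continuous⟩ : C(K, F)))
      (fun A B h => by ext t; simp) (fun c A h => by ext t; simp)
      (fun A h k => by ext t; simp) (fun c A h => by ext t; simp)) 1
    (fun A h => by
      rw [one_mul, ContinuousMap.norm_le _ (by positivity)]
      intro t
      exact (A t).le_opNorm_of_le (h.norm_coe_le_norm t) |>.trans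
        (by gcongr; exact A.norm_coe_le_norm t))

@[simp] theorem ContinuousMap.applyCLM_apply (A : C(K, E →L[ℝ] F)) (h : C(K, E)) (t : K) :
    ContinuousMap.applyCLM A h t = A t (h t) := rfl

/-- The mean value inequality on the segment from `γ t` to `γ t + h t` bounds the remainder. The
bound is uniform in `t` because postcomposition with `fderiv ℝ g` is continuous for the sup norm,
which controls the oscillation of the derivative on all these segments at once. -/
theorem hasFDerivAt_superposition {g : E → F} (hg : ContDiff ℝ 1 g) (γ : C(K, E)) :
    HasFDerivAt (fun γ : C(K, E) => (⟨g, hg.continuous⟩ : C(E, F)).comp γ)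
      (ContinuousMap.applyCLM
        ((⟨fderiv ℝ g, hg.continuous_fderiv one_ne_zero⟩ : C(E, E →L[ℝ] F)).comp γ)) γ := by
  set G : C(E, E →L[ℝ] F) := ⟨fderiv ℝ g, hg.continuous_fderiv one_ne_zero⟩
  have hcont : Continuous fun γ : C(K, E) => G.comp γ := ContinuousMap.continuous_postcomp G
  rw [hasFDerivAt_iff_isLittleO_nhds_zero, Asymptotics.isLittleO_iff]
  intro ε hε
  obtain ⟨δ, hδ, hd⟩ := Metric.continuous_iff (α := C(K, E)) (β := C(K, E →L[ℝ] F)).1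
    hcont γ ε hε
  filter_upwards [Metric.ball_mem_nhds (0 : C(K, E)) hδ] with h hh
  rw [ContinuousMap.norm_le _ (by positivity)]
  intro t
  have key := (convex_segment (γ t) (γ t + h t)).norm_image_sub_le_of_norm_hasFDerivWithin_le'
    (f := g) (f' := fderiv ℝ g) (φ := fderiv ℝ g (γ t)) (C := ε)
    (fun x _ => (hg.differentiable one_ne_zero x).hasFDerivAt.hasFDerivWithinAt)
    (fun x hx => by
      rw [segment_eq_image'] at hx
      obtain ⟨θ, hθ, rfl⟩ := hx
      have h1 : dist (γ + θ • h) γ < δ := by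
        rw [dist_eq_norm, add_sub_cancel_left, norm_smul, Real.norm_of_nonneg hθ.1]
        rw [mem_ball_zero_iff] at hh
        exact (mul_le_of_le_one_left (norm_nonneg h) hθ.2).trans_lt hh
      have h2 := ContinuousMap.norm_coe_le_norm (G.comp (γ + θ • h) - G.comp γ) t
      have h3 : ‖G.comp (γ + θ • h) - G.comp γ‖ < ε :=
        (dist_eq_norm (G.comp (γ + θ • h)) (G.comp γ)).symm.trans_lt (hd _ h1)
      have : (G.comp (γ + θ • h) - G.comp γ) t
          = fderiv ℝ g (γ t + θ • (γ t + h t - γ t)) - fderiv ℝ g (γ t) := by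
        simp [G]
      rw [← this]
      exact h2.trans h3.le)
    (left_mem_segment ℝ _ _) (right_mem_segment ℝ _ _)
  simp only [add_sub_cancel_left] at key
  refine le_trans (le_of_eq ?_) (key.trans (mul_le_mul_of_nonneg_left (h.norm_coe_le_norm t) hε.le))
  simp [G]

/-- The derivative is the superposition operator of `fderiv ℝ g` followed by the continuous linear
map `applyCLM`, so each order of differentiability yields the next. The target `F` varies in the
induction because it becomes `E →L[ℝ] F`. -/
theorem contDiff_superposition_nat (n : ℕ) : ∀ {F : Type} [NormedAddCommGroup F]
    [NormedSpace ℝ F] {g : E → F} (hg : ContDiff ℝ ∞ g),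
    ContDiff ℝ n (fun γ : C(K, E) => (⟨g, hg.continuous⟩ : C(E, F)).comp γ) := by
  induction n with
  | zero =>
    intro F _ _ g hg
    exact contDiff_zero.2 (ContinuousMap.continuous_postcomp _)
  | succ n ih =>
    intro F _ _ g hg
    have hg' : ContDiff ℝ ∞ (fderiv ℝ g) := hg.fderiv_right (by simp)
    rw [Nat.cast_succ, contDiff_succ_iff_hasFDerivAt]
    exact ⟨fun γ => ContinuousMap.applyCLM ((⟨fderiv ℝ g, hg'.continuous⟩ : C(E, E →L[ℝ] F)).comp γ),
      (by fun_prop : ContDiff ℝ n fun A : C(K, E →L[ℝ] F) => ContinuousMap.applyCLM A).comp (ih hg'),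
      fun γ => hasFDerivAt_superposition (hg.of_le (by simp)) γ⟩

theorem contDiff_superposition {g : E → F} (hg : ContDiff ℝ ∞ g) :
    ContDiff ℝ ∞ (fun γ : C(K, E) => (⟨g, hg.continuous⟩ : C(E, F)).comp γ) :=
  contDiff_infty.2 fun n => contDiff_superposition_nat n hg

end Superposition

/-! ### Integration of curves -/

section Primitive

variable {F : Type} [NormedAddCommGroup F] [NormedSpace ℝ F] 

/-- The primitive vanishing at `0` of a continuous curve on `[0, 1]`. -/
def primitiveCLM : C(unitInterval, F) →L[ℝ] C(unitInterval, F) :=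
  LinearMap.mkContinuous
    { toFun := fun γ => ⟨fun t => ∫ τ in (0 : ℝ)..t, IccExtend zero_le_one γ τ, by
        have hc : Continuous (IccExtend zero_le_one γ : ℝ → F) := γ.continuous.Icc_extend'
        exact (intervalIntegral.continuous_primitive
          (fun a b => hc.intervalIntegrable a b) 0).comp continuous_subtype_val⟩
      map_add' := fun γ η => by
        ext t
        have hc : Continuous (IccExtend zero_le_one γ : ℝ → F) := γ.continuous.Icc_extend'
        have hd : Continuous (IccExtend zero_le_one η : ℝ → F) := η.continuous.Icc_extend'
        exact intervalIntegral.integral_add (hc.intervalIntegrable _ _) (hd.intervalIntegrable _ _)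
      map_smul' := fun c γ => by
        ext t
        exact intervalIntegral.integral_smul c _ }
    1 (fun γ => by
      rw [one_mul, ContinuousMap.norm_le _ (by positivity)]
      intro t
      refine (intervalIntegral.norm_integral_le_of_norm_le_const (C := ‖γ‖)
        (fun x _ => γ.norm_coe_le_norm _)).trans ?_
      rw [sub_zero, abs_of_nonneg t.2.1]
      exact mul_le_of_le_one_right (norm_nonneg γ) t.2.2)

theorem hasDerivAt_primitive [CompleteSpace F] (γ : C(unitInterval, F)) (t : ℝ) :
    HasDerivAt (fun t : ℝ => ∫ τ in (0 : ℝ)..t, IccExtend zero_le_one γ τ)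
      (IccExtend zero_le_one γ t) t := by
  have hc : Continuous (IccExtend zero_le_one γ : ℝ → F) := γ.continuous.Icc_extend'
  exact intervalIntegral.integral_hasDerivAt_right (hc.intervalIntegrable _ _)
    (hc.stronglyMeasurableAtFilter _ _) hc.continuousAt

end Primitive

/-! ### Functions that are smooth near a point -/

section SmoothNear

variable {E F G H : Type} [NormedAddCommGroup E] [NormedSpace ℝ E] [NormedAddCommGroup F]
  [NormedSpace ℝ F] [NormedAddCommGroup G] [NormedSpace ℝ G]
  [NormedAddCommGroup H] [NormedSpace ℝ H]

/-- The function `f` is `C^∞` at all points of a neighbourhood of `p`. -/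
def SmoothNear (f : E → F) (p : E) : Prop := ∀ᶠ q in 𝓝 p, ContDiffAt ℝ ∞ f q

variable {f g : E → F} {p : E}

theorem ContDiff.smoothNear (hf : ContDiff ℝ ∞ f) : SmoothNear f p :=
  Filter.Eventually.of_forall fun _ => hf.contDiffAt

theorem ContDiffOn.smoothNear {s : Set E} (hf : ContDiffOn ℝ ∞ f s) (hs : s ∈ 𝓝 p) :
    SmoothNear f p := by
  filter_upwards [eventually_mem_nhds_iff.2 hs] with q hq using hf.contDiffAt hq

namespace SmoothNear

theorem const (c : F) : SmoothNear (fun _ : E => c) p := contDiff_const.smoothNear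

theorem contDiffAt (hf : SmoothNear f p) : ContDiffAt ℝ ∞ f p := hf.self_of_nhds

theorem differentiableAt (hf : SmoothNear f p) : DifferentiableAt ℝ f p :=
  hf.contDiffAt.differentiableAt (by simp)

theorem hasFDerivAt (hf : SmoothNear f p) : HasFDerivAt f (fderiv ℝ f p) p :=
  hf.differentiableAt.hasFDerivAt

theorem continuousAt (hf : SmoothNear f p) : ContinuousAt f p := hf.contDiffAt.continuousAt

theorem eventually (hf : SmoothNear f p) : ∀ᶠ q in 𝓝 p, SmoothNear f q :=
  eventually_eventually_nhds.2 hf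

theorem congr (hf : SmoothNear f p) (h : g =ᶠ[𝓝 p] f) : SmoothNear g p := by
  filter_upwards [hf, h.eventually_nhds] with q h1 h2 using h1.congr_of_eventuallyEq h2

theorem add (hf : SmoothNear f p) (hg : SmoothNear g p) : SmoothNear (fun x => f x + g x) p := by
  filter_upwards [hf, hg] with q h1 h2 using h1.add h2

theorem sub (hf : SmoothNear f p) (hg : SmoothNear g p) : SmoothNear (fun x => f x - g x) p := by
  filter_upwards [hf, hg] with q h1 h2 using h1.sub h2

theorem smul {c : E → ℝ} (hc : SmoothNear c p) (hg : SmoothNear g p) :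
    SmoothNear (fun x => c x • g x) p := by
  filter_upwards [hc, hg] with q h1 h2 using h1.smul h2

theorem mul {c d : E → ℝ} (hc : SmoothNear c p) (hd : SmoothNear d p) :
    SmoothNear (fun x => c x * d x) p := by
  filter_upwards [hc, hd] with q h1 h2 using h1.mul h2

theorem inv {c : E → ℝ} (hc : SmoothNear c p) (h0 : c p ≠ 0) :
    SmoothNear (fun x => (c x)⁻¹) p := by
  filter_upwards [hc, hc.continuousAt.eventually_ne h0] with q h1 h2 using h1.inv h2

theorem sum {ι : Type*} {s : Finset ι} {f : ι → E → F} (hf : ∀ i ∈ s, SmoothNear (f i) p) :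
    SmoothNear (fun x => ∑ i ∈ s, f i x) p := by
  have : ∀ᶠ q in 𝓝 p, ∀ i ∈ s, ContDiffAt ℝ ∞ (f i) q := (Filter.eventually_all_finset s).2 hf
  filter_upwards [this] with q h using ContDiffAt.sum h

theorem comp {k : F → G} (hk : SmoothNear k (f p)) (hf : SmoothNear f p) :
    SmoothNear (fun x => k (f x)) p := by
  filter_upwards [hf, hf.continuousAt.eventually hk] with q h1 h2 using h2.comp q h1

theorem clm_apply {A : E → F →L[ℝ] G} (hA : SmoothNear A p) (hf : SmoothNear f p) :
    SmoothNear (fun x => A x (f x)) p := by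
  filter_upwards [hA, hf] with q h1 h2 using h1.clm_apply h2

theorem clm_comp {A : E → G →L[ℝ] H} {B : E → F →L[ℝ] G} (hA : SmoothNear A p)
    (hB : SmoothNear B p) : SmoothNear (fun x => (A x).comp (B x)) p := by
  filter_upwards [hA, hB] with q h1 h2 using h1.clm_comp h2

theorem prodMk {k : E → G} (hf : SmoothNear f p) (hk : SmoothNear k p) :
    SmoothNear (fun x => (f x, k x)) p := by
  filter_upwards [hf, hk] with q h1 h2 using h1.prodMk h2

theorem clm (L : F →L[ℝ] G) (hf : SmoothNear f p) : SmoothNear (fun x => L (f x)) p := by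
  filter_upwards [hf] with q h1 using L.contDiff.contDiffAt.comp q h1

theorem fderiv (hf : SmoothNear f p) : SmoothNear (fderiv ℝ f) p := by
  filter_upwards [hf] with q h1 using h1.fderiv_right (by simp)

theorem lieBracket {V W : E → E} (hV : SmoothNear V p) (hW : SmoothNear W p) :
    SmoothNear (VectorField.lieBracket ℝ V W) p := by
  filter_upwards [hV, hW] with q h1 h2 using h1.lieBracket_vectorField h2 (by simp)

theorem fderiv_apply {V : E → E} (hf : SmoothNear f p) (hV : SmoothNear V p) :
    SmoothNear (fun x => _root_.fderiv ℝ f x (V x)) p := hf.fderiv.clm_apply hV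

theorem pi {n : ℕ} {f : Fin n → E → ℝ} (hf : ∀ i, SmoothNear (f i) p) :
    SmoothNear (fun x i => f i x) p := by
  filter_upwards [Filter.eventually_all.2 hf] with q h using contDiffAt_pi.2 h

theorem inverse [CompleteSpace F] {A : E → F →L[ℝ] G} (hA : SmoothNear A p)
    (hp : (A p).IsInvertible) :
    SmoothNear (fun x => (A x).inverse) p ∧ ∀ᶠ x in 𝓝 p, (A x).IsInvertible := by
  have h1 : ∀ᶠ x in 𝓝 p, (A x).IsInvertible := by
    obtain ⟨e, he⟩ := hp
    have := ContinuousLinearEquiv.nhds e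
    rw [he] at this
    filter_upwards [hA.continuousAt.eventually this] with x hx
    obtain ⟨e', he'⟩ := hx
    exact ⟨e', he'⟩
  refine ⟨?_, h1⟩
  filter_upwards [h1, hA] with x hx hx'
  exact hx.contDiffAt_map_inverse.comp x hx'

/-- A function that is smooth near a point agrees near this point with a smooth function. -/
theorem exists_contDiff [FiniteDimensional ℝ E] (hf : SmoothNear f p) :
    ∃ g : E → F, ContDiff ℝ ∞ g ∧ g =ᶠ[𝓝 p] f := by
  obtain ⟨r, hr, hball⟩ := Metric.eventually_nhds_iff_ball.1 hf
  let χ : ContDiffBump p := ⟨r / 4, r / 2, by positivity, by linarith⟩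
  refine ⟨fun x => χ x • f x, ?_, ?_⟩
  · rw [contDiff_iff_contDiffAt]
    intro x
    by_cases hx : x ∈ Metric.ball p r
    · exact χ.contDiffAt.smul (hball x hx)
    · have h0 : (fun x => χ x • f x) =ᶠ[𝓝 x] fun _ => 0 := by
        have : x ∉ tsupport χ := by
          rw [χ.tsupport_eq]
          intro h
          exact hx (Metric.closedBall_subset_ball (by change r / 2 < r; linarith) h)
        filter_upwards [(isClosed_tsupport χ).isOpen_compl.mem_nhds this] with y hy
        rw [image_eq_zero_of_notMem_tsupport hy, zero_smul]
      exact contDiffAt_const.congr_of_eventuallyEq h0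
  · filter_upwards [χ.eventuallyEq_one] with x hx
    rw [hx]; simp

/-- The inverse function theorem for functions that are smooth near a point. -/
theorem exists_localInverse [CompleteSpace E] {f : E → F} (hf : SmoothNear f p)
    (hp : (_root_.fderiv ℝ f p).IsInvertible) :
    ∃ e : OpenPartialHomeomorph E F, (e : E → F) = f ∧ p ∈ e.source ∧
      ContDiffOn ℝ ∞ e e.source ∧ ContDiffOn ℝ ∞ e.symm e.target ∧
      ∀ q ∈ e.source, (_root_.fderiv ℝ e q).IsInvertible := by
  obtain ⟨f', hf'⟩ := hp
  have hd : HasFDerivAt f (f' : E →L[ℝ] F) p := by rw [hf']; exact hf.hasFDerivAt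
  let e₀ := hf.contDiffAt.toOpenPartialHomeomorph f hd (by simp)
  have hinv := (hf.fderiv.inverse ⟨f', hf'⟩).2
  -- The local homeomorphism is cut down to an open set on which `f` is smooth with invertible
  -- derivative, so that the inverse is smooth on the whole target.
  obtain ⟨s, hs, hso, hps⟩ := eventually_nhds_iff.1 (hf.and hinv)
  have hsource : (e₀.restr s).source = e₀.source ∩ s := by
    rw [OpenPartialHomeomorph.restr_source, hso.interior_eq]
  have key : ∀ q ∈ (e₀.restr s).source,
      ContDiffAt ℝ ∞ f q ∧ (_root_.fderiv ℝ f q).IsInvertible := by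
    intro q hq
    rw [hsource] at hq
    exact hs q hq.2
  refine ⟨e₀.restr s, rfl, ?_, ?_, ?_, ?_⟩
  · rw [hsource]
    exact ⟨hf.contDiffAt.mem_toOpenPartialHomeomorph_source hd (by simp), hps⟩
  · intro q hq
    exact (key q hq).1.contDiffWithinAt
  · intro y hy
    obtain ⟨h1, g', hg'⟩ := key _ ((e₀.restr s).map_target hy)
    refine ((e₀.restr s).contDiffAt_symm (f₀' := g') hy ?_ h1).contDiffWithinAt
    rw [hg']
    exact (h1.differentiableAt (by simp)).hasFDerivAt
  · intro q hq
    exact (key q hq).2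

end SmoothNear

end SmoothNear

/-! ### Solutions of commuting systems and their smooth dependence on the data -/

section CommutingFlow

variable {V F : Type} [NormedAddCommGroup V] [NormedSpace ℝ V]
  [NormedAddCommGroup F] [NormedSpace ℝ F]

/-- Constant curves. -/
def constCurveCLM (V : Type) [NormedAddCommGroup V] [NormedSpace ℝ V] :
    V →L[ℝ] C(unitInterval, V) :=
  LinearMap.mkContinuous
    { toFun := fun v => ContinuousMap.const _ v
      map_add' := fun _ _ => rfl
      map_smul' := fun _ _ => rfl } 1
    (fun v => by
      rw [one_mul, ContinuousMap.norm_le _ (by positivity)]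
      intro t
      exact le_rfl)

@[simp] theorem constCurveCLM_apply (v : V) (t : unitInterval) : constCurveCLM V v t = v := rfl

/-- The curve `t ↦ (v, γ t)`. -/
def pairCurveCLM (V F : Type) [NormedAddCommGroup V] [NormedSpace ℝ V]
    [NormedAddCommGroup F] [NormedSpace ℝ F] :
    (V × C(unitInterval, F)) →L[ℝ] C(unitInterval, V × F) :=
  LinearMap.mkContinuous
    { toFun := fun x => (ContinuousMap.const _ x.1).prodMk x.2
      map_add' := fun _ _ => rfl
      map_smul' := fun _ _ => rfl } 1
    (fun x => by
      rw [one_mul, ContinuousMap.norm_le _ (by positivity)]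
      intro t
      exact max_le_max le_rfl (x.2.norm_coe_le_norm t))

@[simp] theorem pairCurveCLM_apply (x : V × C(unitInterval, F)) (t : unitInterval) :
    pairCurveCLM V F x t = (x.1, x.2 t) := rfl

/-- Let `η` solve the linearized equation along a solution `γ` of `γ' = Z(γ) u`, with source term
`Z(γ) v`. If the fields commute along `γ`, then `η(t) = t Z(γ(t)) v`. -/
theorem variation_eq_of_commute [CompleteSpace F] {Z : F → V →L[ℝ] F} (hZ : ContDiff ℝ ∞ Z)
    {u v : V} {s : F} {γ η a b : C(unitInterval, F)}
    (ha : ∀ t, a t = Z (γ t) u) (hb : ∀ t, b t = fderiv ℝ Z (γ t) (η t) u + Z (γ t) v)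
    (hγ : γ = constCurveCLM F s + primitiveCLM a) (hη : η = primitiveCLM b)
    (hcomm : ∀ t, fderiv ℝ Z (γ t) (Z (γ t) u) v = fderiv ℝ Z (γ t) (Z (γ t) v) u) :
    η 1 = Z (γ 1) v := by
  have hγ' : ∀ t : unitInterval, γ t = s + ∫ τ in (0 : ℝ)..t, IccExtend zero_le_one a τ :=
    fun t => by conv_lhs => rw [hγ]
                rfl
  have hη' : ∀ t : unitInterval, η t = ∫ τ in (0 : ℝ)..t, IccExtend zero_le_one b τ :=
    fun t => by conv_lhs => rw [hη]
                rfl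
  set γ₁ : ℝ → F := fun t => s + ∫ τ in (0 : ℝ)..t, IccExtend zero_le_one a τ
  set η₁ : ℝ → F := fun t => ∫ τ in (0 : ℝ)..t, IccExtend zero_le_one b τ
  have dγ : ∀ t, HasDerivAt γ₁ (IccExtend zero_le_one a t) t :=
    fun t => (hasDerivAt_primitive a t).const_add s
  have dη : ∀ t, HasDerivAt η₁ (IccExtend zero_le_one b t) t := fun t => hasDerivAt_primitive b t
  have dZ : ∀ t, HasDerivAt (fun t => Z (γ₁ t)) (fderiv ℝ Z (γ₁ t) (IccExtend zero_le_one a t)) t :=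
    fun t => ((hZ.differentiable (by simp)) (γ₁ t)).hasFDerivAt.comp_hasDerivAt t (dγ t)
  have dw : ∀ t, HasDerivAt (fun t => η₁ t - t • Z (γ₁ t) v)
      (IccExtend zero_le_one b t - (t • (fderiv ℝ Z (γ₁ t) (IccExtend zero_le_one a t) v)
        + (1 : ℝ) • Z (γ₁ t) v)) t := fun t =>
    (dη t).sub ((hasDerivAt_id t).smul
      ((((ContinuousLinearMap.apply ℝ F v).hasFDerivAt).comp_hasDerivAt t (dZ t))))
  have hcont : Continuous fun t : unitInterval => ‖fderiv ℝ Z (γ t)‖ :=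
    ((hZ.continuous_fderiv (by simp)).comp γ.continuous).norm
  obtain ⟨D, hD⟩ := isCompact_univ.exists_bound_of_continuousOn hcont.continuousOn
  -- The difference `w(t) = η(t) - t Z(γ(t)) v` starts at `0` and, by commutation, solves the linear
  -- equation `w' = DZ(γ)(w) u`. A Grönwall estimate makes it vanish on `[0, 1]`.
  have hw : ∀ x ∈ Icc (0 : ℝ) 1, η₁ x - x • Z (γ₁ x) v = 0 := by
    refine eq_zero_of_abs_deriv_le_mul_abs_self_of_eq_zero_right (K := D * ‖u‖)
      (f := fun t => η₁ t - t • Z (γ₁ t) v) (fun t _ => (dw t).continuousAt.continuousWithinAt)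
      (fun t _ => (dw t).hasDerivWithinAt) (by simp [η₁]) ?_
    intro t ht
    have ht' : t ∈ Icc (0 : ℝ) 1 := ⟨ht.1, ht.2.le⟩
    rw [IccExtend_of_mem _ _ ht', IccExtend_of_mem _ _ ht', ha, hb]
    have e1 : γ ⟨t, ht'⟩ = γ₁ t := hγ' _
    have e2 : η ⟨t, ht'⟩ = η₁ t := hη' _
    have hc := hcomm ⟨t, ht'⟩
    rw [e1] at hc
    rw [e1, e2, hc]
    have e3 : fderiv ℝ Z (γ₁ t) (η₁ t) u + Z (γ₁ t) v
        - (t • fderiv ℝ Z (γ₁ t) (Z (γ₁ t) v) u + (1 : ℝ) • Z (γ₁ t) v)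
        = fderiv ℝ Z (γ₁ t) (η₁ t - t • Z (γ₁ t) v) u := by
      simp only [map_sub, map_smul, sub_apply, smul_apply,
        one_smul]
      abel
    rw [e3]
    have e4 : ‖fderiv ℝ Z (γ₁ t)‖ ≤ D := by
      rw [← e1]; exact (le_abs_self _).trans (hD ⟨t, ht'⟩ (mem_univ _))
    calc _ ≤ ‖fderiv ℝ Z (γ₁ t) (η₁ t - t • Z (γ₁ t) v)‖ * ‖u‖ := ContinuousLinearMap.le_opNorm _ _
      _ ≤ (‖fderiv ℝ Z (γ₁ t)‖ * ‖η₁ t - t • Z (γ₁ t) v‖) * ‖u‖ := by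
        gcongr; exact ContinuousLinearMap.le_opNorm _ _
      _ ≤ (D * ‖η₁ t - t • Z (γ₁ t) v‖) * ‖u‖ := by gcongr
      _ = _ := by ring
  have h1 := hw 1 (by simp)
  have e1 : γ 1 = γ₁ 1 := hγ' 1
  have e2 : η 1 = η₁ 1 := hη' 1
  rw [e1, e2]
  rw [one_smul] at h1
  exact sub_eq_zero.1 h1

/-- The map whose zeros in the third component are the solution curves of `γ' = Z(γ) u`,
`γ(0) = s`. -/
def solutionMap (Z : F → V →L[ℝ] F) (hZ : ContDiff ℝ ∞ Z)
    (x : (V × F) × C(unitInterval, F)) : (V × F) × C(unitInterval, F) :=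
  (x.1, x.2 - (constCurveCLM F x.1.2 + primitiveCLM
    ((⟨fun y : V × F => Z y.2 y.1, ((hZ.comp contDiff_snd).clm_apply contDiff_fst).continuous⟩ :
      C(V × F, F)).comp (pairCurveCLM V F (x.1.1, x.2)))))

theorem contDiff_solutionMap (Z : F → V →L[ℝ] F) (hZ : ContDiff ℝ ∞ Z) :
    ContDiff ℝ ∞ (solutionMap Z hZ) := by
  have hg : ContDiff ℝ ∞ (fun y : V × F => Z y.2 y.1) :=
    (hZ.comp contDiff_snd).clm_apply contDiff_fst
  have h1 := contDiff_superposition (K := unitInterval) hg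
  have h2 : ContDiff ℝ ∞ (fun x : (V × F) × C(unitInterval, F) =>
      pairCurveCLM V F (x.1.1, x.2)) := by fun_prop
  have h3 := h1.comp h2
  have h4 : ContDiff ℝ ∞ (fun γ : C(unitInterval, F) => primitiveCLM γ) := by fun_prop
  have h5 := h4.comp h3
  exact contDiff_fst.prodMk (contDiff_snd.sub
    (ContDiff.add (by fun_prop) h5))

theorem fderiv_eval_pair {Z : F → V →L[ℝ] F} (hZ : ContDiff ℝ ∞ Z) (y : V × F) (v : V) (w : F) :
    fderiv ℝ (fun y : V × F => Z y.2 y.1) y (v, w) = fderiv ℝ Z y.2 w y.1 + Z y.2 v := by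
  have h1 : HasFDerivAt (fun y : V × F => Z y.2) ((fderiv ℝ Z y.2).comp
      (ContinuousLinearMap.snd ℝ V F)) y :=
    ((hZ.differentiable (by simp)) y.2).hasFDerivAt.comp y hasFDerivAt_snd
  have h2 := h1.clm_apply (hasFDerivAt_fst (p := y))
  rw [h2.fderiv]
  simp [add_comm]

/-- The integral equation `γ = s + ∫ Z(γ) u` is solved by the inverse function theorem in `C([0, 1],
F)`, with `u` and `s` as parameters, near the constant curve at `u = 0`. The flow is the value of
the solution at time `1`, so smooth dependence on `(u, s)` is automatic. Its derivative in `u`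
solves the linearized equation, and commutation identifies it with `Z`. -/
theorem exists_commuting_flow_of_contDiff [FiniteDimensional ℝ V] [FiniteDimensional ℝ F]
    {Z : F → V →L[ℝ] F} (hZ : ContDiff ℝ ∞ Z) {p : F}
    (hcomm : ∀ᶠ q in 𝓝 p, ∀ v w, fderiv ℝ Z q (Z q v) w = fderiv ℝ Z q (Z q w) v) :
    ∃ Fl : V × F → F, SmoothNear Fl (0, p) ∧ (∀ᶠ s in 𝓝 p, Fl (0, s) = s) ∧
      ∀ᶠ x in 𝓝 ((0, p) : V × F), ∀ v, fderiv ℝ Fl x (v, 0) = Z (Fl x) v := by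
  set C := C(unitInterval, F)
  have hg : ContDiff ℝ ∞ (fun y : V × F => Z y.2 y.1) :=
    (hZ.comp contDiff_snd).clm_apply contDiff_fst
  set g : C(V × F, F) := ⟨fun y : V × F => Z y.2 y.1, hg.continuous⟩ with hgdef
  set N : C(unitInterval, V × F) → C := fun γ => g.comp γ with hN
  have dN : ∀ γ, ∃ L : C(unitInterval, V × F) →L[ℝ] C, HasFDerivAt N L γ ∧
      ∀ δ t, L δ t = fderiv ℝ Z (γ t).2 (δ t).2 (γ t).1 + Z (γ t).2 (δ t).1 := fun γ =>
    ⟨_, hasFDerivAt_superposition (hg.of_le (by simp)) γ, fun δ t =>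
      fderiv_eval_pair hZ (γ t) (δ t).1 (δ t).2⟩
  set γ₀ : C := constCurveCLM F p
  set x₀ : (V × F) × C := ((0, p), γ₀) with hx₀
  have hS := contDiff_solutionMap Z hZ
  set A : V × F →L[ℝ] C := (constCurveCLM F).comp (ContinuousLinearMap.snd ℝ V F) +
    (primitiveCLM.comp ((constCurveCLM F).comp (Z p))).comp (ContinuousLinearMap.fst ℝ V F)
    with hA
  -- This is the derivative of the solution map at `x₀`. Since `Z(γ) u` is linear in `u` and `u = 0`
  -- there, it does not vary with `γ`; the derivative is therefore unipotent, and its inverse only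
  -- changes the sign of `A`.
  let S' : ((V × F) × C) ≃L[ℝ] ((V × F) × C) := ContinuousLinearEquiv.equivOfInverse
    ((ContinuousLinearMap.fst ℝ (V × F) C).prod (ContinuousLinearMap.snd ℝ (V × F) C
      - A.comp (ContinuousLinearMap.fst ℝ (V × F) C)))
    ((ContinuousLinearMap.fst ℝ (V × F) C).prod (ContinuousLinearMap.snd ℝ (V × F) C
      + A.comp (ContinuousLinearMap.fst ℝ (V × F) C)))
    (fun x => by simp) (fun x => by simp)
  have hNp : HasFDerivAt (fun x : (V × F) × C => N (pairCurveCLM V F (x.1.1, x.2)))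
      ((constCurveCLM F).comp ((Z p).comp ((ContinuousLinearMap.fst ℝ V F).comp
        (ContinuousLinearMap.fst ℝ (V × F) C)))) x₀ := by
    obtain ⟨L, hL, hL'⟩ := dN (pairCurveCLM V F (x₀.1.1, x₀.2))
    have h1 : HasFDerivAt (fun x : (V × F) × C => pairCurveCLM V F (x.1.1, x.2))
        ((pairCurveCLM V F).comp (((ContinuousLinearMap.fst ℝ V F).comp
        (ContinuousLinearMap.fst ℝ (V × F) C)).prod (ContinuousLinearMap.snd ℝ (V × F) C))) x₀ :=
      ((pairCurveCLM V F).comp (((ContinuousLinearMap.fst ℝ V F).comp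
        (ContinuousLinearMap.fst ℝ (V × F) C)).prod
          (ContinuousLinearMap.snd ℝ (V × F) C))).hasFDerivAt
    refine (hL.comp x₀ h1).congr_fderiv ?_
    ext x t
    · simp [hL', x₀, γ₀]
    · simp [hL', x₀, γ₀]
    · simp [hL', x₀, γ₀]
  have hS' : HasFDerivAt (solutionMap Z hZ) (S' : _ →L[ℝ] _) x₀ := by
    have h2 : HasFDerivAt (fun x : (V × F) × C => x.2 - (constCurveCLM F x.1.2 +
        primitiveCLM (N (pairCurveCLM V F (x.1.1, x.2))))) _ x₀ :=
      (ContinuousLinearMap.snd ℝ (V × F) C).hasFDerivAt.sub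
      ((((constCurveCLM F).comp ((ContinuousLinearMap.snd ℝ V F).comp
        (ContinuousLinearMap.fst ℝ (V × F) C))).hasFDerivAt).add
        ((primitiveCLM (F := F)).hasFDerivAt.comp x₀ hNp))
    exact (ContinuousLinearMap.fst ℝ (V × F) C).hasFDerivAt.prodMk h2
  obtain ⟨e, he, hxe, -, hes, -⟩ := (hS.smoothNear (p := x₀)).exists_localInverse
    ⟨S', hS'.fderiv.symm⟩
  have hN0 : ∀ γ, N (pairCurveCLM V F (0, γ)) = 0 := fun γ => by
    ext t; simp [N, g]
  have hSx₀ : solutionMap Z hZ x₀ = ((0, p), 0) := by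
    change (x₀.1, x₀.2 - (constCurveCLM F x₀.1.2 + primitiveCLM (N (pairCurveCLM V F _)))) = _
    simp only [x₀, hN0]
    simp [γ₀]
  have htarget : (((0, p), 0) : (V × F) × C) ∈ e.target := by
    rw [← hSx₀, ← he]; exact e.map_source hxe
  -- The solution curve with velocity parameter and initial point `x`: the preimage under the
  -- solution map of a point with vanishing last component.
  set Γ : V × F → C := fun x => (e.symm (x, 0)).2 with hΓ
  have hι : ContDiff ℝ ∞ (fun x : V × F => (x, (0 : C))) := contDiff_id.prodMk contDiff_const
  have hΓs : SmoothNear Γ (0, p) := by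
    have h1 : SmoothNear e.symm (((0, p), 0) : (V × F) × C) :=
      hes.smoothNear (e.open_target.mem_nhds htarget)
    have h2 : SmoothNear (fun x : V × F => e.symm (x, 0)) (0, p) :=
      h1.comp (f := fun x : V × F => (x, (0 : C))) hι.smoothNear
    exact h2.clm (ContinuousLinearMap.snd ℝ (V × F) C)
  have hΓeq : ∀ᶠ x in 𝓝 ((0, p) : V × F),
      Γ x = constCurveCLM F x.2 + primitiveCLM (N (pairCurveCLM V F (x.1, Γ x))) := by
    have hcι : ContinuousAt (fun x : V × F => (x, (0 : C))) (0, p) := hι.continuous.continuousAt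
    filter_upwards [hcι.eventually (e.open_target.mem_nhds htarget)] with x hx
    have h1 : solutionMap Z hZ (e.symm (x, 0)) = (x, 0) := by
      rw [← he]; exact e.right_inv hx
    have h2 : (e.symm (x, 0)).1 = x := congrArg Prod.fst h1
    have h3 : (e.symm (x, 0)).2 - (constCurveCLM F (e.symm (x, 0)).1.2 +
      primitiveCLM (N (pairCurveCLM V F ((e.symm (x, 0)).1.1, (e.symm (x, 0)).2)))) = 0 :=
      congrArg Prod.snd h1
    rw [h2] at h3
    exact sub_eq_zero.1 h3
  have hΓ0 : Γ (0, p) = γ₀ := by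
    have : e.symm ((0, p), 0) = x₀ := by
      rw [← hSx₀, ← he]; exact e.left_inv hxe
    simp only [hΓ, this, x₀]
  let ev : C →L[ℝ] F := ContinuousMap.evalCLM ℝ (1 : unitInterval)
  refine ⟨fun x => ev (Γ x), hΓs.clm ev, ?_, ?_⟩
  · have hc : ContinuousAt (fun s : F => ((0, s) : V × F)) p := by fun_prop
    filter_upwards [hc.eventually hΓeq] with s hs
    change Γ (0, s) 1 = s
    rw [hs, hN0, map_zero, add_zero]; rfl
  -- Closeness to the constant curve in the sup norm keeps the whole curve inside the neighbourhood
  -- of `p` on which the fields commute.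
  · have hnear : ∀ᶠ x in 𝓝 ((0, p) : V × F), ∀ t, ∀ v w,
        fderiv ℝ Z (Γ x t) (Z (Γ x t) v) w = fderiv ℝ Z (Γ x t) (Z (Γ x t) w) v := by
      obtain ⟨ε, hε, hball⟩ := Metric.eventually_nhds_iff_ball.1 hcomm
      have h1 : ∀ᶠ x in 𝓝 ((0, p) : V × F), Γ x ∈ Metric.ball γ₀ ε :=
        hΓs.continuousAt.eventually (by rw [hΓ0]; exact Metric.ball_mem_nhds _ hε)
      filter_upwards [h1] with x hx t
      apply hball
      rw [Metric.mem_ball] at hx ⊢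
      exact (ContinuousMap.dist_apply_le_dist t).trans_lt hx
    filter_upwards [hΓs, hΓeq, hΓeq.eventually_nhds, hnear] with x hsm heq heq' hcm v
    have hd : HasFDerivAt Γ (fderiv ℝ Γ x) x := (hsm.differentiableAt (by simp)).hasFDerivAt
    obtain ⟨L, hL, hL'⟩ := dN (pairCurveCLM V F (x.1, Γ x))
    have h1 : HasFDerivAt (fun x => pairCurveCLM V F (x.1, Γ x)) ((pairCurveCLM V F).comp
        ((ContinuousLinearMap.fst ℝ V F).prod (fderiv ℝ Γ x))) x :=
      (pairCurveCLM V F).hasFDerivAt.comp x (hasFDerivAt_fst.prodMk hd)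
    have h2 := (((constCurveCLM F).comp (ContinuousLinearMap.snd ℝ V F)).hasFDerivAt (x := x)).add
      ((primitiveCLM (F := F)).hasFDerivAt.comp x (hL.comp x h1))
    have h3 := (h2.congr_of_eventuallyEq heq').unique hd
    have h4 := congrArg (fun T : V × F →L[ℝ] C => T (v, 0)) h3
    have h5 : fderiv ℝ (fun x => ev (Γ x)) x (v, 0) = fderiv ℝ Γ x (v, 0) 1 := by
      have : HasFDerivAt (fun x => ev (Γ x)) (ev.comp (fderiv ℝ Γ x)) x := ev.hasFDerivAt.comp x hd
      rw [this.fderiv]; rfl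
    rw [h5]
    -- Differentiating the integral equation in the direction `(v, 0)` gives the linearized equation
    -- with source `Z(γ) v` and initial value `0`.
    refine variation_eq_of_commute hZ (u := x.1) (s := x.2)
      (a := N (pairCurveCLM V F (x.1, Γ x)))
      (b := L (pairCurveCLM V F (v, fderiv ℝ Γ x (v, 0)))) ?_ ?_ heq ?_ (fun t => hcm t _ _)
    · intro t; rfl
    · intro t; rw [hL']; rfl
    · refine h4.symm.trans ?_
      simp

/-- Local solvability, with smooth dependence on all data, of the system `∂_v Φ = Z(Φ) v`,
`Φ(0, s) = s` for a family of commuting vector fields. -/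
theorem exists_commuting_flow [FiniteDimensional ℝ V] [FiniteDimensional ℝ F]
    {Z : F → V →L[ℝ] F} {p : F} (hZ : SmoothNear Z p)
    (hcomm : ∀ᶠ q in 𝓝 p, ∀ v w, fderiv ℝ Z q (Z q v) w = fderiv ℝ Z q (Z q w) v) :
    ∃ Fl : V × F → F, SmoothNear Fl (0, p) ∧ (∀ᶠ s in 𝓝 p, Fl (0, s) = s) ∧
      ∀ᶠ x in 𝓝 ((0, p) : V × F), ∀ v, fderiv ℝ Fl x (v, 0) = Z (Fl x) v := by
  -- The superposition operator needs a globally smooth family. The germ at `p` suffices, since the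
  -- flow near `(0, p)` stays near `p`.
  obtain ⟨Z', hZ', heq⟩ := hZ.exists_contDiff
  have hcomm' : ∀ᶠ q in 𝓝 p, ∀ v w, fderiv ℝ Z' q (Z' q v) w = fderiv ℝ Z' q (Z' q w) v := by
    filter_upwards [hcomm, heq.eventually_nhds] with q h1 h2 v w
    replace h2 : Z' =ᶠ[𝓝 q] Z := h2
    rw [h2.fderiv_eq, h2.eq_of_nhds]
    exact h1 v w
  obtain ⟨Fl, h1, h2, h3⟩ := exists_commuting_flow_of_contDiff hZ' hcomm'
  refine ⟨Fl, h1, h2, ?_⟩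
  have h4 : ∀ᶠ x in 𝓝 ((0, p) : V × F), Z' (Fl x) = Z (Fl x) :=
    h1.continuousAt.eventually (by rw [h2.self_of_nhds]; exact heq)
  filter_upwards [h3, h4] with x h3 h4 v
  rw [h3, h4]

end CommutingFlow

/-! ### Rectification of commuting vector fields, moving frames -/

section Rectification

variable {V F : Type} [NormedAddCommGroup V] [NormedSpace ℝ V] [FiniteDimensional ℝ V]
  [NormedAddCommGroup F] [NormedSpace ℝ F] [FiniteDimensional ℝ F]

/-- Starting from the affine slice through `p` along the kernel of `P`, flow out with parameter `P
(q - p)`. The derivative of the flow in its parameter is `Z`, so this map carries the constant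
fields `Z p v` to the fields `Z · v`, and its derivative at `p` is the identity. `Ψ` is its local
inverse. -/
theorem exists_rectification {Z : F → V →L[ℝ] F} {p : F} (hZ : SmoothNear Z p)
    {P : F →L[ℝ] V} (hP : P.comp (Z p) = ContinuousLinearMap.id ℝ V)
    (hcomm : ∀ᶠ q in 𝓝 p, ∀ v w, fderiv ℝ Z q (Z q v) w = fderiv ℝ Z q (Z q w) v) :
    ∃ Ψ : F → F, SmoothNear Ψ p ∧ fderiv ℝ Ψ p = ContinuousLinearMap.id ℝ F ∧
      ∀ᶠ q in 𝓝 p, ∀ v, fderiv ℝ Ψ q (Z q v) = Z p v := by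
  obtain ⟨Fl, hFl, hFl0, hFld⟩ := exists_commuting_flow hZ hcomm
  have hP' : ∀ v, P (Z p v) = v := fun v => congrArg (fun T : V →L[ℝ] V => T v) hP
  set a' : F →L[ℝ] V × F := P.prod (ContinuousLinearMap.id ℝ F - (Z p).comp P) with ha'
  set a : F → V × F := fun q => (0, p) + a' (q - p) with ha
  have hap : a p = (0, p) := by simp [ha]
  have da : ∀ q, HasFDerivAt a a' q := fun q =>
    (a'.hasFDerivAt.comp q ((hasFDerivAt_id q).sub_const p)).const_add _
  have hacd : ContDiff ℝ ∞ a := by fun_prop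
  have hΦ : SmoothNear (fun q => Fl (a q)) p :=
    SmoothNear.comp (by rw [hap]; exact hFl) hacd.smoothNear
  set Φ : F → F := fun q => Fl (a q)
  have hac : Filter.Tendsto a (𝓝 p) (𝓝 (0, p)) := by
    rw [← hap]; exact hacd.continuous.continuousAt
  have hΦp : Φ p = p := by simp only [Φ, hap]; exact hFl0.self_of_nhds
  have dΦ : ∀ᶠ q in 𝓝 p, HasFDerivAt Φ ((fderiv ℝ Fl (a q)).comp a') q := by
    filter_upwards [hac.eventually hFl] with q hq
    exact (hq.differentiableAt (by simp)).hasFDerivAt.comp q (da q)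
  have hΦZ : ∀ᶠ q in 𝓝 p, ∀ v, fderiv ℝ Φ q (Z p v) = Z (Φ q) v := by
    filter_upwards [dΦ, hac.eventually hFld] with q h1 h2 v
    rw [h1.fderiv, ← h2 v]
    simp [ha', hP']
  have dΦp : fderiv ℝ Φ p = ContinuousLinearMap.id ℝ F := by
    have h1 : HasFDerivAt (fun s : F => Fl (0, s)) ((fderiv ℝ Fl (0, p)).comp
        (ContinuousLinearMap.inr ℝ V F)) p := by
      have := hFl.hasFDerivAt.comp p (hasFDerivAt_prodMk_right (𝕜 := ℝ) (0 : V) p)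
      exact this
    have h2 : HasFDerivAt (fun s : F => Fl (0, s)) (ContinuousLinearMap.id ℝ F) p :=
      (hasFDerivAt_id p).congr_of_eventuallyEq hFl0
    have h3 := h1.unique h2
    ext x
    rw [dΦ.self_of_nhds.fderiv, hap]
    have e1 : a' x = (P x, 0) + ContinuousLinearMap.inr ℝ V F (x - Z p (P x)) := by simp [ha']
    have e2 := congrArg (fun T : F →L[ℝ] F => T (x - Z p (P x))) h3
    simp only [ContinuousLinearMap.comp_apply, ContinuousLinearMap.id_apply] at e2 ⊢
    rw [e1, map_add, e2, hFld.self_of_nhds, hFl0.self_of_nhds]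
    abel
  obtain ⟨e, he, hpe, hes, hes', -⟩ := hΦ.exists_localInverse
    (by rw [dΦp]; exact ContinuousLinearMap.isInvertible_equiv (f := ContinuousLinearEquiv.refl ℝ F))
  have hpt : p ∈ e.target := by
    have := e.map_source hpe
    rwa [he, hΦp] at this
  have hsp : e.symm p = p := by
    have := e.left_inv hpe
    rwa [he, hΦp] at this
  have hΨ : SmoothNear e.symm p := hes'.smoothNear (e.open_target.mem_nhds hpt)
  have hinv : ∀ q ∈ e.target, (fderiv ℝ e.symm q).comp (fderiv ℝ Φ (e.symm q)) =
      ContinuousLinearMap.id ℝ F := by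
    intro q hq
    have h1 : HasFDerivAt e.symm (fderiv ℝ e.symm q) (Φ (e.symm q)) := by
      have h0 : Φ (e.symm q) = q := by rw [← he]; exact e.right_inv hq
      rw [h0]
      exact ((hes'.contDiffAt (e.open_target.mem_nhds hq)).differentiableAt (by simp)).hasFDerivAt
    have h2 : HasFDerivAt Φ (fderiv ℝ Φ (e.symm q)) (e.symm q) := by
      have := (hes.contDiffAt (e.open_source.mem_nhds (e.map_target hq))).differentiableAt (by simp)
      rw [he] at this
      exact this.hasFDerivAt
    have h3 : e.symm ∘ Φ =ᶠ[𝓝 (e.symm q)] id := by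
      rw [← he]; exact e.eventually_left_inverse (e.map_target hq)
    exact (h1.comp _ h2).unique ((hasFDerivAt_id _).congr_of_eventuallyEq h3)
  refine ⟨e.symm, hΨ, ?_, ?_⟩
  · have := hinv p hpt
    rwa [hsp, dΦp, ContinuousLinearMap.comp_id] at this
  · have hc : Filter.Tendsto e.symm (𝓝 p) (𝓝 p) := by
      have := hΨ.continuousAt
      rwa [ContinuousAt, hsp] at this
    filter_upwards [hc.eventually hΦZ, e.open_target.mem_nhds hpt] with q h1 h2 v
    have h3 := h1 v
    have h0 : Φ (e.symm q) = q := by rw [← he]; exact e.right_inv h2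
    rw [h0] at h3
    rw [← h3]
    exact congrArg (fun T : F →L[ℝ] F => T (Z p v)) (hinv q h2)

end Rectification

/-! ### Moving frames and smooth coordinate functionals -/

section Frames

variable {ι : Type} [Fintype ι] {E F : Type} [NormedAddCommGroup F] [NormedSpace ℝ F]

/-- The operator `v ↦ ∑ i, v i • k i q` determined by a family of vectors depending on `q`. -/
def frameMap (k : ι → E → F) (q : E) : (ι → ℝ) →L[ℝ] F :=
  ∑ i, (ContinuousLinearMap.proj (R := ℝ) i : (ι → ℝ) →L[ℝ] ℝ).smulRight (k i q)

theorem frameMap_apply (k : ι → E → F) (q : E) (v : ι → ℝ) :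
    frameMap k q v = ∑ i, v i • k i q := by
  simp [frameMap]

theorem frameMap_single [DecidableEq ι] (k : ι → E → F) (q : E) (i : ι) :
    frameMap k q (Pi.single i 1) = k i q := by
  rw [frameMap_apply, Finset.sum_eq_single i] <;> simp +contextual

theorem SmoothNear.frameMap [NormedAddCommGroup E] [NormedSpace ℝ E]
    {k : ι → E → F} {p : E} (hk : ∀ i, SmoothNear (k i) p) :
    SmoothNear (frameMap k) p :=
  SmoothNear.sum fun i _ => (hk i).clm (ContinuousLinearMap.smulRightL ℝ (ι → ℝ) F
    (ContinuousLinearMap.proj (R := ℝ) i))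

theorem range_frameMap (k : ι → E → F) (q : E) :
    LinearMap.range (frameMap k q).toLinearMap = Submodule.span ℝ (range fun i => k i q) := by
  ext v
  rw [Submodule.mem_span_range_iff_exists_fun]
  simp [frameMap_apply]

theorem exists_leftInverse_frameMap [FiniteDimensional ℝ F] {k : ι → E → F} {p : E}
    (hp : LinearIndependent ℝ fun i => k i p) :
    ∃ P : F →L[ℝ] (ι → ℝ), P.comp (frameMap k p) = ContinuousLinearMap.id ℝ (ι → ℝ) := by
  have hker : LinearMap.ker (frameMap k p).toLinearMap = ⊥ := by
    rw [LinearMap.ker_eq_bot']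
    intro v hv
    ext i
    exact Fintype.linearIndependent_iff.1 hp v (by rw [← frameMap_apply]; exact hv) i
  obtain ⟨P, hP⟩ := (frameMap k p).toLinearMap.exists_leftInverse_of_injective hker
  refine ⟨LinearMap.toContinuousLinearMap P, ?_⟩
  ext1 v
  exact congrArg (fun T : (ι → ℝ) →ₗ[ℝ] (ι → ℝ) => T v) hP

/-- A smooth frame of a subbundle admits a smooth family of coordinate functionals. -/
theorem exists_coframe [NormedAddCommGroup E] [NormedSpace ℝ E] [FiniteDimensional ℝ F]
    {k : ι → E → F} {p : E}
    (hk : ∀ i, SmoothNear (k i) p) (hp : LinearIndependent ℝ fun i => k i p) :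
    ∃ θ : E → F →L[ℝ] (ι → ℝ), SmoothNear θ p ∧
      ∀ᶠ q in 𝓝 p, (θ q).comp (frameMap k q) = ContinuousLinearMap.id ℝ (ι → ℝ) := by
  -- With `P` a left inverse of the frame operator `K p` at the base point, the coframe is `(P ∘ K
  -- q)⁻¹ ∘ P`; the invertibility of `P ∘ K q` is an open condition.
  obtain ⟨P, hP⟩ := exists_leftInverse_frameMap hp
  have hB : SmoothNear (fun q => P.comp (frameMap k q)) p :=
    (SmoothNear.const P).clm_comp (SmoothNear.frameMap hk)
  obtain ⟨h1, h2⟩ := hB.inverse (by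
    rw [hP]; exact ContinuousLinearMap.isInvertible_equiv (f := ContinuousLinearEquiv.refl ℝ _))
  refine ⟨_, h1.clm_comp (SmoothNear.const P), ?_⟩
  filter_upwards [h2] with q hq
  rw [ContinuousLinearMap.comp_assoc]
  exact hq.inverse_comp_self

theorem coframe_apply {k : ι → E → F} {q : E} {θ : F →L[ℝ] (ι → ℝ)}
    (hθ : θ.comp (frameMap k q) = ContinuousLinearMap.id ℝ (ι → ℝ)) [DecidableEq ι] (i j : ι) :
    θ (k i q) j = (Pi.single i 1 : ι → ℝ) j := by
  have := congrArg (fun T : (ι → ℝ) →L[ℝ] (ι → ℝ) => T (Pi.single i 1)) hθ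
  simp only [ContinuousLinearMap.comp_apply, frameMap_single, ContinuousLinearMap.id_apply] at this
  rw [this]

theorem eq_sum_coframe {k : ι → E → F} {q : E} {θ : F →L[ℝ] (ι → ℝ)}
    (hθ : θ.comp (frameMap k q) = ContinuousLinearMap.id ℝ (ι → ℝ)) {v : F}
    (hv : v ∈ Submodule.span ℝ (range fun i => k i q)) : v = ∑ i, θ v i • k i q := by
  rw [← range_frameMap] at hv
  obtain ⟨c, rfl⟩ := hv
  have := congrArg (fun T : (ι → ℝ) →L[ℝ] (ι → ℝ) => T c) hθ
  change θ (frameMap k q c) = c at this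
  change frameMap k q c = ∑ i, θ (frameMap k q c) i • k i q
  rw [this, frameMap_apply]

theorem linearIndependent_of_coframe {k : ι → E → F} {q : E} {θ : F →L[ℝ] (ι → ℝ)}
    (hθ : θ.comp (frameMap k q) = ContinuousLinearMap.id ℝ (ι → ℝ)) :
    LinearIndependent ℝ fun i => k i q := by
  rw [Fintype.linearIndependent_iff]
  intro c hc i
  rw [← frameMap_apply] at hc
  have := congrArg (fun T : (ι → ℝ) →L[ℝ] (ι → ℝ) => T c i) hθ
  simp only [ContinuousLinearMap.comp_apply, hc, ContinuousLinearMap.id_apply, map_zero] at this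
  simpa using this.symm

end Frames

/-! ### Modules of vector fields -/

section LocGen

variable {F : Type} [NormedAddCommGroup F] [NormedSpace ℝ F]

/-- The vector fields that near `w` are combinations, with smooth coefficients, of fields of the
family `𝒢`. -/
def LocGen (𝒢 : Set (F → F)) (w : F) : Submodule ℝ (F → F) :=
  Submodule.span ℝ {Z | ∃ f : F → ℝ, SmoothNear f w ∧ ∃ G ∈ insert 0 𝒢, Z =ᶠ[𝓝 w] fun v => f v • G v}

namespace LocGen

variable {𝒢 ℋ 𝒯 : Set (F → F)} {w : F} {Z Z₁ Z₂ : F → F}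

theorem of_mem {G : F → F} (hG : G ∈ 𝒢) : G ∈ LocGen 𝒢 w :=
  Submodule.subset_span ⟨fun _ => 1, SmoothNear.const 1, G, mem_insert_of_mem _ hG,
    Filter.Eventually.of_forall fun v => by simp⟩

/-- The zero field is added to the generators in the definition for this purpose: a vanishing germ
belongs to the module even when there are no generators, and membership then depends on the germ
alone. -/
theorem of_eventuallyEq_zero (h : Z =ᶠ[𝓝 w] 0) : Z ∈ LocGen 𝒢 w :=
  Submodule.subset_span ⟨fun _ => 1, SmoothNear.const 1, 0, mem_insert _ _, by
    filter_upwards [h] with v hv; simp [hv]⟩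

theorem congr (hZ : Z₁ ∈ LocGen 𝒢 w) (h : Z₂ =ᶠ[𝓝 w] Z₁) : Z₂ ∈ LocGen 𝒢 w := by
  have h0 : Z₂ - Z₁ ∈ LocGen 𝒢 w := of_eventuallyEq_zero (by
    filter_upwards [h] with v hv; simp [hv])
  simpa using add_mem h0 hZ

theorem smul {f : F → ℝ} (hf : SmoothNear f w) (hZ : Z ∈ LocGen 𝒢 w) :
    (fun v => f v • Z v) ∈ LocGen 𝒢 w := by
  induction hZ using Submodule.span_induction with
  | mem Z hZ =>
    obtain ⟨g, hg, G, hG, h⟩ := hZ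
    refine Submodule.subset_span ⟨_, hf.mul hg, G, hG, ?_⟩
    filter_upwards [h] with v hv
    rw [hv, smul_smul]
  | zero => exact of_eventuallyEq_zero (Filter.Eventually.of_forall fun v => by simp)
  | add Z₁ Z₂ _ _ h1 h2 =>
    exact congr (add_mem h1 h2) (Filter.Eventually.of_forall fun v => smul_add _ _ _)
  | smul c Z _ h =>
    exact congr (Submodule.smul_mem _ c h) (Filter.Eventually.of_forall fun v => smul_comm _ _ _)

theorem trans (hZ : Z ∈ LocGen 𝒢 w) (h : ∀ G ∈ 𝒢, G ∈ LocGen ℋ w) : Z ∈ LocGen ℋ w := by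
  induction hZ using Submodule.span_induction with
  | mem Z hZ =>
    obtain ⟨f, hf, G, rfl | hG, h'⟩ := hZ
    · exact of_eventuallyEq_zero (by filter_upwards [h'] with v hv; simp [hv])
    · exact congr (smul hf (h G hG)) h'
  | zero => exact zero_mem _
  | add Z₁ Z₂ _ _ h1 h2 => exact add_mem h1 h2
  | smul c Z _ h => exact Submodule.smul_mem _ c h

theorem mono (h : 𝒢 ⊆ ℋ) (hZ : Z ∈ LocGen 𝒢 w) : Z ∈ LocGen ℋ w :=
  trans hZ fun _ hG => of_mem (h hG)

theorem apply_mem {P : Submodule ℝ F} (hZ : Z ∈ LocGen 𝒢 w) (h : ∀ G ∈ 𝒢, G w ∈ P) : Z w ∈ P := by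
  induction hZ using Submodule.span_induction with
  | mem Z hZ =>
    obtain ⟨f, hf, G, rfl | hG, h'⟩ := hZ
    · rw [h'.eq_of_nhds]; simp
    · rw [h'.eq_of_nhds]; exact P.smul_mem _ (h G hG)
  | zero => exact zero_mem _
  | add Z₁ Z₂ _ _ h1 h2 => exact add_mem h1 h2
  | smul c Z _ h => exact Submodule.smul_mem _ c h

theorem smoothNear (hZ : Z ∈ LocGen 𝒢 w) (h : ∀ G ∈ 𝒢, SmoothNear G w) : SmoothNear Z w := by
  induction hZ using Submodule.span_induction with
  | mem Z hZ =>
    obtain ⟨f, hf, G, rfl | hG, h'⟩ := hZ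
    · exact (SmoothNear.const 0).congr (by filter_upwards [h'] with v hv; simp [hv])
    · exact (hf.smul (h G hG)).congr h'
  | zero => exact SmoothNear.const 0
  | add Z₁ Z₂ _ _ h1 h2 => exact h1.add h2
  | smul c Z _ h => exact (SmoothNear.const c).smul h

theorem eventually (hZ : Z ∈ LocGen 𝒢 w) : ∀ᶠ v in 𝓝 w, Z ∈ LocGen 𝒢 v := by
  induction hZ using Submodule.span_induction with
  | mem Z hZ =>
    obtain ⟨f, hf, G, hG, h⟩ := hZ
    filter_upwards [hf.eventually, h.eventually_nhds] with v h1 h2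
    exact Submodule.subset_span ⟨f, h1, G, hG, h2⟩
  | zero => exact Filter.Eventually.of_forall fun _ => zero_mem _
  | add Z₁ Z₂ _ _ h1 h2 => filter_upwards [h1, h2] with v h1 h2 using add_mem h1 h2
  | smul c Z _ h => filter_upwards [h] with v h using Submodule.smul_mem _ c h

theorem sum {ι : Type*} {s : Finset ι} {f : ι → F → ℝ} {k : ι → F → F}
    (hf : ∀ i ∈ s, SmoothNear (f i) w) (hk : ∀ i ∈ s, k i ∈ LocGen 𝒢 w) :
    (fun v => ∑ i ∈ s, f i v • k i v) ∈ LocGen 𝒢 w := by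
  have h := sum_mem fun i hi => smul (hf i hi) (hk i hi)
  refine congr h (Filter.Eventually.of_forall fun v => ?_)
  simp [Finset.sum_apply]

theorem lieBracket_smul_smul {f g : F → ℝ} {G H : F → F} (hf : SmoothNear f w)
    (hg : SmoothNear g w) (hG : SmoothNear G w) (hH : SmoothNear H w) :
    VectorField.lieBracket ℝ (fun v => f v • G v) (fun v => g v • H v) =ᶠ[𝓝 w]
      fun v => (f v * g v) • VectorField.lieBracket ℝ G H v + ((f v * fderiv ℝ g v (G v)) • H v
        - (g v * fderiv ℝ f v (H v)) • G v) := by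
  filter_upwards [hf.eventually, hg.eventually, hG.eventually, hH.eventually] with v h1 h2 h3 h4
  simp only [VectorField.lieBracket]
  have e1 : fderiv ℝ (fun v => f v • G v) v = f v • fderiv ℝ G v + (fderiv ℝ f v).smulRight (G v) :=
    (h1.hasFDerivAt.smul h3.hasFDerivAt).fderiv
  have e2 : fderiv ℝ (fun v => g v • H v) v = g v • fderiv ℝ H v + (fderiv ℝ g v).smulRight (H v) :=
    (h2.hasFDerivAt.smul h4.hasFDerivAt).fderiv
  rw [e1, e2]
  simp only [add_apply, smul_apply, ContinuousLinearMap.smulRight_apply,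
    map_smul]
  module

/-- By the Leibniz rule `[f G, g H] = f g [G, H] + f G(g) H - g H(f) G`, only brackets of generators
and the generators themselves have to be tested. -/
theorem lieBracket (h1 : ∀ G ∈ 𝒢, SmoothNear G w) (h2 : ∀ H ∈ ℋ, SmoothNear H w)
    (h3 : ∀ G ∈ 𝒢, G ∈ LocGen 𝒯 w) (h4 : ∀ H ∈ ℋ, H ∈ LocGen 𝒯 w)
    (h5 : ∀ G ∈ 𝒢, ∀ H ∈ ℋ, VectorField.lieBracket ℝ G H ∈ LocGen 𝒯 w)
    (hZ₁ : Z₁ ∈ LocGen 𝒢 w) (hZ₂ : Z₂ ∈ LocGen ℋ w) :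
    VectorField.lieBracket ℝ Z₁ Z₂ ∈ LocGen 𝒯 w := by
  replace h1 : ∀ G ∈ insert 0 𝒢, SmoothNear G w := by
    rintro G (rfl | hG)
    exacts [SmoothNear.const 0, h1 G hG]
  replace h2 : ∀ G ∈ insert 0 ℋ, SmoothNear G w := by
    rintro G (rfl | hG)
    exacts [SmoothNear.const 0, h2 G hG]
  replace h3 : ∀ G ∈ insert 0 𝒢, G ∈ LocGen 𝒯 w := by
    rintro G (rfl | hG)
    exacts [zero_mem _, h3 G hG]
  replace h4 : ∀ G ∈ insert 0 ℋ, G ∈ LocGen 𝒯 w := by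
    rintro G (rfl | hG)
    exacts [zero_mem _, h4 G hG]
  replace h5 : ∀ G ∈ insert 0 𝒢, ∀ H ∈ insert 0 ℋ, VectorField.lieBracket ℝ G H ∈ LocGen 𝒯 w := by
    rintro G (rfl | hG) H (rfl | hH)
    · rw [VectorField.lieBracket_zero_left]; exact zero_mem _
    · rw [VectorField.lieBracket_zero_left]; exact zero_mem _
    · rw [VectorField.lieBracket_zero_right]; exact zero_mem _
    · exact h5 G hG H hH
  have s1 : ∀ {Z}, Z ∈ LocGen 𝒢 w → SmoothNear Z w := fun hZ =>
    smoothNear hZ fun G hG => h1 G (mem_insert_of_mem _ hG)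
  have s2 : ∀ {Z}, Z ∈ LocGen ℋ w → SmoothNear Z w := fun hZ =>
    smoothNear hZ fun G hG => h2 G (mem_insert_of_mem _ hG)
  induction hZ₁ using Submodule.span_induction with
  | mem Z₁ hZ₁ =>
    obtain ⟨f, hf, G, hG, e1⟩ := hZ₁
    induction hZ₂ using Submodule.span_induction with
    | mem Z₂ hZ₂ =>
      obtain ⟨g, hg, H, hH, e2⟩ := hZ₂
      have h6 : VectorField.lieBracket ℝ Z₁ Z₂ =ᶠ[𝓝 w]
          VectorField.lieBracket ℝ (fun v => f v • G v) (fun v => g v • H v) := by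
        filter_upwards [e1.eventually_nhds, e2.eventually_nhds] with v h1 h2
        exact Filter.EventuallyEq.lieBracket_vectorField_eq h1 h2
      refine congr ?_ (h6.trans (lieBracket_smul_smul hf hg (h1 G hG) (h2 H hH)))
      exact add_mem (smul (hf.mul hg) (h5 G hG H hH))
        (sub_mem (smul (hf.mul (hg.fderiv_apply (h1 G hG))) (h4 H hH))
          (smul (hg.mul (hf.fderiv_apply (h2 H hH))) (h3 G hG)))
    | zero => rw [VectorField.lieBracket_zero_right]; exact zero_mem _
    | add Z Z' hZ hZ' h h' =>
      refine congr (add_mem h h') ?_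
      filter_upwards [s2 hZ, s2 hZ'] with v a b
      exact VectorField.lieBracket_add_right (a.differentiableAt (by simp))
        (b.differentiableAt (by simp))
    | smul c Z hZ h =>
      refine congr (Submodule.smul_mem _ c h) ?_
      filter_upwards [s2 hZ] with v a
      exact VectorField.lieBracket_const_smul_right (a.differentiableAt (by simp))
  | zero => rw [VectorField.lieBracket_zero_left]; exact zero_mem _
  | add Z Z' hZ hZ' h h' =>
    refine congr (add_mem h h') ?_
    filter_upwards [s1 hZ, s1 hZ'] with v a b
    exact VectorField.lieBracket_add_left (a.differentiableAt (by simp))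
      (b.differentiableAt (by simp))
  | smul c Z hZ h =>
    refine congr (Submodule.smul_mem _ c h) ?_
    filter_upwards [s1 hZ] with v a
    exact VectorField.lieBracket_const_smul_left (a.differentiableAt (by simp))

/-- The pointwise form results from taking as target family all fields whose value at `w` lies in
`P`. -/
theorem lieBracket_apply_mem {P : Submodule ℝ F} (h1 : ∀ G ∈ 𝒢, SmoothNear G w)
    (h2 : ∀ H ∈ ℋ, SmoothNear H w) (h3 : ∀ G ∈ 𝒢, G w ∈ P) (h4 : ∀ H ∈ ℋ, H w ∈ P)
    (h5 : ∀ G ∈ 𝒢, ∀ H ∈ ℋ, VectorField.lieBracket ℝ G H w ∈ P)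
    (hZ₁ : Z₁ ∈ LocGen 𝒢 w) (hZ₂ : Z₂ ∈ LocGen ℋ w) :
    VectorField.lieBracket ℝ Z₁ Z₂ w ∈ P :=
  apply_mem (𝒢 := {G | G w ∈ P})
    (lieBracket h1 h2 (fun G hG => of_mem (h3 G hG)) (fun G hG => of_mem (h4 G hG))
      (fun G hG H hH => of_mem (h5 G hG H hH)) hZ₁ hZ₂) fun _ hG => hG

/-- The coefficients are smooth because a smooth coframe computes them from `Z`. -/
theorem of_mem_span {E : Type} [NormedAddCommGroup E] [NormedSpace ℝ E] [FiniteDimensional ℝ E]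
    {ι : Type} [Fintype ι] {k : ι → E → E} {p : E} {Z : E → E}
    (hk : ∀ i, SmoothNear (k i) p) (hp : LinearIndependent ℝ fun i => k i p)
    (hZ : SmoothNear Z p) (h : ∀ᶠ q in 𝓝 p, Z q ∈ Submodule.span ℝ (range fun i => k i q)) :
    Z ∈ LocGen (range k) p := by
  obtain ⟨θ, hθ, hθk⟩ := exists_coframe hk hp
  refine congr (sum (s := Finset.univ) (f := fun i q => θ q (Z q) i) (k := k)
    (fun i _ => (hθ.clm_apply hZ).clm (ContinuousLinearMap.proj (R := ℝ) i))
    fun i _ => of_mem (mem_range_self i)) ?_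
  filter_upwards [hθk, h] with q h1 h2
  exact eq_sum_coframe h1 h2

end LocGen

end LocGen

/-! ### The Frobenius theorem -/

section FirstIntegrals

variable {F : Type} [NormedAddCommGroup F] [NormedSpace ℝ F] [FiniteDimensional ℝ F]

/-- The Frobenius theorem: every covector annihilating an involutive subbundle at `p` is the
differential at `p` of a first integral of this subbundle. -/
theorem exists_firstIntegral {ι : Type} [Fintype ι] {k : ι → F → F} {p : F}
    (hk : ∀ i, SmoothNear (k i) p) (hp : LinearIndependent ℝ fun i => k i p)
    (hinv : ∀ i j, ∀ᶠ q in 𝓝 p, VectorField.lieBracket ℝ (k i) (k j) q ∈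
      Submodule.span ℝ (range fun i => k i q))
    {l : F →L[ℝ] ℝ} (hl : ∀ i, l (k i p) = 0) :
    ∃ s : F → ℝ, SmoothNear s p ∧ fderiv ℝ s p = l ∧ ∀ᶠ q in 𝓝 p, ∀ i, fderiv ℝ s q (k i q) = 0 := by
  classical
  obtain ⟨P, hP⟩ := exists_leftInverse_frameMap hp
  have hZk := SmoothNear.frameMap hk
  have hB : SmoothNear (fun q => P.comp (frameMap k q)) p := (SmoothNear.const P).clm_comp hZk
  obtain ⟨hB1, hB2⟩ := hB.inverse (by
    rw [hP]; exact ContinuousLinearMap.isInvertible_equiv (f := ContinuousLinearEquiv.refl ℝ _))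
  set B : F → (ι → ℝ) →L[ℝ] (ι → ℝ) := fun q => P.comp (frameMap k q) with hBdef
  -- The frame is normalized so that `P ∘ Z q` is the identity. An involutive frame of this kind
  -- commutes: the bracket of two members lies in the subbundle, on which `P` is injective near `p`,
  -- and `P` kills it because `P (Z q v) = v` is constant.
  set Z : F → (ι → ℝ) →L[ℝ] F := fun q => (frameMap k q).comp (B q).inverse with hZdef
  have hZ : SmoothNear Z p := hZk.clm_comp hB1
  have hZp : Z p = frameMap k p := by
    have : (B p).inverse = ContinuousLinearMap.id ℝ _ := by
      rw [hBdef]; simp only [hP]; exact ContinuousLinearMap.inverse_id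
    rw [hZdef]; simp only [this, ContinuousLinearMap.comp_id]
  have hPZ : ∀ᶠ q in 𝓝 p, ∀ v, P (Z q v) = v := by
    filter_upwards [hB2] with q hq v
    exact congrArg (fun T : (ι → ℝ) →L[ℝ] (ι → ℝ) => T v) hq.self_comp_inverse
  have hcomm : ∀ᶠ q in 𝓝 p, ∀ v w, fderiv ℝ Z q (Z q v) w = fderiv ℝ Z q (Z q w) v := by
    have hk' : ∀ᶠ q in 𝓝 p, ∀ i, SmoothNear (k i) q :=
      Filter.eventually_all.2 fun i => (hk i).eventually
    have hinv' : ∀ᶠ q in 𝓝 p, ∀ i j, VectorField.lieBracket ℝ (k i) (k j) q ∈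
      Submodule.span ℝ (range fun i => k i q) :=
      Filter.eventually_all.2 fun i => Filter.eventually_all.2 fun j => hinv i j
    filter_upwards [hk', hinv', hB1.eventually, hPZ.eventually_nhds, hZ.eventually, hB2]
      with q h1 h2 h3 h4 h5 h6 v w
    have hgen : ∀ v, (fun q => Z q v) ∈ LocGen (range k) q := by
      intro v
      have e : (fun q => Z q v) = fun q => ∑ i, ((B q).inverse v) i • k i q := by
        ext1 q
        simp only [hZdef, ContinuousLinearMap.comp_apply, frameMap_apply]
      rw [e]
      exact LocGen.sum (f := fun i q => (B q).inverse v i)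
        (fun i _ => (h3.clm_apply (SmoothNear.const v)).clm (ContinuousLinearMap.proj (R := ℝ) i))
        (fun i _ => LocGen.of_mem (mem_range_self i))
    have hd : ∀ v u, fderiv ℝ (fun q => Z q v) q u = fderiv ℝ Z q u v := by
      intro v u
      have : HasFDerivAt (fun q => Z q v)
          ((ContinuousLinearMap.apply ℝ F v).comp (fderiv ℝ Z q)) q :=
        (ContinuousLinearMap.apply ℝ F v).hasFDerivAt.comp q h5.hasFDerivAt
      rw [this.fderiv]; rfl
    have hPd : ∀ v u, P (fderiv ℝ Z q u v) = 0 := by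
      intro v u
      have e1 : HasFDerivAt (fun q => P (Z q v)) (P.comp (fderiv ℝ (fun q => Z q v) q)) q :=
        P.hasFDerivAt.comp q (h5.clm_apply (SmoothNear.const v)).hasFDerivAt
      have e2 : HasFDerivAt (fun q => P (Z q v)) (0 : F →L[ℝ] (ι → ℝ)) q :=
        (hasFDerivAt_const v q).congr_of_eventuallyEq (by filter_upwards [h4] with q h using h v)
      have := congrArg (fun T : F →L[ℝ] (ι → ℝ) => T u) (e1.unique e2)
      simpa [hd] using this
    have hmem : VectorField.lieBracket ℝ (fun q => Z q v) (fun q => Z q w) q ∈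
        Submodule.span ℝ (range fun i => k i q) := by
      refine LocGen.lieBracket_apply_mem (𝒢 := range k) (ℋ := range k) ?_ ?_ ?_ ?_ ?_
        (hgen v) (hgen w)
      · rintro _ ⟨i, rfl⟩; exact h1 i
      · rintro _ ⟨i, rfl⟩; exact h1 i
      · rintro _ ⟨i, rfl⟩; exact Submodule.subset_span ⟨i, rfl⟩
      · rintro _ ⟨i, rfl⟩; exact Submodule.subset_span ⟨i, rfl⟩
      · rintro _ ⟨i, rfl⟩ _ ⟨j, rfl⟩; exact h2 i j
    have hval : VectorField.lieBracket ℝ (fun q => Z q v) (fun q => Z q w) q =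
        fderiv ℝ Z q (Z q v) w - fderiv ℝ Z q (Z q w) v := by
      simp only [VectorField.lieBracket, hd]
    rw [hval, ← range_frameMap] at hmem
    obtain ⟨c, hc⟩ := hmem
    have hc0 : B q c = 0 := by
      change P (frameMap k q c) = 0
      change frameMap k q c = _ at hc
      rw [hc, map_sub, hPd, hPd, sub_zero]
    have : c = 0 := by
      have e : (B q).inverse (B q c) = c :=
        congrArg (fun T : (ι → ℝ) →L[ℝ] (ι → ℝ) => T c) h6.inverse_comp_self
      rw [← e, hc0, map_zero]
    rw [this, map_zero] at hc
    exact (sub_eq_zero.1 hc.symm)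
  -- The derivative of `Ψ` carries the subbundle to the constant vectors `Z p v`, all annihilated by
  -- `l`; hence `l ∘ Ψ` is a first integral.
  obtain ⟨Ψ, h1, h2, h3⟩ := exists_rectification hZ (by rw [hZp]; exact hP) hcomm
  refine ⟨fun q => l (Ψ q), h1.clm l, ?_, ?_⟩
  · have e : HasFDerivAt (fun q => l (Ψ q)) (l.comp (fderiv ℝ Ψ p)) p :=
      l.hasFDerivAt.comp p h1.hasFDerivAt
    rw [e.fderiv, h2, ContinuousLinearMap.comp_id]
  · filter_upwards [h1, h3, hB2] with q a b c i
    have e1 : HasFDerivAt (fun q => l (Ψ q)) (l.comp (fderiv ℝ Ψ q)) q :=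
      l.hasFDerivAt.comp q (a.differentiableAt (by simp)).hasFDerivAt
    have e2 : k i q = Z q (B q (Pi.single i 1)) := by
      have e : (B q).inverse (B q (Pi.single i 1)) = Pi.single i 1 :=
        congrArg (fun T : (ι → ℝ) →L[ℝ] (ι → ℝ) => T (Pi.single i 1)) c.inverse_comp_self
      simp only [hZdef, ContinuousLinearMap.comp_apply, e, frameMap_single]
    rw [e1.fderiv, ContinuousLinearMap.comp_apply, e2, b, hZp, frameMap_apply, map_sum]
    simp [hl]

end FirstIntegrals

/-! ### Goursat frames and the Goursat normal form -/

section GoursatNormalForm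

open VectorField

variable {F : Type} [NormedAddCommGroup F] [NormedSpace ℝ F]

theorem linearIndependent_of_dual {ι : Type} [Fintype ι] [DecidableEq ι] {v : ι → F}
    (l : ι → F →L[ℝ] ℝ) (h : ∀ i j, l j (v i) = if i = j then 1 else 0) :
    LinearIndependent ℝ v := by
  rw [Fintype.linearIndependent_iff]
  intro c hc j
  have := congrArg (l j) hc
  simpa [h] using this

/-- The second-order terms cancel by symmetry of the second derivative: a bracket acts on functions
as the commutator of the derivations. -/
theorem fderiv_apply_lieBracket_of_smoothNear {G : Type} [NormedAddCommGroup G] [NormedSpace ℝ G]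
    {x : F → G} {V W : F → F} {p : F}
    (hx : SmoothNear x p) (hV : SmoothNear V p) (hW : SmoothNear W p) :
    fderiv ℝ x p (lieBracket ℝ V W p) =
      fderiv ℝ (fun q => fderiv ℝ x q (W q)) p (V p) -
        fderiv ℝ (fun q => fderiv ℝ x q (V q)) p (W p) := by
  have hx1 := hx.fderiv.differentiableAt
  have hx2 := (hx.contDiffAt.of_le (m := 2) (WithTop.coe_le_coe.2 le_top)).isSymmSndFDerivAt
    (by simp)
  have e1 : fderiv ℝ (fun q => fderiv ℝ x q (W q)) p = _ :=
    (hx1.hasFDerivAt.clm_apply hW.hasFDerivAt).fderiv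
  have e2 : fderiv ℝ (fun q => fderiv ℝ x q (V q)) p = _ :=
    (hx1.hasFDerivAt.clm_apply hV.hasFDerivAt).fderiv
  rw [e1, e2]
  have := hx2 (V p) (W p)
  simp only [lieBracket, map_sub, add_apply, ContinuousLinearMap.comp_apply,
    ContinuousLinearMap.flip_apply]
  rw [this]
  abel

/-- The span at `q` of the fields `g 0, …, g i`. -/
def prefixSpan (g : ℕ → F → F) (i : ℕ) (q : F) : Submodule ℝ F :=
  Submodule.span ℝ ((fun j => g j q) '' Iic i)

theorem mem_prefixSpan {g : ℕ → F → F} {i j : ℕ} (h : j ≤ i) (q : F) : g j q ∈ prefixSpan g i q :=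
  Submodule.subset_span ⟨j, h, rfl⟩

theorem prefixSpan_mono (g : ℕ → F → F) {i j : ℕ} (h : i ≤ j) (q : F) :
    prefixSpan g i q ≤ prefixSpan g j q :=
  Submodule.span_mono (image_mono (Iic_subset_Iic.2 h))

/-- The functionals dual to a moving frame. -/
theorem exists_dual_frame [FiniteDimensional ℝ F] {g : ℕ → F → F} {p : F} {N : ℕ}
    (hg : ∀ j < N, SmoothNear (g j) p) (hp : LinearIndependent ℝ fun j : Fin N => g j p)
    (hN : finrank ℝ F = N) :
    ∃ θ : ℕ → F → F →L[ℝ] ℝ, (∀ j, SmoothNear (θ j) p) ∧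
      ∀ᶠ q in 𝓝 p, (∀ i < N, ∀ j < N, θ j q (g i q) = if i = j then 1 else 0) ∧
        ∀ v, v = ∑ j ∈ Finset.range N, θ j q v • g j q := by
  obtain ⟨θ, hθ, hθk⟩ := exists_coframe (k := fun (j : Fin N) => g j) (fun j => hg j j.2) hp
  refine ⟨fun j q => if h : j < N then
    (ContinuousLinearMap.proj (R := ℝ) (⟨j, h⟩ : Fin N)).comp (θ q) else 0, fun j => ?_, ?_⟩
  · by_cases h : j < N
    · simp only [h, dif_pos]
      exact (SmoothNear.const _).clm_comp hθ
    · simp only [h, dif_neg, not_false_eq_true]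
      exact SmoothNear.const 0
  · filter_upwards [hθk] with q hq
    refine ⟨fun i hi j hj => ?_, fun v => ?_⟩
    · have := coframe_apply hq ⟨i, hi⟩ ⟨j, hj⟩
      simp only [hj, dif_pos, ContinuousLinearMap.comp_apply, ContinuousLinearMap.proj_apply]
      rw [this, Pi.single_apply]
      simp [eq_comm]
    · have hli := linearIndependent_of_coframe hq
      have htop : v ∈ Submodule.span ℝ (range fun j : Fin N => g j q) := by
        rw [hli.span_eq_top_of_card_eq_finrank' (by simp [hN])]; trivial
      rw [← Fin.sum_univ_eq_sum_range
        (fun j => (if h : j < N then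
          (ContinuousLinearMap.proj (R := ℝ) (⟨j, h⟩ : Fin N)).comp (θ q) else 0) v • g j q)]
      simpa using eq_sum_coframe hq htop

theorem mem_prefixSpan_iff {g : ℕ → F → F} {θ : ℕ → F → F →L[ℝ] ℝ} {q : F} {N i : ℕ}
    (h1 : ∀ i < N, ∀ j < N, θ j q (g i q) = if i = j then 1 else 0)
    (h2 : ∀ v, v = ∑ j ∈ Finset.range N, θ j q v • g j q) {v : F} :
    v ∈ prefixSpan g i q ↔ ∀ j, i < j → j < N → θ j q v = 0 := by
  constructor
  · intro hv j hij hj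
    induction hv using Submodule.span_induction with
    | mem v hv =>
      obtain ⟨m, hm, rfl⟩ := hv
      have hm' : m ≤ i := hm
      rw [h1 m (by omega) j hj, if_neg (by omega)]
    | zero => simp
    | add v w _ _ hv hw => rw [map_add, hv, hw, add_zero]
    | smul c v _ hv => rw [map_smul, hv, smul_zero]
  · intro h
    rw [h2 v]
    refine sum_mem fun j hj => ?_
    by_cases hij : i < j
    · rw [h j hij (Finset.mem_range.1 hj), zero_smul]; exact zero_mem _
    · exact Submodule.smul_mem _ _ (mem_prefixSpan (not_lt.1 hij) q)

theorem lieBracket_sub_smul_left {A B C : F → F} {r : F → ℝ} {q : F}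
    (hA : DifferentiableAt ℝ A q) (hB : DifferentiableAt ℝ B q) (hr : DifferentiableAt ℝ r q) :
    lieBracket ℝ (fun x => A x - r x • B x) C q =
      lieBracket ℝ A C q - r q • lieBracket ℝ B C q + fderiv ℝ r q (C q) • B q := by
  simp only [lieBracket]
  have e : fderiv ℝ (fun x => A x - r x • B x) q = fderiv ℝ A q -
      (r q • fderiv ℝ B q + (fderiv ℝ r q).smulRight (B q)) :=
    (hA.hasFDerivAt.sub (hr.hasFDerivAt.smul hB.hasFDerivAt)).fderiv
  rw [e]
  simp only [map_sub, map_smul, sub_apply, add_apply, smul_apply,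
    ContinuousLinearMap.smulRight_apply]
  module

/-- `g 0, …, g (n + 1)` is a frame adapted to a regular Goursat flag whose `i`-th term is spanned
by `g 0, …, g i`. -/
structure IsGoursatFrame (n : ℕ) (g : ℕ → F → F) (p : F) : Prop where
  finrank_eq : finrank ℝ F = n + 2
  smooth : ∀ j < n + 2, SmoothNear (g j) p
  linearIndependent : LinearIndependent ℝ fun j : Fin (n + 2) => g j p
  bracket_mem : ∀ j, 1 ≤ j → j ≤ n →
    ∀ᶠ q in 𝓝 p, lieBracket ℝ (g 0) (g j) q ∈ prefixSpan g (j + 1) q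
  bracket_notMem : ∀ j, 1 ≤ j → j ≤ n → ¬ (lieBracket ℝ (g 0) (g j) p ∈ prefixSpan g j p ∧
    lieBracket ℝ (g 1) (g j) p ∈ prefixSpan g j p)
  bracket_last : lieBracket ℝ (g 0) (g n) p ∉ prefixSpan g n p
  bracket_square : ∀ i < n, ∀ j < n, ∀ᶠ q in 𝓝 p, lieBracket ℝ (g i) (g j) q ∈ prefixSpan g n q

namespace IsGoursatFrame

variable {n : ℕ} {g : ℕ → F → F} {p : F}

/-- The component of `g j` along `ker dx`, in the direction of `g 0`. -/
def vert (g : ℕ → F → F) (x : F → ℝ) (j : ℕ) (q : F) : F :=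
  g j q - (fderiv ℝ x q (g j q) * (fderiv ℝ x q (g 0 q))⁻¹) • g 0 q

theorem locGen_prefix (h : IsGoursatFrame n g p) [FiniteDimensional ℝ F] {i : ℕ} (hi : i < n + 2)
    {Z : F → F} (hZ : SmoothNear Z p) (hmem : ∀ᶠ q in 𝓝 p, Z q ∈ prefixSpan g i q) :
    Z ∈ LocGen (g '' Iic i) p := by
  have h1 : Z ∈ LocGen (range fun j : Fin (i + 1) => g j) p := by
    refine LocGen.of_mem_span (k := fun j : Fin (i + 1) => g j)
      (fun j => h.smooth j (by omega)) ?_ hZ ?_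
    · exact h.linearIndependent.comp (Fin.castLE (by omega)) (Fin.castLE_injective _)
    · filter_upwards [hmem] with q hq
      refine Submodule.span_mono ?_ hq
      rintro _ ⟨j, hj, rfl⟩
      exact ⟨⟨j, Nat.lt_succ_of_le hj⟩, rfl⟩
  refine LocGen.mono ?_ h1
  rintro _ ⟨j, rfl⟩
  exact ⟨j, Nat.le_of_lt_succ j.2, rfl⟩

theorem exists_dual [FiniteDimensional ℝ F] (h : IsGoursatFrame n g p) :
    ∃ θ : ℕ → F → F →L[ℝ] ℝ, (∀ j, SmoothNear (θ j) p) ∧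
      ∀ᶠ q in 𝓝 p, (∀ i < n + 2, ∀ j < n + 2, θ j q (g i q) = if i = j then 1 else 0) ∧
        ∀ v, v = ∑ j ∈ Finset.range (n + 2), θ j q v • g j q :=
  exists_dual_frame h.smooth h.linearIndependent h.finrank_eq

theorem image_Iic_smoothNear (h : IsGoursatFrame n g p) {i : ℕ} (hi : i < n + 2) :
    ∀ᶠ q in 𝓝 p, ∀ G ∈ g '' Iic i, SmoothNear G q := by
  have : ∀ᶠ q in 𝓝 p, ∀ j ∈ Finset.range (i + 1), SmoothNear (g j) q :=
    (Filter.eventually_all_finset _).2 fun j hj =>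
      (h.smooth j (by have := Finset.mem_range.1 hj; omega)).eventually
  filter_upwards [this] with q hq
  rintro _ ⟨j, hj, rfl⟩
  exact hq j (Finset.mem_range.2 (Nat.lt_succ_of_le hj))

/-- A field whose brackets with `g 0, …, g n` are tangent to the hyperplane field spanned by them
has this property for all sections of the hyperplane field. -/
theorem lieBracket_mem_of_char (h : IsGoursatFrame n g p) [FiniteDimensional ℝ F] {K Z : F → F}
    (hK : SmoothNear K p) (hKmem : ∀ᶠ q in 𝓝 p, K q ∈ prefixSpan g n q)
    (hch : ∀ m ≤ n, ∀ᶠ q in 𝓝 p, lieBracket ℝ K (g m) q ∈ prefixSpan g n q)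
    (hZ : SmoothNear Z p) (hZmem : ∀ᶠ q in 𝓝 p, Z q ∈ prefixSpan g n q) :
    ∀ᶠ q in 𝓝 p, lieBracket ℝ K Z q ∈ prefixSpan g n q := by
  have hch' : ∀ᶠ q in 𝓝 p, ∀ m ∈ Finset.range (n + 1),
      lieBracket ℝ K (g m) q ∈ prefixSpan g n q :=
    (Filter.eventually_all_finset _).2 fun m hm => hch m (by have := Finset.mem_range.1 hm; omega)
  filter_upwards [hK.eventually, hKmem, hch', LocGen.eventually (h.locGen_prefix (by omega) hZ hZmem),
    h.image_Iic_smoothNear (i := n) (by omega)] with q h1 h2 h3 h4 h5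
  refine LocGen.lieBracket_apply_mem (𝒢 := {K}) (ℋ := g '' Iic n) (by rintro _ rfl; exact h1) h5
    (by rintro _ rfl; exact h2) ?_ ?_ (LocGen.of_mem rfl) h4
  · rintro _ ⟨j, hj, rfl⟩
    exact mem_prefixSpan hj q
  · rintro _ rfl _ ⟨j, hj, rfl⟩
    exact h3 j (Finset.mem_range.2 (Nat.lt_succ_of_le hj))

/-- Let `H` be the hyperplane field spanned by `g 0, …, g n`. Modulo `H`, the brackets of `g 0, …, g
(n - 1)` among themselves vanish, while `[g 0, g n]` does not. So the fields `k i = g i - r i • g 0`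
with `1 ≤ i < n`, where `r i` is the ratio of `[g i, g n]` to `[g 0, g n]` modulo `H`, are
characteristic for `H`. They span an involutive bundle, and for any first integral `x` of it with
`dx(g 0) ≠ 0` the vertical part of `g i` is `k i`. -/
theorem exists_independent_variable (h : IsGoursatFrame n g p) [FiniteDimensional ℝ F]
    (hn : 1 ≤ n) :
    ∃ x : F → ℝ, SmoothNear x p ∧ fderiv ℝ x p (g 0 p) = 1 ∧ ∀ i, 1 ≤ i → i < n → ∀ m ≤ n,
      ∀ᶠ q in 𝓝 p, lieBracket ℝ (vert g x i) (g m) q ∈ prefixSpan g n q := by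
  obtain ⟨θ, hθ, hd⟩ := h.exists_dual
  have g0 := h.smooth 0 (by omega)
  have gn := h.smooth n (by omega)
  have hω : ∀ᶠ q in 𝓝 p, ∀ v, v ∈ prefixSpan g n q ↔ θ (n + 1) q v = 0 := by
    filter_upwards [hd] with q hq v
    rw [mem_prefixSpan_iff hq.1 hq.2]
    refine ⟨fun h => h (n + 1) (by omega) (by omega), fun h j h1 h2 => ?_⟩
    obtain rfl : j = n + 1 := by omega
    exact h
  set a : ℕ → F → ℝ := fun i q => θ (n + 1) q (lieBracket ℝ (g i) (g n) q) with ha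
  have sa : ∀ i < n + 2, SmoothNear (a i) p := fun i hi =>
    (hθ (n + 1)).clm_apply ((h.smooth i hi).lieBracket gn)
  have a0 : a 0 p ≠ 0 := fun h0 => h.bracket_last ((hω.self_of_nhds _).2 h0)
  set r : ℕ → F → ℝ := fun i q => a i q * (a 0 q)⁻¹ with hr
  have sr : ∀ i < n + 2, SmoothNear (r i) p := fun i hi =>
    (sa i hi).mul ((sa 0 (by omega)).inv a0)
  set k : ℕ → F → F := fun i q => g i q - r i q • g 0 q with hk
  have sk : ∀ i < n + 2, SmoothNear (k i) p := fun i hi =>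
    (h.smooth i hi).sub ((sr i hi).smul g0)
  have kmem : ∀ i < n, ∀ q, k i q ∈ prefixSpan g n q := fun i hi q =>
    sub_mem (mem_prefixSpan hi.le q) (Submodule.smul_mem _ _ (mem_prefixSpan (Nat.zero_le n) q))
  have a0' : ∀ᶠ q in 𝓝 p, a 0 q ≠ 0 := (sa 0 (by omega)).continuousAt.eventually_ne a0
  -- the fields `k i` are characteristic
  have hch : ∀ i < n, ∀ m ≤ n, ∀ᶠ q in 𝓝 p, lieBracket ℝ (k i) (g m) q ∈ prefixSpan g n q := by
    intro i hi m hm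
    have key : ∀ᶠ q in 𝓝 p, lieBracket ℝ (g i) (g m) q - r i q • lieBracket ℝ (g 0) (g m) q ∈
        prefixSpan g n q := by
      rcases hm.lt_or_eq with hm | rfl
      · filter_upwards [h.bracket_square i hi m hm, h.bracket_square 0 (by omega) m hm] with q h1 h2
        exact sub_mem h1 (Submodule.smul_mem _ _ h2)
      · filter_upwards [hω, a0'] with q h1 h2
        rw [h1, map_sub, map_smul, smul_eq_mul]
        change a i q - a i q * (a 0 q)⁻¹ * a 0 q = 0
        field_simp
        ring
    filter_upwards [key, h.smooth i (by omega), g0, sr i (by omega)] with q h1 h2 h3 h4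
    rw [hk, lieBracket_sub_smul_left (h2.differentiableAt (by simp))
      (h3.differentiableAt (by simp)) (h4.differentiableAt (by simp))]
    exact add_mem h1 (Submodule.smul_mem _ _ (mem_prefixSpan (Nat.zero_le n) q))
  have k0 : ∀ᶠ q in 𝓝 p, k 0 q = 0 := by
    filter_upwards [a0'] with q h1
    simp [hk, hr, h1]
  -- they span an involutive subbundle
  have hinv : ∀ i < n, ∀ j < n, ∀ᶠ q in 𝓝 p, lieBracket ℝ (k i) (k j) q ∈
      Submodule.span ℝ ((fun m => k m q) '' Ico 1 n) := by
    intro i hi j hj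
    -- By the Jacobi identity the bracket of two characteristic fields is characteristic. What
    -- remains is that a characteristic section of the hyperplane field is a combination of the `k
    -- m`.
    set V := lieBracket ℝ (k i) (k j) with hV
    have sV : SmoothNear V p := (sk i (by omega)).lieBracket (sk j (by omega))
    have Vmem : ∀ᶠ q in 𝓝 p, V q ∈ prefixSpan g n q :=
      h.lieBracket_mem_of_char (sk i (by omega)) (Filter.Eventually.of_forall (kmem i hi))
        (hch i hi) (sk j (by omega)) (Filter.Eventually.of_forall (kmem j hj))
    have Vch : ∀ m ≤ n, ∀ᶠ q in 𝓝 p, lieBracket ℝ V (g m) q ∈ prefixSpan g n q := by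
      intro m hm
      have e1 := h.lieBracket_mem_of_char (sk i (by omega))
        (Filter.Eventually.of_forall (kmem i hi)) (hch i hi)
        ((sk j (by omega)).lieBracket (h.smooth m (by omega))) (hch j hj m hm)
      have e2 := h.lieBracket_mem_of_char (sk j (by omega))
        (Filter.Eventually.of_forall (kmem j hj)) (hch j hj)
        ((sk i (by omega)).lieBracket (h.smooth m (by omega))) (hch i hi m hm)
      filter_upwards [e1, e2, sk i (by omega), sk j (by omega), h.smooth m (by omega)]
        with q h1 h2 h3 h4 h5
      have h6 := leibniz_identity_lieBracket (𝕜 := ℝ) (n := ∞)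
        (by rw [minSmoothness_of_isRCLikeNormedField]; exact WithTop.coe_le_coe.2 le_top) h3 h4 h5
      rw [hV, eq_sub_of_add_eq h6.symm]
      exact sub_mem h1 h2
    set v : ℕ → F → ℝ := fun m q => θ m q (V q) with hv
    have sv : ∀ m, SmoothNear (v m) p := fun m => (hθ m).clm_apply sV
    set e : F → ℝ := fun q => ∑ m ∈ Finset.range n, v m q * r m q with he
    have se : SmoothNear e p := SmoothNear.sum fun m hm =>
      (sv m).mul (sr m (by have := Finset.mem_range.1 hm; omega))
    -- Modulo the `k m` only components along `g n` and `g 0` survive. Bracketing with `g 0` and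
    -- with `g n` isolates them, and both vanish because `[g 0, g n]` is transversal to the
    -- hyperplane field.
    set W : F → F := fun q => V q - ∑ m ∈ Finset.range n, v m q • k m q with hW
    have hWeq : W =ᶠ[𝓝 p] fun q => v n q • g n q + e q • g 0 q := by
      filter_upwards [hd, Vmem, hω] with q h1 h2 h3
      have h4 := h1.2 (V q)
      rw [Finset.sum_range_succ, (h3 _).1 h2, zero_smul, add_zero, Finset.sum_range_succ] at h4
      simp only [hW, hk, smul_sub, Finset.sum_sub_distrib, smul_smul, he, Finset.sum_smul]
      nth_rewrite 1 [h4]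
      abel
    have hWch : ∀ m ≤ n, ∀ᶠ q in 𝓝 p, lieBracket ℝ W (g m) q ∈ prefixSpan g n q := by
      intro m hm
      have hk' : ∀ᶠ q in 𝓝 p, ∀ l ∈ Finset.range n, SmoothNear (k l) q ∧ SmoothNear (v l) q ∧
          lieBracket ℝ (k l) (g m) q ∈ prefixSpan g n q :=
        (Filter.eventually_all_finset _).2 fun l hl => by
          have hl' := Finset.mem_range.1 hl
          filter_upwards [(sk l (by omega)).eventually, (sv l).eventually, hch l hl' m hm]
            with q h1 h2 h3 using ⟨h1, h2, h3⟩
      filter_upwards [hk', sV.eventually, Vmem, Vch m hm, (h.smooth m (by omega)).eventually]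
        with q h1 h2 h3 h4 h5
      refine LocGen.lieBracket_apply_mem (𝒢 := insert V (k '' Iio n)) (ℋ := {g m}) ?_
        (by rintro _ rfl; exact h5) ?_ (by rintro _ rfl; exact mem_prefixSpan hm q) ?_
        (sub_mem (LocGen.of_mem (mem_insert _ _)) (LocGen.sum
          (fun l hl => (h1 l hl).2.1)
          fun l hl => LocGen.of_mem (mem_insert_of_mem _ ⟨l, Finset.mem_range.1 hl, rfl⟩)))
        (LocGen.of_mem rfl)
      · rintro _ (rfl | ⟨l, hl, rfl⟩)
        exacts [h2, (h1 l (Finset.mem_range.2 hl)).1]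
      · rintro _ (rfl | ⟨l, hl, rfl⟩)
        exacts [h3, kmem l hl q]
      · rintro _ (rfl | ⟨l, hl, rfl⟩) _ rfl
        exacts [h4, (h1 l (Finset.mem_range.2 hl)).2.2]
    have hWf : ∀ m ≤ n, ∀ᶠ q in 𝓝 p, v n q * θ (n + 1) q (lieBracket ℝ (g n) (g m) q) +
        e q * θ (n + 1) q (lieBracket ℝ (g 0) (g m) q) = 0 := by
      intro m hm
      filter_upwards [hWch m hm, hWeq.eventually_nhds, hω, (sv n).eventually, se.eventually,
        gn.eventually, g0.eventually] with q h1 h2 h3 h4 h5 h6 h7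
      have h8 : lieBracket ℝ W (g m) q =
          lieBracket ℝ ((fun q => v n q • g n q) + fun q => e q • g 0 q) (g m) q :=
        Filter.EventuallyEq.lieBracket_vectorField_eq h2 Filter.EventuallyEq.rfl
      rw [h3, h8, lieBracket_add_left (h4.smul h6).differentiableAt (h5.smul h7).differentiableAt,
        map_add] at h1
      have e1 := lieBracket_smul_left (W := g m) h4.differentiableAt h6.differentiableAt
      have e2 := lieBracket_smul_left (W := g m) h5.differentiableAt h7.differentiableAt
      have o1 : θ (n + 1) q (g n q) = 0 := (h3 _).1 (mem_prefixSpan le_rfl q)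
      have o2 : θ (n + 1) q (g 0 q) = 0 := (h3 _).1 (mem_prefixSpan (Nat.zero_le n) q)
      change θ (n + 1) q (lieBracket ℝ (fun q => v n q • g n q) (g m) q) +
        θ (n + 1) q (lieBracket ℝ (fun q => e q • g 0 q) (g m) q) = 0 at h1
      rw [e1, e2] at h1
      simpa [o1, o2] using h1
    filter_upwards [hWf 0 (Nat.zero_le n), hWf n le_rfl, a0', hWeq, k0] with q h1 h2 h3 h4 h5
    have e1 : lieBracket ℝ (g 0) (g 0) q = 0 := by simp [lieBracket]
    have e2 : lieBracket ℝ (g n) (g n) q = 0 := by simp [lieBracket]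
    rw [e1, map_zero, mul_zero, add_zero, lieBracket_swap, map_neg] at h1
    rw [e2, map_zero, mul_zero, zero_add] at h2
    change v n q * -(a 0 q) = 0 at h1
    change e q * a 0 q = 0 at h2
    have v0 : v n q = 0 := by simpa [h3] using h1
    have e0 : e q = 0 := by simpa [h3] using h2
    rw [v0, e0, zero_smul, zero_smul, add_zero] at h4
    rw [sub_eq_zero.1 h4]
    refine sum_mem fun m hm => ?_
    rcases Nat.eq_zero_or_pos m with rfl | hm0
    · rw [h5, smul_zero]; exact zero_mem _
    · exact Submodule.smul_mem _ _ (Submodule.subset_span ⟨m, ⟨hm0, Finset.mem_range.1 hm⟩, rfl⟩)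
  have hlk : ∀ i, 1 ≤ i → i < n → ∀ j, 1 ≤ j → j < n →
      θ j p (k i p) = if i = j then 1 else 0 := by
    intro i hi hin j hj hjn
    have := hd.self_of_nhds.1
    simp only [hk, map_sub, map_smul, this i (by omega) j (by omega),
      this 0 (by omega) j (by omega), if_neg (show ¬ 0 = j by omega)]
    simp
  -- The values `1` on `g 0` and `r i` on `g i` are chosen so that this covector kills every `k i`.
  set l : F →L[ℝ] ℝ := θ 0 p + ∑ j ∈ Finset.Ico 1 n, r j p • θ j p with hl
  have hlg : ∀ i < n, l (g i p) = if i = 0 then 1 else r i p := by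
    intro i hi
    have e := hd.self_of_nhds.1
    have e1 : ∀ j ∈ Finset.Ico 1 n, r j p * θ j p (g i p) = if i = j then r j p else 0 := by
      intro j hj
      have := Finset.mem_Ico.1 hj
      rw [e i (by omega) j (by omega)]
      split_ifs <;> simp
    simp only [hl, add_apply, sum_apply, smul_apply, smul_eq_mul]
    rw [Finset.sum_congr rfl e1, e i (by omega) 0 (by omega), Finset.sum_ite_eq]
    rcases Nat.eq_zero_or_pos i with rfl | h0
    · simp
    · rw [if_neg (by omega), if_pos (Finset.mem_Ico.2 ⟨h0, hi⟩), if_neg (by omega), zero_add]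
  obtain ⟨x, sx, hxl, hx⟩ := exists_firstIntegral (ι := Fin (n - 1)) (l := l) (p := p)
    (k := fun i => k (i + 1)) (fun i => sk (i + 1) (by omega))
    (linearIndependent_of_dual (fun j => θ (j + 1) p) fun i j => by
      rw [hlk (i + 1) (by omega) (by omega) (j + 1) (by omega) (by omega)]
      simp [Fin.ext_iff])
    (fun i j => by
      filter_upwards [hinv (i + 1) (by omega) (j + 1) (by omega)] with q hq
      refine Submodule.span_mono ?_ hq
      rintro _ ⟨m, ⟨hm1, hm2⟩, rfl⟩
      exact ⟨⟨m - 1, by omega⟩, by simp [Nat.sub_add_cancel hm1]⟩)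
    (fun i => by
      simp only [hk, map_sub, map_smul, hlg (i + 1) (by omega), hlg 0 (by omega)]
      simp)
  have hx0 : fderiv ℝ x p (g 0 p) = 1 := by rw [hxl, hlg 0 (by omega)]; simp
  have hx0' : ∀ᶠ q in 𝓝 p, fderiv ℝ x q (g 0 q) ≠ 0 :=
    (sx.fderiv_apply g0).continuousAt.eventually_ne (by rw [hx0]; exact one_ne_zero)
  refine ⟨x, sx, hx0, fun i hi hin m hm => ?_⟩
  have hvk : vert g x i =ᶠ[𝓝 p] k i := by
    filter_upwards [hx, hx0'] with q h1 h2
    have h3 := h1 ⟨i - 1, by omega⟩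
    simp only [Nat.sub_add_cancel hi, hk, map_sub, map_smul, smul_eq_mul] at h3
    simp only [vert, hk]
    rw [sub_eq_zero.1 h3, mul_assoc, mul_inv_cancel₀ h2, mul_one]
  filter_upwards [hvk.eventually_nhds, hch i hin m hm] with q h1 h2
  have h1' : vert g x i =ᶠ[𝓝 q] k i := h1
  rwa [h1'.lieBracket_vectorField_eq Filter.EventuallyEq.rfl]

/-- The span at `q` of the components of `g 1, …, g i` along `ker dx`. -/
def vertSpan (g : ℕ → F → F) (x : F → ℝ) (i : ℕ) (q : F) : Submodule ℝ F :=
  Submodule.span ℝ ((fun j => vert g x j q) '' Icc 1 i)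

theorem vertSpan_mono (g : ℕ → F → F) (x : F → ℝ) {i j : ℕ} (h : i ≤ j) (q : F) :
    vertSpan g x i q ≤ vertSpan g x j q :=
  Submodule.span_mono (image_mono (Icc_subset_Icc_right h))

theorem vertSpan_le_prefixSpan (g : ℕ → F → F) (x : F → ℝ) (i : ℕ) (q : F) :
    vertSpan g x i q ≤ prefixSpan g i q := by
  rw [vertSpan, Submodule.span_le]
  rintro _ ⟨j, hj, rfl⟩
  exact sub_mem (mem_prefixSpan hj.2 q) (Submodule.smul_mem _ _ (mem_prefixSpan (Nat.zero_le i) q))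

theorem mem_vertSpan_of_mem_prefixSpan {x : F → ℝ} {i : ℕ} {q v : F}
    (h0 : fderiv ℝ x q (g 0 q) ≠ 0) (hv : v ∈ prefixSpan g i q) (hxv : fderiv ℝ x q v = 0) :
    v ∈ vertSpan g x i q := by
  have key : ∀ v ∈ prefixSpan g i q,
      v - (fderiv ℝ x q v * (fderiv ℝ x q (g 0 q))⁻¹) • g 0 q ∈ vertSpan g x i q := by
    intro v hv
    induction hv using Submodule.span_induction with
    | mem v hv =>
      obtain ⟨j, hj, rfl⟩ := hv
      rcases Nat.eq_zero_or_pos j with rfl | hj0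
      · simp [h0]
      · exact Submodule.subset_span ⟨j, ⟨hj0, hj⟩, rfl⟩
    | zero => simp
    | add v w _ _ hv hw =>
      convert add_mem hv hw using 1
      rw [map_add]
      module
    | smul c v _ hv =>
      convert Submodule.smul_mem _ c hv using 1
      rw [map_smul, smul_eq_mul]
      module
  simpa [hxv] using key v hv

theorem mem_vertSpan_of_apply_eq_zero {x : F → ℝ} {i : ℕ} {q v : F} {l : F →L[ℝ] ℝ}
    (hv : v ∈ vertSpan g x (i + 1) q) (hl : ∀ j, 1 ≤ j → j ≤ i → l (vert g x j q) = 0)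
    (hl' : l (vert g x (i + 1) q) ≠ 0) (hlv : l v = 0) : v ∈ vertSpan g x i q := by
  have key : ∀ v ∈ vertSpan g x (i + 1) q,
      v - (l v * (l (vert g x (i + 1) q))⁻¹) • vert g x (i + 1) q ∈ vertSpan g x i q := by
    intro v hv
    induction hv using Submodule.span_induction with
    | mem v hv =>
      obtain ⟨j, hj, rfl⟩ := hv
      rcases hj.2.lt_or_eq with hj0 | rfl
      · have := hl j hj.1 (by omega)
        simp only [this, zero_mul, zero_smul, sub_zero]
        exact Submodule.subset_span ⟨j, ⟨hj.1, by omega⟩, rfl⟩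
      · simp [hl']
    | zero => simp
    | add v w _ _ hv hw =>
      convert add_mem hv hw using 1
      rw [map_add]
      module
    | smul c v _ hv =>
      convert Submodule.smul_mem _ c hv using 1
      rw [map_smul, smul_eq_mul]
      module
  simpa [hlv] using key v hv

theorem apply_eq_zero_of_mem_vertSpan {x : F → ℝ} {i : ℕ} {q v : F} {l : F →L[ℝ] ℝ}
    (hv : v ∈ vertSpan g x i q) (hl : ∀ j, 1 ≤ j → j ≤ i → l (vert g x j q) = 0) : l v = 0 := by
  have : vertSpan g x i q ≤ LinearMap.ker l.toLinearMap := by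
    rw [vertSpan, Submodule.span_le]
    rintro _ ⟨j, hj, rfl⟩
    exact hl j hj.1 hj.2
  exact this hv

theorem fderiv_vert {x : F → ℝ} {q : F} (h0 : fderiv ℝ x q (g 0 q) ≠ 0) (j : ℕ) :
    fderiv ℝ x q (vert g x j q) = 0 := by
  simp [vert, h0]

theorem smoothNear_vert (h : IsGoursatFrame n g p) {x : F → ℝ} (sx : SmoothNear x p)
    (h0 : fderiv ℝ x p (g 0 p) ≠ 0) {j : ℕ} (hj : j < n + 2) : SmoothNear (vert g x j) p :=
  (h.smooth j hj).sub (((sx.fderiv_apply (h.smooth j hj)).mul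
    ((sx.fderiv_apply (h.smooth 0 (by omega))).inv h0)).smul (h.smooth 0 (by omega)))

theorem locGen_vert (h : IsGoursatFrame n g p) {x : F → ℝ} (sx : SmoothNear x p)
    (h0 : fderiv ℝ x p (g 0 p) ≠ 0) {j : ℕ} (hj : j < n + 2) :
    vert g x j ∈ LocGen {g 0, g j} p :=
  sub_mem (LocGen.of_mem (by simp)) (LocGen.smul (((sx.fderiv_apply (h.smooth j hj)).mul
    ((sx.fderiv_apply (h.smooth 0 (by omega))).inv h0))) (LocGen.of_mem (by simp)))

/-- If one index is below `n`, that field is characteristic and the bracket stays in the hyperplane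
field; if both indices equal `n`, the bracket is zero. It also stays in `ker dx`, since `x` is
constant along both fields. -/
theorem lieBracket_vert_mem (h : IsGoursatFrame n g p) [FiniteDimensional ℝ F] {x : F → ℝ}
    (sx : SmoothNear x p) (h0 : fderiv ℝ x p (g 0 p) ≠ 0)
    (hch : ∀ i, 1 ≤ i → i < n → ∀ m ≤ n,
      ∀ᶠ q in 𝓝 p, lieBracket ℝ (vert g x i) (g m) q ∈ prefixSpan g n q)
    {i j : ℕ} (hi : 1 ≤ i) (hin : i ≤ n) (hj : 1 ≤ j) (hjn : j ≤ n) :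
    ∀ᶠ q in 𝓝 p, lieBracket ℝ (vert g x i) (vert g x j) q ∈ vertSpan g x n q := by
  have sv : ∀ j < n + 2, SmoothNear (vert g x j) p := fun j hj => h.smoothNear_vert sx h0 hj
  have g0 := h.smooth 0 (by omega)
  have vmem : ∀ j, 1 ≤ j → j ≤ n → ∀ q, vert g x j q ∈ prefixSpan g n q := fun j h1 h2 q =>
    vertSpan_le_prefixSpan g x n q (Submodule.subset_span ⟨j, ⟨h1, h2⟩, rfl⟩)
  have h0' : ∀ᶠ q in 𝓝 p, fderiv ℝ x q (g 0 q) ≠ 0 :=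
    (sx.fderiv_apply g0).continuousAt.eventually_ne h0
  have key : ∀ᶠ q in 𝓝 p, lieBracket ℝ (vert g x i) (vert g x j) q ∈ prefixSpan g n q := by
    rcases hin.lt_or_eq with hin | rfl
    · exact h.lieBracket_mem_of_char (sv i (by omega))
        (Filter.Eventually.of_forall (vmem i hi hin.le)) (hch i hi hin) (sv j (by omega))
        (Filter.Eventually.of_forall (vmem j hj hjn))
    · rcases hjn.lt_or_eq with hjn | rfl
      · filter_upwards [h.lieBracket_mem_of_char (sv j (by omega))
          (Filter.Eventually.of_forall (vmem j hj hjn.le)) (hch j hj hjn) (sv i (by omega))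
          (Filter.Eventually.of_forall (vmem i hi le_rfl))] with q hq
        rw [lieBracket_swap]
        exact neg_mem hq
      · exact Filter.Eventually.of_forall fun q => by simp
  filter_upwards [key, h0'.eventually_nhds, h0', sx.eventually, (sv i (by omega)).eventually,
    (sv j (by omega)).eventually] with q h1 h2 h3 h4 h5 h6
  refine mem_vertSpan_of_mem_prefixSpan h3 h1 ?_
  have e : ∀ j, (fun q => fderiv ℝ x q (vert g x j q)) =ᶠ[𝓝 q] fun _ => 0 := fun j => by
    filter_upwards [h2] with q hq using fderiv_vert hq j
  rw [fderiv_apply_lieBracket_of_smoothNear h4 h5 h6, (e i).fderiv_eq, (e j).fderiv_eq]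
  simp

/-- The total derivative field, normalized by `dx = 1`. -/
def totalField (g : ℕ → F → F) (x : F → ℝ) (q : F) : F := (fderiv ℝ x q (g 0 q))⁻¹ • g 0 q

/-- Bracketing with `g 0` raises the index by at most one, and the bracket is vertical because `dx`
is constant on both fields, with values `0` and `1`. -/
theorem lieBracket_vert_totalField_mem (h : IsGoursatFrame n g p) [FiniteDimensional ℝ F]
    {x : F → ℝ} (sx : SmoothNear x p) (h0 : fderiv ℝ x p (g 0 p) ≠ 0)
    {j : ℕ} (hj : 1 ≤ j) (hjn : j ≤ n) :
    ∀ᶠ q in 𝓝 p, lieBracket ℝ (vert g x j) (totalField g x) q ∈ vertSpan g x (j + 1) q := by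
  have g0 := h.smooth 0 (by omega)
  have h0' : ∀ᶠ q in 𝓝 p, fderiv ℝ x q (g 0 q) ≠ 0 :=
    (sx.fderiv_apply g0).continuousAt.eventually_ne h0
  have sT : SmoothNear (totalField g x) p := ((sx.fderiv_apply g0).inv h0).smul g0
  filter_upwards [h.bracket_mem j hj hjn, h0', h0'.eventually_nhds, sx.eventually, sT.eventually,
    (h.smoothNear_vert sx h0 (j := j) (by omega)).eventually, g0.eventually,
    (h.smooth j (by omega)).eventually, LocGen.eventually (h.locGen_vert sx h0 (j := j) (by omega))]
    with q h1 h2 h3 h4 h5 h6 h7 h8 h9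
  refine mem_vertSpan_of_mem_prefixSpan h2 ?_ ?_
  · refine LocGen.lieBracket_apply_mem (𝒢 := {g 0, g j}) (ℋ := {g 0}) ?_ (by rintro _ rfl; exact h7)
      ?_ (by rintro _ rfl; exact mem_prefixSpan (by omega) q) ?_ h9
      (LocGen.smul ((h4.fderiv_apply h7).inv h2) (LocGen.of_mem rfl))
    · rintro _ (rfl | rfl)
      exacts [h7, h8]
    · rintro _ (rfl | rfl)
      exacts [mem_prefixSpan (by omega) q, mem_prefixSpan (by omega) q]
    · rintro _ (rfl | rfl) _ rfl
      · simp
      · rw [lieBracket_swap]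
        exact neg_mem h1
  · have e1 : (fun q => fderiv ℝ x q (vert g x j q)) =ᶠ[𝓝 q] fun _ => 0 := by
      filter_upwards [h3] with q hq using fderiv_vert hq j
    have e2 : (fun q => fderiv ℝ x q (totalField g x q)) =ᶠ[𝓝 q] fun _ => 1 := by
      filter_upwards [h3] with q hq
      simp [totalField, hq]
    rw [fderiv_apply_lieBracket_of_smoothNear h4 h6 h5, e1.fderiv_eq, e2.fderiv_eq]
    simp

/-- The vertical fields of index `1, …, n` span an involutive bundle, so the Frobenius theorem
applies to the covector dual to `g (n + 1)`, which annihilates this bundle at `p`. -/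
theorem exists_dependent_variable (h : IsGoursatFrame n g p) [FiniteDimensional ℝ F] {x : F → ℝ}
    (sx : SmoothNear x p) (h0 : fderiv ℝ x p (g 0 p) ≠ 0)
    (hch : ∀ i, 1 ≤ i → i < n → ∀ m ≤ n,
      ∀ᶠ q in 𝓝 p, lieBracket ℝ (vert g x i) (g m) q ∈ prefixSpan g n q) :
    ∃ y : F → ℝ, SmoothNear y p ∧ fderiv ℝ y p (vert g x (n + 1) p) ≠ 0 ∧
      ∀ j, 1 ≤ j → j ≤ n → ∀ᶠ q in 𝓝 p, fderiv ℝ y q (vert g x j q) = 0 := by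
  obtain ⟨θ, hθ, hd⟩ := h.exists_dual
  have e := hd.self_of_nhds.1
  have ev : ∀ i, 1 ≤ i → i < n + 2 → ∀ j, 1 ≤ j → j < n + 2 →
      θ j p (vert g x i p) = if i = j then 1 else 0 := by
    intro i hi hin j hj hjn
    simp only [vert, map_sub, map_smul, e i hin j hjn, e 0 (by omega) j hjn,
      if_neg (show ¬ 0 = j by omega)]
    simp
  obtain ⟨y, sy, hy, hyk⟩ := exists_firstIntegral (ι := Fin n) (l := θ (n + 1) p) (p := p)
    (k := fun i => vert g x (i + 1)) (fun i => h.smoothNear_vert sx h0 (by omega))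
    (linearIndependent_of_dual (fun j => θ (j + 1) p) fun i j => by
      rw [ev (i + 1) (by omega) (by omega) (j + 1) (by omega) (by omega)]
      simp [Fin.ext_iff])
    (fun i j => by
      filter_upwards [h.lieBracket_vert_mem sx h0 hch (i := i + 1) (j := j + 1) (by omega)
        (by omega) (by omega) (by omega)] with q hq
      refine Submodule.span_mono ?_ hq
      rintro _ ⟨m, ⟨hm1, hm2⟩, rfl⟩
      exact ⟨⟨m - 1, by omega⟩, by simp [Nat.sub_add_cancel hm1]⟩)
    (fun i => by
      rw [ev (i + 1) (by omega) (by omega) (n + 1) (by omega) (by omega), if_neg (by omega)])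
  refine ⟨y, sy, ?_, fun j hj hjn => ?_⟩
  · rw [hy, ev (n + 1) (by omega) (by omega) (n + 1) (by omega) (by omega), if_pos rfl]
    exact one_ne_zero
  · filter_upwards [hyk] with q hq
    simpa [Nat.sub_add_cancel hj] using hq ⟨j - 1, by omega⟩

/-- The successive total derivatives of `y`. -/
def totalDeriv (g : ℕ → F → F) (x y : F → ℝ) : ℕ → F → ℝ
  | 0 => y
  | k + 1 => fun q => fderiv ℝ (totalDeriv g x y k) q (totalField g x q)

theorem smoothNear_totalDeriv (h : IsGoursatFrame n g p) {x y : F → ℝ} (sx : SmoothNear x p)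
    (sy : SmoothNear y p) (h0 : fderiv ℝ x p (g 0 p) ≠ 0) (k : ℕ) :
    SmoothNear (totalDeriv g x y k) p := by
  have g0 := h.smooth 0 (by omega)
  induction k with
  | zero => exact sy
  | succ k ih => exact ih.fderiv_apply (((sx.fderiv_apply g0).inv h0).smul g0)

/-- Write `V` for the vertical field of index `j` and `T` for the total derivative. In `V(T y_k) =
T(V y_k) + [V, T] y_k` the first term vanishes, and so does the second, because `[V, T]` involves
only vertical fields of index at most `j + 1`, which annihilate `y_k`. -/
theorem fderiv_totalDeriv_vert (h : IsGoursatFrame n g p) [FiniteDimensional ℝ F] {x y : F → ℝ}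
    (sx : SmoothNear x p) (sy : SmoothNear y p) (h0 : fderiv ℝ x p (g 0 p) ≠ 0)
    (hy : ∀ j, 1 ≤ j → j ≤ n → ∀ᶠ q in 𝓝 p, fderiv ℝ y q (vert g x j q) = 0) (k : ℕ) :
    ∀ j, 1 ≤ j → j + k ≤ n →
      ∀ᶠ q in 𝓝 p, fderiv ℝ (totalDeriv g x y k) q (vert g x j q) = 0 := by
  have g0 := h.smooth 0 (by omega)
  have sT : SmoothNear (totalField g x) p := ((sx.fderiv_apply g0).inv h0).smul g0
  induction k with
  | zero => exact hy
  | succ k ih =>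
    intro j hj hjk
    have hall : ∀ᶠ q in 𝓝 p, ∀ i ∈ Finset.Icc 1 (j + 1),
        fderiv ℝ (totalDeriv g x y k) q (vert g x i q) = 0 :=
      (Filter.eventually_all_finset _).2 fun i hi => by
        have := Finset.mem_Icc.1 hi
        exact ih i this.1 (by omega)
    filter_upwards [h.lieBracket_vert_totalField_mem sx h0 hj (by omega), hall,
      (ih j hj (by omega)).eventually_nhds, (h.smoothNear_totalDeriv sx sy h0 k).eventually,
      sT.eventually, (h.smoothNear_vert sx h0 (j := j) (by omega)).eventually]
      with q h1 h2 h3 h4 h5 h6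
    have e := fderiv_apply_lieBracket_of_smoothNear h4 h6 h5
    have e0 : (fun q => fderiv ℝ (totalDeriv g x y k) q (vert g x j q)) =ᶠ[𝓝 q] fun _ => 0 := h3
    rw [apply_eq_zero_of_mem_vertSpan h1 fun i hi hij => h2 i (Finset.mem_Icc.2 ⟨hi, hij⟩),
      e0.fderiv_eq] at e
    change fderiv ℝ (fun q => fderiv ℝ (totalDeriv g x y k) q (totalField g x q)) q
      (vert g x j q) = 0
    simpa using e.symm

/-- The matrix of the `dy_k` on the vertical fields is triangular, so each vanishing derivative with
nonzero diagonal entry removes the top vertical field. -/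
theorem mem_vertSpan_of_fderiv_totalDeriv_eq_zero {x y : F → ℝ} {v : F} {N : ℕ} (hN : N ≤ n + 1)
    (hy : ∀ k j, 1 ≤ j → j + k ≤ n → fderiv ℝ (totalDeriv g x y k) p (vert g x j p) = 0)
    (hy' : ∀ k < N, fderiv ℝ (totalDeriv g x y k) p (vert g x (n + 1 - k) p) ≠ 0)
    (hv : v ∈ vertSpan g x (n + 1) p)
    (hvk : ∀ k < N, fderiv ℝ (totalDeriv g x y k) p v = 0) :
    v ∈ vertSpan g x (n + 1 - N) p := by
  induction N with
  | zero => exact hv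
  | succ N ih =>
    have h1 := ih (by omega) (fun k hk => hy' k (by omega)) fun k hk => hvk k (by omega)
    have e : n + 1 - N = n + 1 - (N + 1) + 1 := by omega
    have h2 := hy' N (by omega)
    rw [e] at h1 h2
    exact mem_vertSpan_of_apply_eq_zero h1 (fun j hj hjN => hy N j hj (by omega)) h2
      (hvk N (by omega))

/-- If the diagonal entry of `y_{k+1}` vanished, then with `j = n - k` the bracket of the `j`-th
vertical field with the total derivative would stay in the span of the first `j` vertical fields at
`p`. Then neither `[g 0, g j]` nor `[g 1, g j]` would leave the span of `g 0, …, g j` at `p`,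
against the growth of the flag. -/
theorem fderiv_totalDeriv_vert_ne_zero (h : IsGoursatFrame n g p) [FiniteDimensional ℝ F]
    {x y : F → ℝ} (sx : SmoothNear x p) (sy : SmoothNear y p) (h0 : fderiv ℝ x p (g 0 p) ≠ 0)
    (hch : ∀ i, 1 ≤ i → i < n → ∀ m ≤ n,
      ∀ᶠ q in 𝓝 p, lieBracket ℝ (vert g x i) (g m) q ∈ prefixSpan g n q)
    (hy : ∀ j, 1 ≤ j → j ≤ n → ∀ᶠ q in 𝓝 p, fderiv ℝ y q (vert g x j q) = 0)
    (hy0 : fderiv ℝ y p (vert g x (n + 1) p) ≠ 0) (k : ℕ) (hk : k ≤ n) :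
    fderiv ℝ (totalDeriv g x y k) p (vert g x (n + 1 - k) p) ≠ 0 := by
  have g0 := h.smooth 0 (by omega)
  have sT : SmoothNear (totalField g x) p := ((sx.fderiv_apply g0).inv h0).smul g0
  have sv : ∀ j < n + 2, SmoothNear (vert g x j) p := fun j hj => h.smoothNear_vert sx h0 hj
  have sy' := h.smoothNear_totalDeriv sx sy h0
  have hyv := h.fderiv_totalDeriv_vert sx sy h0 hy
  induction k using Nat.strong_induction_on with
  | _ k ih =>
  rcases Nat.eq_zero_or_pos k with rfl | hk0
  · exact hy0
  obtain ⟨k, rfl⟩ : ∃ l, k = l + 1 := ⟨k - 1, by omega⟩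
  obtain ⟨j, hj⟩ : ∃ j, n + 1 - (k + 1) = j := ⟨_, rfl⟩
  have hj1 : 1 ≤ j := by omega
  have hjn : j ≤ n := by omega
  have hjk : n + 1 - k = j + 1 := by omega
  rw [hj]
  intro hzero
  have e := fderiv_apply_lieBracket_of_smoothNear (sy' k) (sv j (by omega)) sT
  have e0 : (fun q => fderiv ℝ (totalDeriv g x y k) q (vert g x j q)) =ᶠ[𝓝 p] fun _ => 0 :=
    hyv k j hj1 (by omega)
  rw [e0.fderiv_eq] at e
  have e1 : fderiv ℝ (totalDeriv g x y k) p
      (lieBracket ℝ (vert g x j) (totalField g x) p) = 0 := by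
    rw [e]
    change fderiv ℝ (totalDeriv g x y (k + 1)) p (vert g x j p) - _ = 0
    rw [hzero]
    simp
  have hT : lieBracket ℝ (vert g x j) (totalField g x) p ∈ vertSpan g x j p := by
    refine mem_vertSpan_of_apply_eq_zero
      (h.lieBracket_vert_totalField_mem sx h0 hj1 hjn).self_of_nhds
      (fun i hi hij => (hyv k i hi (by omega)).self_of_nhds) ?_ e1
    rw [← hjk]
    exact ih k (by omega) (by omega)
  have hT' := vertSpan_le_prefixSpan g x j p hT
  have hTS : totalField g x p ∈ prefixSpan g j p :=
    Submodule.smul_mem _ _ (mem_prefixSpan (Nat.zero_le j) p)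
  have hvS : ∀ i, 1 ≤ i → i ≤ j → vert g x i p ∈ prefixSpan g j p := fun i h1 h2 =>
    vertSpan_le_prefixSpan g x j p (Submodule.subset_span ⟨i, ⟨h1, h2⟩, rfl⟩)
  have h0' : ∀ᶠ q in 𝓝 p, fderiv ℝ x q (g 0 q) ≠ 0 :=
    (sx.fderiv_apply g0).continuousAt.eventually_ne h0
  have gT : ∀ {𝒢 : Set (F → F)}, totalField g x ∈ 𝒢 → g 0 ∈ LocGen 𝒢 p := fun h𝒢 => by
    refine LocGen.congr (LocGen.smul (sx.fderiv_apply g0) (LocGen.of_mem h𝒢)) ?_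
    filter_upwards [h0'] with q hq
    rw [totalField, smul_smul, mul_inv_cancel₀ hq, one_smul]
  have gv : ∀ i < n + 2, ∀ {𝒢 : Set (F → F)}, totalField g x ∈ 𝒢 → vert g x i ∈ 𝒢 →
      g i ∈ LocGen 𝒢 p := fun i hi 𝒢 h1 h2 => by
    refine LocGen.congr (add_mem (LocGen.of_mem h2) (LocGen.smul
      ((sx.fderiv_apply (h.smooth i hi)).mul ((sx.fderiv_apply g0).inv h0)) (gT h1))) ?_
    filter_upwards with q
    simp [vert]
  refine h.bracket_notMem j hj1 hjn ⟨?_, ?_⟩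
  · refine LocGen.lieBracket_apply_mem (𝒢 := {totalField g x}) (ℋ := {totalField g x, vert g x j})
      (by rintro _ rfl; exact sT) ?_ (by rintro _ rfl; exact hTS) ?_ ?_ (gT rfl)
      (gv j (by omega) (by simp) (by simp))
    · rintro _ (rfl | rfl)
      exacts [sT, sv j (by omega)]
    · rintro _ (rfl | rfl)
      exacts [hTS, hvS j hj1 le_rfl]
    · rintro _ rfl _ (rfl | rfl)
      · simp
      · rw [lieBracket_swap]
        exact neg_mem hT'
  -- For `j = 1` the second bracket is `[g 1, g 1] = 0`.
  rcases hj1.eq_or_lt with rfl | hj2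
  · simp
  have hT1 : lieBracket ℝ (vert g x 1) (totalField g x) p ∈ prefixSpan g j p :=
    prefixSpan_mono g (show 1 + 1 ≤ j by omega) p (vertSpan_le_prefixSpan g x _ p
      (h.lieBracket_vert_totalField_mem sx h0 le_rfl (by omega)).self_of_nhds)
  -- Near `p` both vertical fields annihilate `y_0, …, y_k`, hence so does their bracket. The
  -- diagonal entries up to `k` are already known to be nonzero, so triangularity confines the
  -- bracket to indices at most `j`.
  have hc : lieBracket ℝ (vert g x 1) (vert g x j) p ∈ prefixSpan g j p := by
    refine vertSpan_le_prefixSpan g x j p ?_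
    have e2 : j = n + 1 - (k + 1) := hj.symm
    rw [e2]
    refine mem_vertSpan_of_fderiv_totalDeriv_eq_zero (N := k + 1) (by omega)
      (fun l i hi hil => (hyv l i hi hil).self_of_nhds)
      (fun l hl => ih l hl (by omega)) (vertSpan_mono g x (Nat.le_succ n) p
        (h.lieBracket_vert_mem sx h0 hch le_rfl (by omega) (by omega)
          (by omega)).self_of_nhds) fun l hl => ?_
    rw [← e2]
    have e3 : (fun q => fderiv ℝ (totalDeriv g x y l) q (vert g x j q)) =ᶠ[𝓝 p] fun _ => 0 :=
      hyv l j hj1 (by omega)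
    have e4 : (fun q => fderiv ℝ (totalDeriv g x y l) q (vert g x 1 q)) =ᶠ[𝓝 p] fun _ => 0 :=
      hyv l 1 le_rfl (by omega)
    rw [fderiv_apply_lieBracket_of_smoothNear (sy' l) (sv 1 (by omega)) (sv j (by omega)),
      e3.fderiv_eq, e4.fderiv_eq]
    simp
  refine LocGen.lieBracket_apply_mem (𝒢 := {totalField g x, vert g x 1})
    (ℋ := {totalField g x, vert g x j}) ?_ ?_ ?_ ?_ ?_ (gv 1 (by omega) (by simp) (by simp))
      (gv j (by omega) (by simp) (by simp))
  · rintro _ (rfl | rfl)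
    exacts [sT, sv 1 (by omega)]
  · rintro _ (rfl | rfl)
    exacts [sT, sv j (by omega)]
  · rintro _ (rfl | rfl)
    exacts [hTS, hvS 1 le_rfl hj1]
  · rintro _ (rfl | rfl)
    exacts [hTS, hvS j hj1 le_rfl]
  · rintro _ (rfl | rfl) _ (rfl | rfl)
    · simp
    · rw [lieBracket_swap]
      exact neg_mem hT'
    · exact hT1
    · exact hc

/-- The Goursat normal form: a Goursat distribution with regular flag is, near a point, the
contact distribution `dy_k = y_{k+1} dx` in suitable coordinates `x, y_0, …, y_n`. -/
theorem exists_jet_coordinates (h : IsGoursatFrame n g p) [FiniteDimensional ℝ F] (hn : 1 ≤ n) :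
    ∃ (x : F → ℝ) (y : ℕ → F → ℝ), SmoothNear x p ∧ (∀ k, SmoothNear (y k) p) ∧
      (∀ v, fderiv ℝ x p v = 0 → (∀ k ≤ n, fderiv ℝ (y k) p v = 0) → v = 0) ∧
      ∀ᶠ q in 𝓝 p, ∀ v ∈ Submodule.span ℝ {g 0 q, g 1 q}, ∀ k < n,
        fderiv ℝ (y k) q v = y (k + 1) q * fderiv ℝ x q v := by
  obtain ⟨x, sx, hx1, hch⟩ := h.exists_independent_variable hn
  have h0 : fderiv ℝ x p (g 0 p) ≠ 0 := by rw [hx1]; exact one_ne_zero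
  obtain ⟨y, sy, hy0, hy⟩ := h.exists_dependent_variable sx h0 hch
  have h0' : ∀ᶠ q in 𝓝 p, fderiv ℝ x q (g 0 q) ≠ 0 :=
    (sx.fderiv_apply (h.smooth 0 (by omega))).continuousAt.eventually_ne h0
  have hyv := h.fderiv_totalDeriv_vert sx sy h0 hy
  refine ⟨x, totalDeriv g x y, sx, h.smoothNear_totalDeriv sx sy h0, fun v hv hvk => ?_, ?_⟩
  · have hvS : v ∈ prefixSpan g (n + 1) p := by
      obtain ⟨θ, hθ, hd⟩ := h.exists_dual
      rw [mem_prefixSpan_iff hd.self_of_nhds.1 hd.self_of_nhds.2]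
      intros
      omega
    -- With all `n + 1` diagonal entries nonzero, the remaining vertical indices range over `Icc 1
    -- 0`, so the remaining span is zero.
    have := mem_vertSpan_of_fderiv_totalDeriv_eq_zero (N := n + 1) le_rfl
      (fun k j hj hjk => (hyv k j hj hjk).self_of_nhds)
      (fun k hk => h.fderiv_totalDeriv_vert_ne_zero sx sy h0 hch hy hy0 k (by omega))
      (mem_vertSpan_of_mem_prefixSpan h0 hvS hv) fun k hk => hvk k (by omega)
    simpa [vertSpan] using this
  -- The plane is spanned by `g 0`, on which the contact relation is the definition of `y_{k+1}`,
  -- and by the vertical part of `g 1`, on which `dx` and `dy_k` with `k < n` vanish.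
  · have hall : ∀ᶠ q in 𝓝 p, ∀ k ∈ Finset.range n,
        fderiv ℝ (totalDeriv g x y k) q (vert g x 1 q) = 0 :=
      (Filter.eventually_all_finset _).2 fun k hk => by
        have := Finset.mem_range.1 hk
        exact hyv k 1 le_rfl (by omega)
    filter_upwards [h0', hall] with q h1 h2 v hv k hk
    have e0 : fderiv ℝ (totalDeriv g x y k) q (g 0 q) =
        totalDeriv g x y (k + 1) q * fderiv ℝ x q (g 0 q) := by
      simp only [totalDeriv, totalField, map_smul, smul_eq_mul]
      field_simp
    have e1 := h2 k (Finset.mem_range.2 hk)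
    simp only [vert, map_sub, map_smul, smul_eq_mul, e0] at e1
    obtain ⟨a, b, rfl⟩ := Submodule.mem_span_pair.1 hv
    simp only [map_add, map_smul, smul_eq_mul, e0, sub_eq_zero.1 e1]
    field_simp

end IsGoursatFrame

end GoursatNormalForm

/-! ### Vector fields in a chart -/

section Charts

open VectorField

variable {d : ℕ} {M : Type*} [TopologicalSpace M] [ChartedSpace (EuclideanSpace ℝ (Fin d)) M]

/-- The derivative of a chart, as a map to the model space. -/
def chartDeriv (φ : OpenPartialHomeomorph M (EuclideanSpace ℝ (Fin d))) (q : M) :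
    TangentSpace (𝓡 d) q →L[ℝ] EuclideanSpace ℝ (Fin d) :=
  mfderiv (𝓡 d) (𝓡 d) φ q

/-- The representative of a vector field in a chart. -/
def pushField (φ : OpenPartialHomeomorph M (EuclideanSpace ℝ (Fin d))) (W : VField d M)
    (u : EuclideanSpace ℝ (Fin d)) : EuclideanSpace ℝ (Fin d) :=
  chartDeriv φ (φ.symm u) (W (φ.symm u))

/-- The vector field with a given representative in a chart. -/
def pullField (φ : OpenPartialHomeomorph M (EuclideanSpace ℝ (Fin d)))
    (W : EuclideanSpace ℝ (Fin d) → EuclideanSpace ℝ (Fin d)) : VField d M :=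
  mpullback (𝓡 d) (𝓡 d) φ W

variable {φ : OpenPartialHomeomorph M (EuclideanSpace ℝ (Fin d))}

theorem mlieBracket_eq_lieBracket (V W : EuclideanSpace ℝ (Fin d) → EuclideanSpace ℝ (Fin d)) :
    mlieBracket (𝓡 d) V W = lieBracket ℝ V W :=
  (mlieBracketWithin_univ (I := 𝓡 d) (V := V) (W := W)).symm.trans
    (mlieBracketWithin_eq_lieBracketWithin.trans lieBracketWithin_univ)

theorem mdifferentiable_of_mem_maximalAtlas (hφ : φ ∈ IsManifold.maximalAtlas (𝓡 d) ∞ M) :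
    φ.MDifferentiable (𝓡 d) (𝓡 d) :=
  ⟨(contMDiffOn_of_mem_maximalAtlas hφ).mdifferentiableOn (by simp),
    (contMDiffOn_symm_of_mem_maximalAtlas hφ).mdifferentiableOn (by simp)⟩

theorem trans_mem_maximalAtlas (hφ : φ ∈ IsManifold.maximalAtlas (𝓡 d) ∞ M)
    {e : OpenPartialHomeomorph (EuclideanSpace ℝ (Fin d)) (EuclideanSpace ℝ (Fin d))}
    (h1 : ContDiffOn ℝ ∞ e e.source) (h2 : ContDiffOn ℝ ∞ e.symm e.target) :
    φ ≫ₕ e ∈ IsManifold.maximalAtlas (𝓡 d) ∞ M := by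
  have he : e ∈ contDiffGroupoid ∞ (𝓡 d) := by
    rw [contDiffGroupoid, mem_groupoid_of_pregroupoid]
    exact ⟨by simpa [contDiffPregroupoid] using h1, by simpa [contDiffPregroupoid] using h2⟩
  intro e' he'
  obtain ⟨h3, h4⟩ := hφ e' he'
  refine ⟨?_, ?_⟩
  · rw [OpenPartialHomeomorph.trans_symm_eq_symm_trans_symm, OpenPartialHomeomorph.trans_assoc]
    exact (contDiffGroupoid ∞ (𝓡 d)).trans ((contDiffGroupoid ∞ (𝓡 d)).symm he) h3
  · rw [← OpenPartialHomeomorph.trans_assoc]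
    exact (contDiffGroupoid ∞ (𝓡 d)).trans h4 he

theorem isInvertible_mfderiv_chart (hφ : φ ∈ IsManifold.maximalAtlas (𝓡 d) ∞ M) {q : M}
    (hq : q ∈ φ.source) : (mfderiv (𝓡 d) (𝓡 d) φ q).IsInvertible :=
  ⟨(mdifferentiable_of_mem_maximalAtlas hφ).mfderiv hq, rfl⟩

theorem chartDeriv_bijective (hφ : φ ∈ IsManifold.maximalAtlas (𝓡 d) ∞ M) {q : M}
    (hq : q ∈ φ.source) : Function.Bijective (chartDeriv φ q) :=
  (mdifferentiable_of_mem_maximalAtlas hφ).mfderiv_bijective hq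

/-- The derivatives of the chart and of its inverse are inverse to each other. Written as a pullback
along `φ.symm`, the representative inherits smoothness and naturality of brackets. -/
theorem pushField_eq_mpullback (hφ : φ ∈ IsManifold.maximalAtlas (𝓡 d) ∞ M) (W : VField d M)
    {u : EuclideanSpace ℝ (Fin d)} (hu : u ∈ φ.target) :
    pushField φ W u = mpullback (𝓡 d) (𝓡 d) φ.symm W u := by
  have h := mdifferentiable_of_mem_maximalAtlas hφ
  have h3 : (mfderiv (𝓡 d) (𝓡 d) φ.symm u).IsInvertible := ⟨h.symm.mfderiv hu, rfl⟩
  have h1 := h.symm_comp_deriv (φ.map_target hu)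
  rw [φ.right_inv hu] at h1
  have h4 : W (φ.symm u) = mfderiv (𝓡 d) (𝓡 d) φ.symm u (pushField φ W u) :=
    (DFunLike.congr_fun h1 (W (φ.symm u))).symm
  exact (h3.inverse_apply_eq.2 h4).symm

theorem chartDeriv_pullField (hφ : φ ∈ IsManifold.maximalAtlas (𝓡 d) ∞ M)
    (W : EuclideanSpace ℝ (Fin d) → EuclideanSpace ℝ (Fin d)) {q : M} (hq : q ∈ φ.source) :
    chartDeriv φ q (pullField φ W q) = W (φ q) :=
  (isInvertible_mfderiv_chart hφ hq).self_apply_inverse (W (φ q))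

theorem pushField_pullField (hφ : φ ∈ IsManifold.maximalAtlas (𝓡 d) ∞ M)
    (W : EuclideanSpace ℝ (Fin d) → EuclideanSpace ℝ (Fin d))
    {u : EuclideanSpace ℝ (Fin d)} (hu : u ∈ φ.target) :
    pushField φ (pullField φ W) u = W u := by
  have h := chartDeriv_pullField hφ W (φ.map_target hu)
  rwa [φ.right_inv hu] at h

theorem pushField_apply {q : M} (hq : q ∈ φ.source) (W : VField d M) :
    pushField φ W (φ q) = chartDeriv φ q (W q) := by
  rw [pushField, φ.left_inv hq]

theorem pushField_add (V W : VField d M) : pushField φ (V + W) = pushField φ V + pushField φ W := by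
  funext u
  exact map_add (chartDeriv φ (φ.symm u)) _ _

theorem pushField_smul (c : ℝ) (V : VField d M) : pushField φ (c • V) = c • pushField φ V := by
  funext u
  exact map_smul (chartDeriv φ (φ.symm u)) _ _

theorem pushField_zero : pushField φ (0 : VField d M) = 0 := by
  funext u
  exact map_zero (chartDeriv φ (φ.symm u))

theorem pushField_mem_locGen_of_mem_span {𝒮 : Set (VField d M)} {𝒢 : Set _}
    {u : EuclideanSpace ℝ (Fin d)} (h : ∀ Y ∈ 𝒮, pushField φ Y ∈ LocGen 𝒢 u) :
    ∀ Y ∈ Submodule.span ℝ 𝒮, pushField φ Y ∈ LocGen 𝒢 u := by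
  intro Y hY
  induction hY using Submodule.span_induction with
  | mem Y hY => exact h Y hY
  | zero => rw [pushField_zero]; exact zero_mem _
  | add V W _ _ hV hW => rw [pushField_add]; exact add_mem hV hW
  | smul c V _ hV => rw [pushField_smul]; exact Submodule.smul_mem _ _ hV

variable [IsManifold (𝓡 d) ∞ M]

theorem smoothNear_pushField (hφ : φ ∈ IsManifold.maximalAtlas (𝓡 d) ∞ M) {W : VField d M}
    {U : Set M} (hU : IsOpen U) (hW : W.SmoothOn U) {q : M} (hq : q ∈ φ.source) (hqU : q ∈ U) :
    SmoothNear (pushField φ W) (φ q) := by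
  have h := mdifferentiable_of_mem_maximalAtlas hφ
  have hev : ∀ᶠ u in 𝓝 (φ q), u ∈ φ.target ∧ φ.symm u ∈ U :=
    Filter.Eventually.and (φ.open_target.mem_nhds (φ.map_source hq))
      ((φ.continuousAt_symm (φ.map_source hq)).preimage_mem_nhds
        (by rw [φ.left_inv hq]; exact hU.mem_nhds hqU))
  filter_upwards [hev.eventually_nhds] with u hu
  have hu' := hu.self_of_nhds
  have h3 : (mfderiv (𝓡 d) (𝓡 d) φ.symm u).IsInvertible := ⟨h.symm.mfderiv hu'.1, rfl⟩
  have h4 : ContMDiffAt (𝓡 d) (𝓡 d) ∞ φ.symm u :=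
    (contMDiffOn_symm_of_mem_maximalAtlas hφ).contMDiffAt (φ.open_target.mem_nhds hu'.1)
  have h5 := ContMDiffAt.mpullback_vectorField_preimage (V := W) (n := ∞) (m := ∞)
    (hW.contMDiffAt (hU.mem_nhds hu'.2)) h4 h3 le_rfl
  have h6 := contMDiffAt_vectorSpace_iff_contDiffAt.1 h5
  refine h6.congr_of_eventuallyEq ?_
  filter_upwards [hu] with v hv using pushField_eq_mpullback hφ W hv.1

theorem pushField_mlieBracket (hφ : φ ∈ IsManifold.maximalAtlas (𝓡 d) ∞ M) {V W : VField d M}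
    {U : Set M} (hU : IsOpen U) (hV : V.SmoothOn U) (hW : W.SmoothOn U) {u}
    (hu : u ∈ φ.target) (hqU : φ.symm u ∈ U) :
    pushField φ (mlieBracket (𝓡 d) V W) u = lieBracket ℝ (pushField φ V) (pushField φ W) u := by
  have h4 : ContMDiffAt (𝓡 d) (𝓡 d) ∞ φ.symm u :=
    (contMDiffOn_symm_of_mem_maximalAtlas hφ).contMDiffAt (φ.open_target.mem_nhds hu)
  have h2 : minSmoothness ℝ 2 ≤ (∞ : WithTop ℕ∞) := by
    rw [minSmoothness_of_isRCLikeNormedField]; exact WithTop.coe_le_coe.2 le_top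
  have : IsManifold (𝓡 d) (minSmoothness ℝ 2) M := IsManifold.of_le h2
  have : IsManifold (𝓡 d) (minSmoothness ℝ 2) (EuclideanSpace ℝ (Fin d)) := IsManifold.of_le h2
  have h5 : mpullback (𝓡 d) (𝓡 d) φ.symm (mlieBracket (𝓡 d) V W) u = _ :=
    mpullback_mlieBracket (n := ∞)
      ((hV.contMDiffAt (hU.mem_nhds hqU)).mdifferentiableAt (by simp))
      ((hW.contMDiffAt (hU.mem_nhds hqU)).mdifferentiableAt (by simp)) h4 h2
  have h6 : ∀ W : VField d M, pushField φ W =ᶠ[𝓝 u] mpullback (𝓡 d) (𝓡 d) φ.symm W := fun W => by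
    filter_upwards [φ.open_target.mem_nhds hu] with v hv using pushField_eq_mpullback hφ W hv
  have h7 := Filter.EventuallyEq.lieBracket_vectorField_eq (𝕜 := ℝ) (h6 V) (h6 W)
  exact (pushField_eq_mpullback hφ _ hu).trans
    (h5.trans ((congrFun (mlieBracket_eq_lieBracket _ _) u).trans h7.symm))

theorem smoothOn_pullField (hφ : φ ∈ IsManifold.maximalAtlas (𝓡 d) ∞ M)
    {W : EuclideanSpace ℝ (Fin d) → EuclideanSpace ℝ (Fin d)} {s : Set (EuclideanSpace ℝ (Fin d))}
    (hs : IsOpen s) (hW : ContDiffOn ℝ ∞ W s) :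
    (pullField φ W).SmoothOn (φ.source ∩ φ ⁻¹' s) := by
  intro q hq
  have h4 : ContMDiffAt (𝓡 d) (𝓡 d) ∞ φ q :=
    (contMDiffOn_of_mem_maximalAtlas hφ).contMDiffAt (φ.open_source.mem_nhds hq.1)
  exact (ContMDiffAt.mpullback_vectorField_preimage (V := W) (n := ∞) (m := ∞)
    (contMDiffAt_vectorSpace_iff_contDiffAt.2 (hW.contDiffAt (hs.mem_nhds hq.2))) h4
    (isInvertible_mfderiv_chart hφ hq.1) le_rfl).contMDiffWithinAt

theorem VField.SmoothOn.add {V W : VField d M} {U : Set M} (hV : V.SmoothOn U)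
    (hW : W.SmoothOn U) : (V + W).SmoothOn U :=
  fun x hx => (hV x hx).add_section (hW x hx)

theorem VField.SmoothOn.const_smul {V : VField d M} {U : Set M} (hV : V.SmoothOn U) (c : ℝ) :
    (c • V).SmoothOn U :=
  fun x hx => (hV x hx).const_smul_section

theorem VField.smoothOn_zero (U : Set M) : (0 : VField d M).SmoothOn U :=
  (Bundle.contMDiff_zeroSection ℝ (TangentSpace (𝓡 d) : M → Type _)).contMDiffOn

theorem VField.SmoothOn.mlieBracket {V W : VField d M} {U : Set M} (hU : IsOpen U)
    (hV : V.SmoothOn U) (hW : W.SmoothOn U) :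
    VField.SmoothOn (VectorField.mlieBracket (𝓡 d) V W) U := by
  intro x hx
  have : IsManifold (𝓡 d) (minSmoothness ℝ 2) M := IsManifold.of_le (n := ∞)
    (by rw [minSmoothness_of_isRCLikeNormedField]; exact WithTop.coe_le_coe.2 le_top)
  have : IsManifold (𝓡 d) (((⊤ : ℕ∞) : WithTop ℕ∞) + 1) M := ‹IsManifold (𝓡 d) ∞ M›
  exact (ContMDiffAt.mlieBracket_vectorField (m := ⊤) (n := ⊤) (hV.contMDiffAt (hU.mem_nhds hx))
    (hW.contMDiffAt (hU.mem_nhds hx))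
    (by rw [minSmoothness_of_isRCLikeNormedField]; exact le_rfl)).contMDiffWithinAt

end Charts

/-! ### The small derived flag in a chart -/

section Words

open VectorField

variable {F : Type} [NormedAddCommGroup F] [NormedSpace ℝ F] {S : Set (F → F)}

/-- The left-normed iterated brackets of length at most `i` of the fields in `S`. -/
def bracketWords (S : Set (F → F)) : ℕ → Set (F → F)
  | 0 => ∅
  | 1 => S
  | i + 2 => bracketWords S (i + 1) ∪
      {Z | ∃ A ∈ S, ∃ W ∈ bracketWords S (i + 1), Z = lieBracket ℝ A W}

/-- The values at `q` of the iterated brackets of length at most `i`. -/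
def wordSpan (S : Set (F → F)) (i : ℕ) (q : F) : Submodule ℝ F :=
  Submodule.span ℝ ((fun W => W q) '' bracketWords S i)

theorem bracketWords_subset_succ (S : Set (F → F)) (i : ℕ) :
    bracketWords S i ⊆ bracketWords S (i + 1) := by
  cases i with
  | zero => exact empty_subset _
  | succ i => exact subset_union_left

theorem bracketWords_mono (S : Set (F → F)) : Monotone (bracketWords S) :=
  monotone_nat_of_le_succ (bracketWords_subset_succ S)

theorem wordSpan_mono (S : Set (F → F)) {i j : ℕ} (h : i ≤ j) (q : F) :
    wordSpan S i q ≤ wordSpan S j q :=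
  Submodule.span_mono (image_mono (bracketWords_mono S h))

theorem lieBracket_mem_bracketWords {A W : F → F} {i : ℕ} (hi : 1 ≤ i) (hA : A ∈ S)
    (hW : W ∈ bracketWords S i) : lieBracket ℝ A W ∈ bracketWords S (i + 1) := by
  obtain ⟨i, rfl⟩ : ∃ j, i = j + 1 := ⟨i - 1, by omega⟩
  exact Or.inr ⟨A, hA, W, hW, rfl⟩

theorem apply_mem_wordSpan {W : F → F} {i : ℕ} (hW : W ∈ bracketWords S i) (q : F) :
    W q ∈ wordSpan S i q :=
  Submodule.subset_span ⟨W, hW, rfl⟩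

theorem smoothNear_of_mem_bracketWords {p : F} (hS : ∀ A ∈ S, SmoothNear A p) (i : ℕ) :
    ∀ W ∈ bracketWords S i, SmoothNear W p := by
  induction i using Nat.strong_induction_on with
  | _ i ih =>
  match i with
  | 0 => rintro W ⟨⟩
  | 1 => exact hS
  | i + 2 =>
    rintro W (hW | ⟨A, hA, W, hW, rfl⟩)
    · exact ih (i + 1) (by omega) W hW
    · exact (hS A hA).lieBracket (ih (i + 1) (by omega) W hW)

end Words

namespace RankTwoDistribution

open VectorField

variable {d : ℕ} {M : Type*} [TopologicalSpace M] [ChartedSpace (EuclideanSpace ℝ (Fin d)) M]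
  [IsManifold (𝓡 d) ∞ M]

/-- `A` and `B` represent a frame of `D` over `s` in the chart `φ`. -/
structure IsFrameIn (D : RankTwoDistribution d M)
    (φ : OpenPartialHomeomorph M (EuclideanSpace ℝ (Fin d))) (s : Set (EuclideanSpace ℝ (Fin d)))
    (A B : EuclideanSpace ℝ (Fin d) → EuclideanSpace ℝ (Fin d)) : Prop where
  mem : φ ∈ IsManifold.maximalAtlas (𝓡 d) ∞ M
  isOpen : IsOpen s
  subset : s ⊆ φ.target
  smooth₁ : ContDiffOn ℝ ∞ A s
  smooth₂ : ContDiffOn ℝ ∞ B s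
  linearIndependent : ∀ u ∈ s, LinearIndependent ℝ ![A u, B u]
  map_fiber : ∀ u ∈ s, (D.fiber (φ.symm u)).map (chartDeriv φ (φ.symm u)).toLinearMap =
    Submodule.span ℝ {A u, B u}

variable {D : RankTwoDistribution d M} {φ : OpenPartialHomeomorph M (EuclideanSpace ℝ (Fin d))}
  {s : Set (EuclideanSpace ℝ (Fin d))} {A B : EuclideanSpace ℝ (Fin d) → EuclideanSpace ℝ (Fin d)}

theorem exists_isFrameIn (D : RankTwoDistribution d M)
    (hφ : φ ∈ IsManifold.maximalAtlas (𝓡 d) ∞ M) {q : M} (hq : q ∈ φ.source) :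
    ∃ s A B, φ q ∈ s ∧ D.IsFrameIn φ s A B := by
  obtain ⟨U, hU, hqU, X, Y, hX, hY, h⟩ := D.exists_frame q
  refine ⟨φ.target ∩ φ.symm ⁻¹' U, pushField φ X, pushField φ Y,
    ⟨φ.map_source hq, by rwa [mem_preimage, φ.left_inv hq]⟩, hφ,
    φ.isOpen_inter_preimage_symm hU, inter_subset_left, ?_, ?_, ?_, ?_⟩
  · intro u hu
    have := smoothNear_pushField hφ hU hX (φ.map_target hu.1) hu.2
    rw [φ.right_inv hu.1] at this
    exact this.contDiffAt.contDiffWithinAt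
  · intro u hu
    have := smoothNear_pushField hφ hU hY (φ.map_target hu.1) hu.2
    rw [φ.right_inv hu.1] at this
    exact this.contDiffAt.contDiffWithinAt
  · intro u hu
    have h1 := (h _ hu.2).1.map' (chartDeriv φ (φ.symm u)).toLinearMap
      (LinearMap.ker_eq_bot.2 (chartDeriv_bijective hφ (φ.map_target hu.1)).1)
    have e : (chartDeriv φ (φ.symm u)).toLinearMap ∘ ![X (φ.symm u), Y (φ.symm u)] =
        ![pushField φ X u, pushField φ Y u] := by
      funext i
      fin_cases i <;> rfl
    rw [e] at h1
    exact h1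
  · intro u hu
    rw [(h _ hu.2).2, Submodule.map_span, image_pair]
    rfl

namespace IsFrameIn

theorem smoothNear (h : D.IsFrameIn φ s A B) {u : EuclideanSpace ℝ (Fin d)} (hu : u ∈ s) :
    ∀ X ∈ ({A, B} : Set _), SmoothNear X u := by
  rintro X (rfl | rfl)
  exacts [h.smooth₁.smoothNear (h.isOpen.mem_nhds hu), h.smooth₂.smoothNear (h.isOpen.mem_nhds hu)]

theorem chartDeriv_mem_span_iff (h : D.IsFrameIn φ s A B) {q : M} (hq : q ∈ φ.source)
    (hqs : φ q ∈ s) {v : TangentSpace (𝓡 d) q} :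
    chartDeriv φ q v ∈ Submodule.span ℝ {A (φ q), B (φ q)} ↔ v ∈ D.fiber q := by
  have h1 := h.map_fiber _ hqs
  rw [φ.left_inv hq] at h1
  rw [← h1]
  refine ⟨?_, fun hv => Submodule.mem_map_of_mem hv⟩
  rintro ⟨v', hv', e⟩
  rwa [← (chartDeriv_bijective h.mem hq).1 e]

theorem smoothOn_of_mem_derivedSections {U : Set M} (hU : IsOpen U) (i : ℕ) :
    ∀ Y ∈ D.derivedSections U i, Y.SmoothOn U := by
  induction i using Nat.strong_induction_on with
  | _ i ih =>
  have key : ∀ (𝒮 : Set (VField d M)), (∀ Y ∈ 𝒮, Y.SmoothOn U) →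
      ∀ Y ∈ Submodule.span ℝ 𝒮, Y.SmoothOn U := by
    intro 𝒮 h𝒮 Y hY
    induction hY using Submodule.span_induction with
    | mem Y hY => exact h𝒮 Y hY
    | zero => exact VField.smoothOn_zero U
    | add V W _ _ hV hW => exact hV.add hW
    | smul c V _ hV => exact hV.const_smul c
  match i with
  | 0 =>
    rintro Y hY
    rw [(Submodule.mem_bot ℝ).1 hY]
    exact VField.smoothOn_zero U
  | 1 => exact key _ fun Y hY => hY.1
  | i + 2 =>
    intro Y hY
    obtain ⟨Y, hY', Z, hZ, rfl⟩ := Submodule.mem_sup.1 hY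
    refine (ih (i + 1) (by omega) Y hY').add (key _ ?_ Z hZ)
    rintro _ ⟨V, W, hV, hW, rfl⟩
    exact VField.SmoothOn.mlieBracket hU hV.1 (ih (i + 1) (by omega) W hW)

theorem smoothOn_of_mem_lieSquareSections {U : Set M} (hU : IsOpen U) (i : ℕ) :
    ∀ Y ∈ D.lieSquareSections U i, Y.SmoothOn U := by
  induction i using Nat.strong_induction_on with
  | _ i ih =>
  have key : ∀ (𝒮 : Set (VField d M)), (∀ Y ∈ 𝒮, Y.SmoothOn U) →
      ∀ Y ∈ Submodule.span ℝ 𝒮, Y.SmoothOn U := by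
    intro 𝒮 h𝒮 Y hY
    induction hY using Submodule.span_induction with
    | mem Y hY => exact h𝒮 Y hY
    | zero => exact VField.smoothOn_zero U
    | add V W _ _ hV hW => exact hV.add hW
    | smul c V _ hV => exact hV.const_smul c
  match i with
  | 0 =>
    rintro Y hY
    rw [(Submodule.mem_bot ℝ).1 hY]
    exact VField.smoothOn_zero U
  | 1 => exact key _ fun Y hY => hY.1
  | i + 2 =>
    intro Y hY
    obtain ⟨Y, hY', Z, hZ, rfl⟩ := Submodule.mem_sup.1 hY
    refine (ih (i + 1) (by omega) Y hY').add (key _ ?_ Z hZ)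
    rintro _ ⟨V, W, hV, hW, rfl⟩
    exact VField.SmoothOn.mlieBracket hU (ih (i + 1) (by omega) V hV) (ih (i + 1) (by omega) W hW)

theorem eventually_symm_mem (h : D.IsFrameIn φ s A B) {U : Set M} (hU : IsOpen U)
    {u : EuclideanSpace ℝ (Fin d)} (hu : u ∈ s) (huU : φ.symm u ∈ U) :
    ∀ᶠ v in 𝓝 u, v ∈ s ∧ φ.symm v ∈ U :=
  Filter.Eventually.and (h.isOpen.mem_nhds hu)
    ((φ.symm.continuousAt (h.subset hu)).preimage_mem_nhds (hU.mem_nhds huU))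

theorem pushField_mem_locGen_of_isSectionOn (h : D.IsFrameIn φ s A B) {U : Set M} (hU : IsOpen U)
    {u : EuclideanSpace ℝ (Fin d)} (hu : u ∈ s) (huU : φ.symm u ∈ U) {X : VField d M}
    (hX : D.IsSectionOn U X) : pushField φ X ∈ LocGen {A, B} u := by
  have hs := smoothNear_pushField h.mem hU hX.1 (φ.map_target (h.subset hu)) huU
  rw [φ.right_inv (h.subset hu)] at hs
  have h1 : pushField φ X ∈ LocGen (range ![A, B]) u := by
    refine LocGen.of_mem_span (fun i => ?_) ?_ hs ?_
    · fin_cases i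
      exacts [h.smoothNear hu A (by simp), h.smoothNear hu B (by simp)]
    · have e : (fun i => ![A, B] i u) = ![A u, B u] := by
        funext i
        fin_cases i <;> rfl
      rw [e]
      exact h.linearIndependent u hu
    · filter_upwards [h.eventually_symm_mem hU hu huU] with v hv
      have h2 : pushField φ X v ∈ Submodule.span ℝ {A v, B v} := by
        rw [← h.map_fiber v hv.1]
        exact Submodule.mem_map_of_mem (hX.2 _ hv.2)
      refine Submodule.span_mono ?_ h2
      rintro _ (rfl | rfl)
      exacts [⟨0, rfl⟩, ⟨1, rfl⟩]
  refine LocGen.mono ?_ h1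
  rintro _ ⟨i, rfl⟩
  fin_cases i <;> simp

theorem pushField_mlieBracket_eventuallyEq (h : D.IsFrameIn φ s A B) {U : Set M} (hU : IsOpen U)
    {u : EuclideanSpace ℝ (Fin d)} (hu : u ∈ s) (huU : φ.symm u ∈ U) {V W : VField d M}
    (hV : V.SmoothOn U) (hW : W.SmoothOn U) :
    pushField φ (mlieBracket (𝓡 d) V W) =ᶠ[𝓝 u] lieBracket ℝ (pushField φ V) (pushField φ W) := by
  filter_upwards [h.eventually_symm_mem hU hu huU] with v hv
  exact pushField_mlieBracket h.mem hU hV hW (h.subset hv.1) hv.2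

/-- Sections are combinations of the frame, and by the Leibniz rule bracketing such combinations
produces only brackets of frame fields, of no greater length. This gives the upper bound for the
flag in the chart. -/
theorem pushField_mem_locGen_bracketWords (h : D.IsFrameIn φ s A B) {U : Set M} (hU : IsOpen U)
    {u : EuclideanSpace ℝ (Fin d)} (hu : u ∈ s) (huU : φ.symm u ∈ U) (i : ℕ) :
    ∀ Y ∈ D.derivedSections U i, pushField φ Y ∈ LocGen (bracketWords {A, B} i) u := by
  induction i using Nat.strong_induction_on with
  | _ i ih =>
  match i with
  | 0 =>
    rintro Y hY
    rw [(Submodule.mem_bot ℝ).1 hY, pushField_zero]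
    exact zero_mem _
  | 1 =>
    exact pushField_mem_locGen_of_mem_span
      fun Y hY => h.pushField_mem_locGen_of_isSectionOn hU hu huU hY
  | i + 2 =>
    intro Y hY
    obtain ⟨Y, hY', Z, hZ, rfl⟩ := Submodule.mem_sup.1 hY
    rw [pushField_add]
    refine add_mem (LocGen.mono (bracketWords_subset_succ _ _) (ih (i + 1) (by omega) Y hY'))
      (pushField_mem_locGen_of_mem_span ?_ Z hZ)
    rintro _ ⟨V, W, hV, hW, rfl⟩
    refine LocGen.congr ?_ (h.pushField_mlieBracket_eventuallyEq hU hu huU hV.1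
      (smoothOn_of_mem_derivedSections hU _ W hW))
    refine LocGen.lieBracket (𝒢 := {A, B}) (ℋ := bracketWords {A, B} (i + 1)) (h.smoothNear hu)
      (smoothNear_of_mem_bracketWords (h.smoothNear hu) _) (fun G hG => LocGen.of_mem ?_)
      (fun G hG => LocGen.of_mem ?_) (fun G hG H hH => LocGen.of_mem ?_)
      (h.pushField_mem_locGen_of_isSectionOn hU hu huU hV) (ih (i + 1) (by omega) W hW)
    · exact bracketWords_mono {A, B} (show 1 ≤ i + 2 by omega) hG
    · exact bracketWords_subset_succ _ _ hG
    · exact lieBracket_mem_bracketWords (by omega) hG hH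

theorem isSectionOn_pullField (h : D.IsFrameIn φ s A B) :
    ∀ X ∈ ({A, B} : Set (EuclideanSpace ℝ (Fin d) → EuclideanSpace ℝ (Fin d))),
      D.IsSectionOn (φ.source ∩ φ ⁻¹' s) (pullField φ X) := by
  intro X hX
  refine ⟨smoothOn_pullField h.mem h.isOpen ?_, fun q hq => ?_⟩
  · rcases hX with rfl | rfl
    exacts [h.smooth₁, h.smooth₂]
  · rw [← h.chartDeriv_mem_span_iff hq.1 hq.2, chartDeriv_pullField h.mem X hq.1]
    refine Submodule.subset_span ?_
    rcases hX with rfl | rfl <;> simp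

/-- The frame fields are themselves representatives of sections and charts respect brackets, so
every iterated bracket of the frame occurs. This gives the lower bound for the flag. -/
theorem exists_pushField_eq (h : D.IsFrameIn φ s A B) (i : ℕ) :
    ∀ W ∈ bracketWords {A, B} i, ∃ Y ∈ D.derivedSections (φ.source ∩ φ ⁻¹' s) i,
      ∀ u ∈ s, pushField φ Y u = W u := by
  have hV : IsOpen (φ.source ∩ φ ⁻¹' s) := φ.isOpen_inter_preimage h.isOpen
  have hsV : ∀ u ∈ s, φ.symm u ∈ φ.source ∩ φ ⁻¹' s := fun u hu =>
    ⟨φ.map_target (h.subset hu), by rwa [mem_preimage, φ.right_inv (h.subset hu)]⟩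
  have sec := h.isSectionOn_pullField
  induction i using Nat.strong_induction_on with
  | _ i ih =>
  match i with
  | 0 => rintro W ⟨⟩
  | 1 =>
    exact fun W hW => ⟨pullField φ W, Submodule.subset_span (sec W hW),
      fun u hu => pushField_pullField h.mem W (h.subset hu)⟩
  | i + 2 =>
    rintro W (hW | ⟨X, hX, W, hW, rfl⟩)
    · obtain ⟨Y, hY, h1⟩ := ih (i + 1) (by omega) W hW
      exact ⟨Y, Submodule.mem_sup_left hY, h1⟩
    · obtain ⟨Y, hY, h1⟩ := ih (i + 1) (by omega) W hW
      refine ⟨mlieBracket (𝓡 d) (pullField φ X) Y, Submodule.mem_sup_right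
        (Submodule.subset_span ⟨_, _, sec X hX, hY, rfl⟩), fun u hu => ?_⟩
      rw [pushField_mlieBracket h.mem hV (sec X hX).1 (smoothOn_of_mem_derivedSections hV _ Y hY)
        (h.subset hu) (hsV u hu)]
      refine Filter.EventuallyEq.lieBracket_vectorField_eq ?_ ?_
      · filter_upwards [h.isOpen.mem_nhds hu] with v hv
        exact pushField_pullField h.mem X (h.subset hv)
      · filter_upwards [h.isOpen.mem_nhds hu] with v hv using h1 v hv

theorem map_derivedFlag (h : D.IsFrameIn φ s A B) (i : ℕ) {q : M} (hq : q ∈ φ.source)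
    (hqs : φ q ∈ s) :
    (D.derivedFlag i q).map (chartDeriv φ q).toLinearMap = wordSpan {A, B} i (φ q) := by
  apply le_antisymm
  · rw [derivedFlag, Submodule.map_span, Submodule.span_le]
    rintro _ ⟨_, ⟨U, hU, hqU, Y, hY, rfl⟩, rfl⟩
    have h1 := h.pushField_mem_locGen_bracketWords hU hqs (by rwa [φ.left_inv hq]) i Y hY
    have h2 := LocGen.apply_mem (P := wordSpan {A, B} i (φ q)) h1
      fun G hG => apply_mem_wordSpan hG _
    rwa [pushField_apply hq] at h2
  · rw [wordSpan, Submodule.span_le]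
    rintro _ ⟨W, hW, rfl⟩
    obtain ⟨Y, hY, h1⟩ := h.exists_pushField_eq i W hW
    have h2 := h1 _ hqs
    rw [pushField_apply hq] at h2
    exact ⟨Y q, Submodule.subset_span
      ⟨_, φ.isOpen_inter_preimage h.isOpen, ⟨hq, hqs⟩, Y, hY, rfl⟩, h2⟩

theorem finrank_derivedFlag (h : D.IsFrameIn φ s A B) (i : ℕ) {q : M} (hq : q ∈ φ.source)
    (hqs : φ q ∈ s) :
    finrank ℝ (D.derivedFlag i q) = finrank ℝ (wordSpan {A, B} i (φ q)) := by
  rw [← h.map_derivedFlag i hq hqs]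
  exact (Submodule.equivMapOfInjective (chartDeriv φ q).toLinearMap
    (chartDeriv_bijective h.mem hq).1 (D.derivedFlag i q)).finrank_eq

/-- An upper bound for the sequence of Lie squares. -/
theorem map_lieSquareFlag_le (h : D.IsFrameIn φ s A B) {𝒢 : ℕ → Set (_ → _)} {q : M}
    (hq : q ∈ φ.source) (hqs : φ q ∈ s) (h𝒢 : ∀ i, ∀ G ∈ 𝒢 i, SmoothNear G (φ q))
    (hA : A ∈ LocGen (𝒢 1) (φ q)) (hB : B ∈ LocGen (𝒢 1) (φ q))
    (hmono : ∀ i, ∀ G ∈ 𝒢 (i + 1), G ∈ LocGen (𝒢 (i + 2)) (φ q))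
    (hbr : ∀ i, ∀ G ∈ 𝒢 (i + 1), ∀ H ∈ 𝒢 (i + 1),
      lieBracket ℝ G H ∈ LocGen (𝒢 (i + 2)) (φ q)) (i : ℕ) :
    (D.lieSquareFlag i q).map (chartDeriv φ q).toLinearMap ≤
      Submodule.span ℝ ((fun G => G (φ q)) '' 𝒢 i) := by
  rw [lieSquareFlag, Submodule.map_span, Submodule.span_le]
  rintro _ ⟨_, ⟨U, hU, hqU, Y, hY, rfl⟩, rfl⟩
  have hqU' : φ.symm (φ q) ∈ U := by rwa [φ.left_inv hq]
  have key : ∀ i, ∀ Y ∈ D.lieSquareSections U i, pushField φ Y ∈ LocGen (𝒢 i) (φ q) := by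
    clear hY Y i
    intro i
    induction i using Nat.strong_induction_on with
    | _ i ih =>
    match i with
    | 0 =>
      rintro Y hY
      rw [(Submodule.mem_bot ℝ).1 hY, pushField_zero]
      exact zero_mem _
    | 1 =>
      refine pushField_mem_locGen_of_mem_span fun Y hY =>
        LocGen.trans (h.pushField_mem_locGen_of_isSectionOn hU hqs hqU' hY) ?_
      rintro _ (rfl | rfl)
      exacts [hA, hB]
    | i + 2 =>
      intro Y hY
      obtain ⟨Y, hY', Z, hZ, rfl⟩ := Submodule.mem_sup.1 hY
      rw [pushField_add]
      refine add_mem (LocGen.trans (ih (i + 1) (by omega) Y hY') (hmono i))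
        (pushField_mem_locGen_of_mem_span ?_ Z hZ)
      rintro _ ⟨V, W, hV, hW, rfl⟩
      refine LocGen.congr ?_ (h.pushField_mlieBracket_eventuallyEq hU hqs hqU'
        (smoothOn_of_mem_lieSquareSections hU _ V hV)
        (smoothOn_of_mem_lieSquareSections hU _ W hW))
      exact LocGen.lieBracket (h𝒢 (i + 1)) (h𝒢 (i + 1)) (hmono i) (hmono i) (hbr i)
        (ih (i + 1) (by omega) V hV) (ih (i + 1) (by omega) W hW)
  have h2 := LocGen.apply_mem (P := Submodule.span ℝ ((fun G => G (φ q)) '' 𝒢 i)) (key i Y hY)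
    fun G hG => Submodule.subset_span ⟨G, hG, rfl⟩
  rwa [pushField_apply hq] at h2

end IsFrameIn

theorem isSectionOn_of_mem_span {U : Set M} {X : VField d M}
    (hX : X ∈ Submodule.span ℝ {X | D.IsSectionOn U X}) : D.IsSectionOn U X := by
  induction hX using Submodule.span_induction with
  | mem Y hY => exact hY
  | zero => exact ⟨VField.smoothOn_zero U, fun x _ => zero_mem _⟩
  | add V W _ _ hV hW => exact ⟨hV.1.add hW.1, fun x hx => add_mem (hV.2 x hx) (hW.2 x hx)⟩
  | smul c V _ hV => exact ⟨hV.1.const_smul c, fun x hx => Submodule.smul_mem _ _ (hV.2 x hx)⟩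

theorem derivedSections_le_lieSquareSections (U : Set M) (i : ℕ) :
    D.derivedSections U i ≤ D.lieSquareSections U i := by
  have h1 : ∀ i, D.lieSquareSections U 1 ≤ D.lieSquareSections U (i + 1) := by
    intro i
    induction i with
    | zero => exact le_rfl
    | succ i ih => exact ih.trans le_sup_left
  induction i using Nat.strong_induction_on with
  | _ i ih =>
  match i with
  | 0 => exact le_rfl
  | 1 => exact le_rfl
  | i + 2 =>
    refine sup_le_sup (ih (i + 1) (by omega)) (Submodule.span_mono ?_)
    rintro _ ⟨X, Y, hX, hY, rfl⟩
    exact ⟨X, Y, h1 i (Submodule.subset_span hX), ih (i + 1) (by omega) hY, rfl⟩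

theorem derivedFlag_le_lieSquareFlag (D : RankTwoDistribution d M) (i : ℕ) (q : M) :
    D.derivedFlag i q ≤ D.lieSquareFlag i q := by
  refine Submodule.span_mono ?_
  rintro _ ⟨U, hU, hqU, Y, hY, rfl⟩
  exact ⟨U, hU, hqU, Y, derivedSections_le_lieSquareSections U i hY, rfl⟩

/-- The two flags can differ only from the third term on: both second terms are `D + [D, D]`. -/
theorem derivedFlag_two (D : RankTwoDistribution d M) (q : M) :
    D.derivedFlag 2 q = D.lieSquareFlag 2 q := by
  apply le_antisymm (D.derivedFlag_le_lieSquareFlag 2 q)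
  refine Submodule.span_mono ?_
  rintro _ ⟨U, hU, hqU, Y, hY, rfl⟩
  refine ⟨U, hU, hqU, Y, ?_, rfl⟩
  revert hY
  refine fun hY => sup_le_sup (le_refl (D.derivedSections U 1)) (Submodule.span_mono ?_) hY
  rintro _ ⟨X, Y, hX, hY, rfl⟩
  exact ⟨X, Y, isSectionOn_of_mem_span hX, hY, rfl⟩

theorem derivedFlag_mono (D : RankTwoDistribution d M) (q : M) :
    Monotone fun i => D.derivedFlag i q := by
  refine monotone_nat_of_le_succ fun i => Submodule.span_mono ?_
  rintro _ ⟨U, hU, hqU, Y, hY, rfl⟩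
  refine ⟨U, hU, hqU, Y, ?_, rfl⟩
  cases i with
  | zero => rw [(Submodule.mem_bot ℝ).1 hY]; exact zero_mem _
  | succ i => exact Submodule.mem_sup_left hY

end RankTwoDistribution

/-! ### Generic points -/

section Rank

variable {F : Type} [NormedAddCommGroup F] [NormedSpace ℝ F] {p : F}

theorem SmoothNear.eventually_linearIndependent {ι : Type} [Fintype ι] [FiniteDimensional ℝ F]
    {E : Type} [NormedAddCommGroup E] [NormedSpace ℝ E] {p : E} {k : ι → E → F} (hk : ∀ i, SmoothNear (k i) p) (hp : LinearIndependent ℝ fun i => k i p) :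
    ∀ᶠ q in 𝓝 p, LinearIndependent ℝ fun i => k i q := by
  obtain ⟨θ, -, hθ⟩ := exists_coframe hk hp
  filter_upwards [hθ] with q hq using linearIndependent_of_coframe hq

/-- Among a family of fields one can choose a basis of its span at a point. -/
theorem exists_basis_fields [FiniteDimensional ℝ F] {𝒲 : Set (F → F)} (p : F) :
    ∃ k : Fin (finrank ℝ (Submodule.span ℝ ((fun W => W p) '' 𝒲))) → F → F,
      (∀ i, k i ∈ 𝒲) ∧ LinearIndependent ℝ fun i => k i p := by
  obtain ⟨f, hf, -, hli⟩ := Submodule.exists_fun_fin_finrank_span_eq ℝ ((fun W => W p) '' 𝒲)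
  choose k hk hkf using hf
  refine ⟨k, hk, ?_⟩
  have : (fun i => k i p) = f := funext hkf
  rwa [this]

theorem span_range_le_of_mem {ι : Type} {𝒲 : Set (F → F)} {k : ι → F → F} (hk : ∀ i, k i ∈ 𝒲)
    (q : F) : Submodule.span ℝ (range fun i => k i q) ≤
      Submodule.span ℝ ((fun W => W q) '' 𝒲) := by
  refine Submodule.span_mono ?_
  rintro _ ⟨i, rfl⟩
  exact ⟨k i, hk i, rfl⟩

/-- Fields that form a basis of the span at `p` stay independent nearby. -/
theorem eventually_finrank_span_le [FiniteDimensional ℝ F] {𝒲 : Set (F → F)}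
    (h𝒲 : ∀ W ∈ 𝒲, SmoothNear W p) :
    ∀ᶠ q in 𝓝 p, finrank ℝ (Submodule.span ℝ ((fun W => W p) '' 𝒲)) ≤
      finrank ℝ (Submodule.span ℝ ((fun W => W q) '' 𝒲)) := by
  obtain ⟨k, hk, hli⟩ := exists_basis_fields (𝒲 := 𝒲) p
  filter_upwards [SmoothNear.eventually_linearIndependent (fun i => h𝒲 _ (hk i)) hli] with q hq
  have h1 := finrank_span_eq_card hq
  rw [Fintype.card_fin] at h1
  rw [← h1]
  exact Submodule.finrank_mono (span_range_le_of_mem hk q)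

/-- If the values of a family of fields span subspaces of constant dimension, then a smooth field
with values in these subspaces is a combination of members of the family. -/
theorem locGen_of_finrank_eq [FiniteDimensional ℝ F] {𝒲 : Set (F → F)}
    (h𝒲 : ∀ W ∈ 𝒲, SmoothNear W p)
    (hr : ∀ᶠ q in 𝓝 p, finrank ℝ (Submodule.span ℝ ((fun W => W q) '' 𝒲)) =
      finrank ℝ (Submodule.span ℝ ((fun W => W p) '' 𝒲)))
    {Z : F → F} (hZ : SmoothNear Z p)
    (hZ𝒲 : ∀ᶠ q in 𝓝 p, Z q ∈ Submodule.span ℝ ((fun W => W q) '' 𝒲)) : Z ∈ LocGen 𝒲 p := by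
  obtain ⟨k, hk, hli⟩ := exists_basis_fields (𝒲 := 𝒲) p
  refine LocGen.mono (𝒢 := range k) (by rintro _ ⟨i, rfl⟩; exact hk i)
    (LocGen.of_mem_span (fun i => h𝒲 _ (hk i)) hli hZ ?_)
  filter_upwards [SmoothNear.eventually_linearIndependent (fun i => h𝒲 _ (hk i)) hli, hr, hZ𝒲]
    with q hq h1 h2
  have h3 := finrank_span_eq_card hq
  rw [Fintype.card_fin] at h3
  rwa [Submodule.eq_of_le_of_finrank_eq (span_range_le_of_mem hk q) (h3.trans h1.symm)]

end Rank

/-- A bounded lower semicontinuous function with natural values is constant on some open subset of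
every nonempty open set. -/
theorem exists_isOpen_const {X : Type*} [TopologicalSpace X] {f : X → ℕ} {N : ℕ}
    (hN : ∀ x, f x ≤ N) (hf : ∀ x, ∀ᶠ y in 𝓝 x, f x ≤ f y) {W : Set X} (hW : IsOpen W)
    (hne : W.Nonempty) :
    ∃ V ⊆ W, IsOpen V ∧ V.Nonempty ∧ ∀ x ∈ V, ∀ y ∈ V, f y = f x := by
  -- A bounded natural-valued function attains a maximum, and lower semicontinuity prevents it from
  -- dropping near a maximum point.
  obtain ⟨x, hx, hxm⟩ : ∃ x ∈ W, ∀ y ∈ W, f y ≤ f x := by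
    have hb : BddAbove (f '' W) := ⟨N, by rintro _ ⟨x, _, rfl⟩; exact hN x⟩
    obtain ⟨x, hx, hxe⟩ := Nat.sSup_mem (hne.image f) hb
    exact ⟨x, hx, fun y hy => hxe ▸ le_csSup hb ⟨y, hy, rfl⟩⟩
  obtain ⟨V, hVsub, hV, hxV⟩ := eventually_nhds_iff.1 (Filter.Eventually.and (hW.mem_nhds hx) (hf x))
  refine ⟨V, fun y hy => (hVsub y hy).1, hV, ⟨x, hxV⟩, ?_⟩
  have key : ∀ y ∈ V, f y = f x := fun y hy => le_antisymm (hxm y (hVsub y hy).1) (hVsub y hy).2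
  exact fun y hy z hz => (key z hz).trans (key y hy).symm

namespace RankTwoDistribution

variable {d : ℕ} {M : Type*} [TopologicalSpace M] [ChartedSpace (EuclideanSpace ℝ (Fin d)) M]

instance finiteDimensional_tangentSpace (x : M) : FiniteDimensional ℝ (TangentSpace (𝓡 d) x) :=
  inferInstanceAs (FiniteDimensional ℝ (EuclideanSpace ℝ (Fin d)))

theorem finrank_tangentSpace (x : M) : finrank ℝ (TangentSpace (𝓡 d) x) = d :=
  finrank_euclideanSpace_fin (𝕜 := ℝ) (n := d)

variable [IsManifold (𝓡 d) ∞ M]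

theorem eventually_finrank_derivedFlag_le (D : RankTwoDistribution d M) (i : ℕ) (q : M) :
    ∀ᶠ q' in 𝓝 q, finrank ℝ (D.derivedFlag i q) ≤ finrank ℝ (D.derivedFlag i q') := by
  have hφ := IsManifold.chart_mem_maximalAtlas (I := 𝓡 d) (n := ∞) q
  have hq := mem_chart_source (EuclideanSpace ℝ (Fin d)) q
  obtain ⟨s, A, B, hs, h⟩ := D.exists_isFrameIn hφ hq
  have h1 := eventually_finrank_span_le (smoothNear_of_mem_bracketWords (h.smoothNear hs) i)
  have h2 := ((chartAt (EuclideanSpace ℝ (Fin d)) q).continuousAt hq).eventually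
    (h1.and (h.isOpen.mem_nhds hs))
  filter_upwards [h2, (chartAt (EuclideanSpace ℝ (Fin d)) q).open_source.mem_nhds hq] with q' h3 h4
  rw [h.finrank_derivedFlag i hq hs, h.finrank_derivedFlag i h4 h3.2]
  exact h3.1

theorem finrank_derivedFlag_le (D : RankTwoDistribution d M) (i : ℕ) (q : M) :
    finrank ℝ (D.derivedFlag i q) ≤ d :=
  (Submodule.finrank_le _).trans_eq (finrank_tangentSpace q)

theorem isOpen_genericPoints (D : RankTwoDistribution d M) : IsOpen D.genericPoints := by
  rw [isOpen_iff_mem_nhds]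
  rintro p ⟨U, hU, hp, h⟩
  filter_upwards [hU.mem_nhds hp] with q hq
  exact ⟨U, hU, hq, fun i r hr => (h i r hr).trans (h i q hq).symm⟩

/-- Infinitely many ranks must be made constant at once. Let the largest rank over all points of `W`
and all indices be attained at `x` for the index `i₀`. Near `x`, every term of index at least `i₀`
keeps this maximal rank, because the flag increases; the finitely many smaller indices are treated
one after another by shrinking. -/
theorem dense_genericPoints (D : RankTwoDistribution d M) : Dense D.genericPoints := by
  rw [dense_iff_inter_open]
  intro W hW hne
  obtain ⟨x, i₀, hx, hxm⟩ : ∃ x, ∃ i₀ : ℕ, x ∈ W ∧ ∀ y ∈ W, ∀ i,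
      finrank ℝ (D.derivedFlag i y) ≤ finrank ℝ (D.derivedFlag i₀ x) := by
    set S : Set ℕ := {r | ∃ x ∈ W, ∃ i : ℕ, finrank ℝ (D.derivedFlag i x) = r} with hS
    have hb : BddAbove S := ⟨d, by rintro _ ⟨x, _, i, rfl⟩; exact D.finrank_derivedFlag_le i x⟩
    have hSne : S.Nonempty := ⟨_, hne.some, hne.some_mem, 0, rfl⟩
    obtain ⟨x, hx, i, hi⟩ := Nat.sSup_mem hSne hb
    exact ⟨x, i, hx, fun y hy j => hi ▸ le_csSup hb ⟨y, hy, j, rfl⟩⟩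
  obtain ⟨V, hVsub, hV, hxV⟩ := eventually_nhds_iff.1
    (Filter.Eventually.and (hW.mem_nhds hx) (D.eventually_finrank_derivedFlag_le i₀ x))
  have key : ∀ k : ℕ, ∃ V' ⊆ V, IsOpen V' ∧ V'.Nonempty ∧ ∀ i < k, ∀ y ∈ V', ∀ z ∈ V',
      finrank ℝ (D.derivedFlag i z) = finrank ℝ (D.derivedFlag i y) := by
    intro k
    induction k with
    | zero => exact ⟨V, subset_rfl, hV, ⟨x, hxV⟩, fun i hi => absurd hi (Nat.not_lt_zero i)⟩
    | succ k ih =>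
      obtain ⟨V', h1, h2, h3, h4⟩ := ih
      obtain ⟨V'', h5, h6, h7, h8⟩ := exists_isOpen_const (fun y => D.finrank_derivedFlag_le k y)
        (D.eventually_finrank_derivedFlag_le k) h2 h3
      refine ⟨V'', h5.trans h1, h6, h7, fun i hi y hy z hz => ?_⟩
      rcases (Nat.lt_succ_iff.1 hi).lt_or_eq with hi | rfl
      exacts [h4 i hi y (h5 hy) z (h5 hz), h8 y hy z hz]
  obtain ⟨V', h1, h2, ⟨y, hy⟩, h4⟩ := key i₀
  refine ⟨y, (hVsub y (h1 hy)).1, V', h2, hy, fun i z hz => ?_⟩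
  rcases lt_or_ge i i₀ with hi | hi
  · exact h4 i hi y hy z hz
  · have : ∀ z ∈ V', finrank ℝ (D.derivedFlag i z) = finrank ℝ (D.derivedFlag i₀ x) := fun z hz =>
      le_antisymm (hxm z (hVsub z (h1 hz)).1 i) ((hVsub z (h1 hz)).2.trans
        (Submodule.finrank_mono (D.derivedFlag_mono z hi)))
    rw [this z hz, this y hy]

end RankTwoDistribution

/-! ### Goursat distributions with constant small growth -/

section Stabilization

open VectorField

variable {F : Type} [NormedAddCommGroup F] [NormedSpace ℝ F] {S : Set (F → F)} {p : F}

/-- If brackets of length `i + 1` are combinations of those of length at most `i`, then the latter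
generate an involutive family. -/
theorem lieBracket_mem_locGen_bracketWords [CompleteSpace F] {i : ℕ} (hi : 1 ≤ i)
    (hS : ∀ A ∈ S, SmoothNear A p)
    (h : ∀ W ∈ bracketWords S (i + 1), W ∈ LocGen (bracketWords S i) p) (j : ℕ) :
    ∀ W ∈ bracketWords S j, ∀ Z ∈ LocGen (bracketWords S i) p,
      lieBracket ℝ W Z ∈ LocGen (bracketWords S i) p := by
  have hw := smoothNear_of_mem_bracketWords hS i
  have hX : ∀ X ∈ S, ∀ Z ∈ LocGen (bracketWords S i) p,
      lieBracket ℝ X Z ∈ LocGen (bracketWords S i) p := by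
    intro X hX Z hZ
    refine LocGen.lieBracket (𝒢 := {X}) (by rintro _ rfl; exact hS _ hX) hw ?_
      (fun H hH => LocGen.of_mem hH) ?_ (LocGen.of_mem rfl) hZ
    · rintro _ rfl
      exact LocGen.of_mem (bracketWords_mono S hi hX)
    · rintro _ rfl H hH
      exact h _ (lieBracket_mem_bracketWords hi hX hH)
  induction j using Nat.strong_induction_on with
  | _ j ih =>
  match j with
  | 0 => rintro W ⟨⟩
  | 1 => exact hX
  | j + 2 =>
    rintro _ (hW | ⟨X, hX', W, hW, rfl⟩) Z hZ
    · exact ih (j + 1) (by omega) _ hW Z hZ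
    · have sZ := LocGen.smoothNear hZ hw
      have sW := smoothNear_of_mem_bracketWords hS _ W hW
      -- The Jacobi identity in the form `[[X, W], Z] = [X, [W, Z]] - [W, [X, Z]]`.
      refine LocGen.congr (sub_mem (hX X hX' _ (ih (j + 1) (by omega) W hW Z hZ))
        (ih (j + 1) (by omega) W hW _ (hX X hX' Z hZ))) ?_
      filter_upwards [hS X hX', sW, sZ] with q h1 h2 h3
      have h6 := leibniz_identity_lieBracket (𝕜 := ℝ) (n := ∞)
        (by rw [minSmoothness_of_isRCLikeNormedField]; exact WithTop.coe_le_coe.2 le_top) h1 h2 h3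
      exact eq_sub_of_add_eq h6.symm

end Stabilization

namespace RankTwoDistribution

open VectorField

variable {d : ℕ} {M : Type*} [TopologicalSpace M] [ChartedSpace (EuclideanSpace ℝ (Fin d)) M]
  [IsManifold (𝓡 d) ∞ M] {D : RankTwoDistribution d M}
  {φ : OpenPartialHomeomorph M (EuclideanSpace ℝ (Fin d))}
  {s : Set (EuclideanSpace ℝ (Fin d))} {A B : EuclideanSpace ℝ (Fin d) → EuclideanSpace ℝ (Fin d)}

namespace IsFrameIn

theorem wordSpan_one (A B : EuclideanSpace ℝ (Fin d) → EuclideanSpace ℝ (Fin d))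
    (u : EuclideanSpace ℝ (Fin d)) : wordSpan {A, B} 1 u = Submodule.span ℝ {A u, B u} := by
  rw [wordSpan, bracketWords, image_pair]

theorem finrank_wordSpan_one (h : D.IsFrameIn φ s A B) {u : EuclideanSpace ℝ (Fin d)}
    (hu : u ∈ s) : finrank ℝ (wordSpan {A, B} 1 u) = 2 := by
  have := finrank_span_eq_card (h.linearIndependent u hu)
  rw [Matrix.range_cons, Matrix.range_cons, Matrix.range_empty, union_empty, Fintype.card_fin] at this
  rw [wordSpan_one]
  exact this

theorem finrank_wordSpan_le_of_isGoursat (h : D.IsFrameIn φ s A B) (hG : D.IsGoursat) {i : ℕ}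
    (hi : 1 ≤ i) (hid : i + 1 ≤ d) {u : EuclideanSpace ℝ (Fin d)} (hu : u ∈ s) :
    finrank ℝ (wordSpan {A, B} i u) ≤ i + 1 := by
  have hq := φ.map_target (h.subset hu)
  have e := φ.right_inv (h.subset hu)
  rw [← hG i hi hid (φ.symm u)]
  have h1 := h.finrank_derivedFlag i hq (by rwa [e])
  rw [e] at h1
  rw [← h1]
  exact Submodule.finrank_mono (D.derivedFlag_le_lieSquareFlag i _)

/-- Near a point at which the small growth vector is locally constant, the small growth vector of a
Goursat distribution is `2, 3, 4, …`. -/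
theorem finrank_wordSpan_of_isGoursat (h : D.IsFrameIn φ s A B) (hG : D.IsGoursat)
    {u : EuclideanSpace ℝ (Fin d)} (hu : u ∈ s)
    (hc : ∀ i, ∀ᶠ v in 𝓝 u, finrank ℝ (wordSpan {A, B} i v) = finrank ℝ (wordSpan {A, B} i u))
    {i : ℕ} (hi : 1 ≤ i) (hid : i + 1 ≤ d) : finrank ℝ (wordSpan {A, B} i u) = i + 1 := by
  induction i, hi using Nat.le_induction with
  | base => exact h.finrank_wordSpan_one hu
  | succ i hi ih =>
    replace ih := ih (by omega)
    have hs := h.smoothNear hu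
    refine le_antisymm (h.finrank_wordSpan_le_of_isGoursat hG (by omega) hid hu) ?_
    by_contra hlt
    have hmono : ∀ v, wordSpan {A, B} i v ≤ wordSpan {A, B} (i + 1) v := fun v =>
      wordSpan_mono _ (Nat.le_succ i) v
    have hrank : finrank ℝ (wordSpan {A, B} (i + 1) u) = finrank ℝ (wordSpan {A, B} i u) :=
      le_antisymm (by omega) (Submodule.finrank_mono (hmono u))
    -- If the rank did not grow from `i` to `i + 1`, then, the ranks being locally constant, the
    -- words of length at most `i + 1` would be smooth combinations of those of length at most `i`.
    -- The latter would generate an involutive family, and the Lie square of index `i + 1` would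
    -- have dimension at most `i + 1` instead of `i + 2`.
    have hW : ∀ W ∈ bracketWords {A, B} (i + 1), W ∈ LocGen (bracketWords {A, B} i) u := by
      intro W hW
      refine locGen_of_finrank_eq (smoothNear_of_mem_bracketWords hs i) (hc i)
        (smoothNear_of_mem_bracketWords hs _ W hW) ?_
      filter_upwards [hc i, hc (i + 1)] with v h1 h2
      have h3 : wordSpan {A, B} i v = wordSpan {A, B} (i + 1) v :=
        Submodule.eq_of_le_of_finrank_eq (hmono v) (by rw [h1, h2, hrank])
      change W v ∈ wordSpan {A, B} i v
      rw [h3]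
      exact apply_mem_wordSpan hW v
    have hq := φ.map_target (h.subset hu)
    have e := φ.right_inv (h.subset hu)
    have mem1 : ∀ X ∈ ({A, B} : Set _), X ∈ bracketWords {A, B} i := fun X hX =>
      bracketWords_mono {A, B} hi hX
    have hle := h.map_lieSquareFlag_le (𝒢 := fun _ => bracketWords {A, B} i) hq (by rwa [e])
      (by rw [e]; exact fun _ => smoothNear_of_mem_bracketWords hs i)
      (LocGen.of_mem (mem1 A (by simp))) (LocGen.of_mem (mem1 B (by simp)))
      (fun _ G hG => LocGen.of_mem hG)
      (by
        rw [e]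
        exact fun _ G hG H hH => lieBracket_mem_locGen_bracketWords hi hs hW i G hG H
          (LocGen.of_mem hH)) (i + 1)
    have h1 := Submodule.finrank_mono hle
    rw [← (Submodule.equivMapOfInjective (chartDeriv φ (φ.symm u)).toLinearMap
      (chartDeriv_bijective h.mem hq).1 _).finrank_eq, hG (i + 1) (by omega) hid, e] at h1
    change i + 1 + 1 ≤ finrank ℝ (wordSpan {A, B} i u) at h1
    omega

/-- The bracket lies in the Lie square of index `i + 2`, which contains the corresponding term of
the small flag and has the same dimension at this point. -/
theorem lieBracket_mem_wordSpan_of_isGoursat (h : D.IsFrameIn φ s A B) (hG : D.IsGoursat)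
    {u : EuclideanSpace ℝ (Fin d)} (hu : u ∈ s) {i : ℕ} (hid : i + 3 ≤ d)
    (hr : finrank ℝ (wordSpan {A, B} (i + 2) u) = i + 3)
    {V W : EuclideanSpace ℝ (Fin d) → EuclideanSpace ℝ (Fin d)}
    (hV : V ∈ bracketWords {A, B} (i + 1)) (hW : W ∈ bracketWords {A, B} (i + 1)) :
    lieBracket ℝ V W u ∈ wordSpan {A, B} (i + 2) u := by
  have hq := φ.map_target (h.subset hu)
  have e := φ.right_inv (h.subset hu)
  have hO : IsOpen (φ.source ∩ φ ⁻¹' s) := φ.isOpen_inter_preimage h.isOpen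
  have hqO : φ.symm u ∈ φ.source ∩ φ ⁻¹' s := ⟨hq, by rwa [mem_preimage, e]⟩
  obtain ⟨Y, hY, hYV⟩ := h.exists_pushField_eq (i + 1) V hV
  obtain ⟨Z, hZ, hZW⟩ := h.exists_pushField_eq (i + 1) W hW
  have h1 : mlieBracket (𝓡 d) Y Z (φ.symm u) ∈ D.lieSquareFlag (i + 2) (φ.symm u) :=
    Submodule.subset_span ⟨_, hO, hqO, _, Submodule.mem_sup_right (Submodule.subset_span
      ⟨Y, Z, derivedSections_le_lieSquareSections _ _ hY,
        derivedSections_le_lieSquareSections _ _ hZ, rfl⟩), rfl⟩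
  have h2 := h.finrank_derivedFlag (i + 2) hq (by rwa [e])
  rw [e, hr, ← hG (i + 2) (by omega) hid (φ.symm u)] at h2
  rw [← Submodule.eq_of_le_of_finrank_eq (D.derivedFlag_le_lieSquareFlag _ _) h2] at h1
  have h3 := h.map_derivedFlag (i + 2) hq (by rwa [e])
  rw [e] at h3
  rw [← h3]
  have h4 : lieBracket ℝ V W u = pushField φ (mlieBracket (𝓡 d) Y Z) u := by
    rw [pushField_mlieBracket h.mem hO (smoothOn_of_mem_derivedSections hO _ Y hY)
      (smoothOn_of_mem_derivedSections hO _ Z hZ) (h.subset hu) hqO]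
    refine Filter.EventuallyEq.lieBracket_vectorField_eq ?_ ?_
    · filter_upwards [h.isOpen.mem_nhds hu] with v hv using (hYV v hv).symm
    · filter_upwards [h.isOpen.mem_nhds hu] with v hv using (hZW v hv).symm
  rw [h4]
  exact Submodule.mem_map_of_mem h1

end IsFrameIn

/-- For `j ≥ 2` the field `g j` is a word of length at most `j` whose value lies outside `D^{j-1}`.
The choice does not depend on the order of `A` and `B`, which is left open so that `[g 0, g n]` can
be made the bracket that gives the last new direction. -/
theorem IsFrameIn.exists_isGoursatFrame_aux {n : ℕ} (hn : 2 ≤ n) {M : Type*} [TopologicalSpace M]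
    [ChartedSpace (EuclideanSpace ℝ (Fin (n + 2))) M] [IsManifold (𝓡 (n + 2)) ∞ M]
    {D : RankTwoDistribution (n + 2) M}
    {φ : OpenPartialHomeomorph M (EuclideanSpace ℝ (Fin (n + 2)))} {s : Set _} {A B : _ → _}
    (h : D.IsFrameIn φ s A B) (hG : D.IsGoursat) {u : EuclideanSpace ℝ (Fin (n + 2))} (hu : u ∈ s)
    (hc : ∀ i, ∀ᶠ v in 𝓝 u, finrank ℝ (wordSpan {A, B} i v) = finrank ℝ (wordSpan {A, B} i u)) :
    ∃ W : ℕ → EuclideanSpace ℝ (Fin (n + 2)) → EuclideanSpace ℝ (Fin (n + 2)),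
      ∀ g : ℕ → EuclideanSpace ℝ (Fin (n + 2)) → EuclideanSpace ℝ (Fin (n + 2)),
      (g 0 = A ∧ g 1 = B ∨ g 0 = B ∧ g 1 = A) → (∀ j, 2 ≤ j → g j = W j) →
      (lieBracket ℝ (g 0) (g n) u ∉ prefixSpan g n u → IsGoursatFrame n g u) ∧
      ¬ (lieBracket ℝ (g 0) (g n) u ∈ prefixSpan g n u ∧
        lieBracket ℝ (g 1) (g n) u ∈ prefixSpan g n u) := by
  have hr : ∀ i, 1 ≤ i → i ≤ n + 1 → finrank ℝ (wordSpan {A, B} i u) = i + 1 := fun i h1 h2 =>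
    h.finrank_wordSpan_of_isGoursat hG hu hc h1 (by omega)
  have hrc : ∀ i, 1 ≤ i → i ≤ n + 1 → ∀ᶠ v in 𝓝 u, finrank ℝ (wordSpan {A, B} i v) = i + 1 := by
    intro i h1 h2
    filter_upwards [hc i] with v hv
    rw [hv, hr i h1 h2]
  have hs := h.smoothNear hu
  have hW : ∀ j, ∃ W, 2 ≤ j → j ≤ n + 1 →
      W ∈ bracketWords {A, B} j ∧ W u ∉ wordSpan {A, B} (j - 1) u := by
    intro j
    by_contra hcon
    push Not at hcon
    -- The zero field is an arbitrary argument here; only the bounds on `j` are extracted.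
    have hj := (hcon 0).1
    have hj' := (hcon 0).2.1
    have : wordSpan {A, B} j u ≤ wordSpan {A, B} (j - 1) u := by
      rw [wordSpan, Submodule.span_le]
      rintro _ ⟨W, hW, rfl⟩
      exact (hcon W).2.2 hW
    have h1 := Submodule.finrank_mono this
    rw [hr j (by omega) hj', hr (j - 1) (by omega) (by omega)] at h1
    omega
  choose W hW using hW
  refine ⟨W, fun g hg01 hgW => ?_⟩
  have hg0 : ∀ j < 2, g j ∈ ({A, B} : Set _) := by
    intro j hj
    interval_cases j <;> rcases hg01 with ⟨h0, h1⟩ | ⟨h0, h1⟩ <;> simp [h0, h1]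
  -- Both `g 0` and `g 1` are words of length one, hence the maximum with `1`.
  have hg : ∀ j ≤ n + 1, g j ∈ bracketWords {A, B} (max j 1) := by
    intro j hj
    rcases lt_or_ge j 2 with h2 | h2
    · exact bracketWords_mono {A, B} (le_max_right j 1) (hg0 j h2)
    · rw [hgW j h2, max_eq_left (by omega)]
      exact (hW j h2 hj).1
  have sg : ∀ j < n + 2, SmoothNear (g j) u := fun j hj =>
    smoothNear_of_mem_bracketWords hs _ _ (hg j (by omega))
  have hli : ∀ N, 2 ≤ N → N ≤ n + 2 → LinearIndependent ℝ fun j : Fin N => g j u := by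
    intro N hN hNn
    induction N, hN using Nat.le_induction with
    | base =>
      have h1 := h.linearIndependent u hu
      rcases hg01 with ⟨e0, e1⟩ | ⟨e0, e1⟩
      · have e : (fun j : Fin 2 => g j u) = ![A u, B u] := by
          funext j
          fin_cases j <;> simp [e0, e1]
        rw [e]
        exact h1
      · have e : (fun j : Fin 2 => g j u) = ![B u, A u] := by
          funext j
          fin_cases j <;> simp [e0, e1]
        rw [e]
        exact LinearIndependent.pair_symm_iff.1 h1
    | succ N hN ih =>
      rw [linearIndependent_finSucc']
      refine ⟨ih (by omega), fun hmem => ?_⟩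
      have h1 := (hW N hN (by omega)).2
      rw [← hgW N hN] at h1
      refine h1 (Submodule.span_le.2 ?_ hmem)
      rintro _ ⟨j, rfl⟩
      have hj := j.2
      exact wordSpan_mono {A, B} (show max (j : ℕ) 1 ≤ N - 1 by omega) u
        (apply_mem_wordSpan (hg j (by omega)) u)
  have hpre : ∀ j, 1 ≤ j → j ≤ n + 1 → ∀ᶠ v in 𝓝 u, prefixSpan g j v = wordSpan {A, B} j v := by
    intro j hj hjn
    filter_upwards [SmoothNear.eventually_linearIndependent (k := fun i : Fin (j + 1) => g i)
      (fun i => sg i (by omega)) (hli (j + 1) (by omega) (by omega)), hrc j hj hjn] with v h1 h2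
    have h3 := finrank_span_eq_card h1
    rw [Fintype.card_fin] at h3
    have e : prefixSpan g j v = Submodule.span ℝ (range fun i : Fin (j + 1) => g i v) := by
      refine congrArg _ (Set.ext fun x => ⟨?_, ?_⟩)
      · rintro ⟨i, hi, rfl⟩
        exact ⟨⟨i, Nat.lt_succ_of_le hi⟩, rfl⟩
      · rintro ⟨i, rfl⟩
        exact ⟨i, Nat.le_of_lt_succ i.2, rfl⟩
    refine Submodule.eq_of_le_of_finrank_eq ?_ (by rw [e, h3, h2])
    rw [prefixSpan, Submodule.span_le]
    rintro _ ⟨i, hi, rfl⟩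
    have hi' : i ≤ j := hi
    exact wordSpan_mono {A, B} (show max i 1 ≤ j by omega) v
      (apply_mem_wordSpan (hg i (by omega)) v)
  -- If neither bracket with `g j` leaves the span, then by the Leibniz rule no bracket of a frame
  -- field with a word of length at most `j` leaves `D^j` at `u`, and the rank cannot grow at the
  -- next step.
  have hnot : ∀ j, 1 ≤ j → j ≤ n → ¬ (lieBracket ℝ (g 0) (g j) u ∈ prefixSpan g j u ∧
      lieBracket ℝ (g 1) (g j) u ∈ prefixSpan g j u) := by
    rintro j hj hjn ⟨h0, h1⟩
    have hprej := (hpre j hj (by omega)).self_of_nhds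
    have key : ∀ X ∈ ({A, B} : Set _), ∀ m ≤ j, lieBracket ℝ X (g m) u ∈ prefixSpan g j u := by
      intro X hX m hm
      rcases (show max m 1 ≤ j by omega).lt_or_eq with hlt | heq
      · rw [hprej]
        exact wordSpan_mono {A, B} (show max m 1 + 1 ≤ j by omega) u (apply_mem_wordSpan
          (lieBracket_mem_bracketWords (by omega) hX (hg m (by omega))) u)
      · have hX' : X = g 0 ∨ X = g 1 := by
          rcases hg01 with ⟨e0, e1⟩ | ⟨e0, e1⟩ <;> rcases hX with rfl | rfl <;> simp [e0, e1]
        rcases Nat.eq_zero_or_pos m with rfl | hm0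
        · obtain rfl : j = 1 := by omega
          rcases hX' with rfl | rfl
          · simp
          · rw [lieBracket_swap]
            exact neg_mem h0
        · obtain rfl : m = j := by omega
          rcases hX' with rfl | rfl
          exacts [h0, h1]
    have hle : wordSpan {A, B} (j + 1) u ≤ wordSpan {A, B} j u := by
      obtain ⟨i, rfl⟩ : ∃ i, j = i + 1 := ⟨j - 1, by omega⟩
      rw [wordSpan, Submodule.span_le]
      rintro _ ⟨_, (hV | ⟨X, hX, V, hV, rfl⟩), rfl⟩
      · exact apply_mem_wordSpan hV u
      · have hVg : V ∈ LocGen (g '' Iic (i + 1)) u := by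
          refine LocGen.mono (𝒢 := range fun m : Fin (i + 1 + 1) => g m) ?_ (LocGen.of_mem_span
            (k := fun m : Fin (i + 1 + 1) => g m) (fun m => sg m (by omega))
            (hli (i + 1 + 1) (by omega) (by omega)) (smoothNear_of_mem_bracketWords hs _ V hV) ?_)
          · rintro _ ⟨m, rfl⟩
            exact ⟨m, Nat.le_of_lt_succ m.2, rfl⟩
          · filter_upwards [hpre (i + 1) hj (by omega)] with v hv
            have h2 := apply_mem_wordSpan hV v
            rw [← hv] at h2
            refine Submodule.span_mono ?_ h2
            rintro _ ⟨m, hm, rfl⟩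
            exact ⟨⟨m, Nat.lt_succ_of_le hm⟩, rfl⟩
        change lieBracket ℝ X V u ∈ wordSpan {A, B} (i + 1) u
        rw [← hprej]
        refine LocGen.lieBracket_apply_mem (𝒢 := {X}) (ℋ := g '' Iic (i + 1))
          (by rintro _ rfl; exact hs _ hX) ?_ ?_ ?_ ?_ (LocGen.of_mem rfl) hVg
        · rintro _ ⟨m, hm, rfl⟩
          have hm' : m ≤ i + 1 := hm
          exact sg m (by omega)
        · rintro _ rfl
          rw [hprej]
          exact wordSpan_mono {A, B} hj u (apply_mem_wordSpan (i := 1) hX u)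
        · rintro _ ⟨m, hm, rfl⟩
          exact mem_prefixSpan hm u
        · rintro _ rfl _ ⟨m, hm, rfl⟩
          exact key _ hX m hm
    have h2 := Submodule.finrank_mono hle
    rw [hr (j + 1) (by omega) (by omega), hr j hj (by omega)] at h2
    omega
  refine ⟨fun hlast => ⟨finrank_euclideanSpace_fin, sg, hli (n + 2) (by omega) le_rfl, ?_, hnot,
    hlast, ?_⟩, hnot n (by omega) le_rfl⟩
  · intro j hj hjn
    filter_upwards [hpre (j + 1) (by omega) (by omega)] with v hv
    rw [hv]
    have h1 := lieBracket_mem_bracketWords (by omega) (hg0 0 (by omega)) (hg j (by omega))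
    rw [max_eq_left hj] at h1
    exact apply_mem_wordSpan h1 v
  · intro i hi j hj
    obtain ⟨m, rfl⟩ : ∃ m, n = m + 2 := ⟨n - 2, by omega⟩
    filter_upwards [hpre (m + 2) (by omega) (by omega), h.isOpen.mem_nhds hu,
      hrc (m + 2) (by omega) (by omega)] with v h1 h2 h3
    rw [h1]
    exact h.lieBracket_mem_wordSpan_of_isGoursat hG h2 (by omega) h3
      (bracketWords_mono {A, B} (show max i 1 ≤ m + 1 by omega) (hg i (by omega)))
      (bracketWords_mono {A, B} (show max j 1 ≤ m + 1 by omega) (hg j (by omega)))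

/-- A Goursat distribution has an adapted Goursat frame near a point at which its small growth
vector is locally constant. -/
theorem IsFrameIn.exists_isGoursatFrame {n : ℕ} (hn : 2 ≤ n) {M : Type*} [TopologicalSpace M]
    [ChartedSpace (EuclideanSpace ℝ (Fin (n + 2))) M] [IsManifold (𝓡 (n + 2)) ∞ M]
    {D : RankTwoDistribution (n + 2) M}
    {φ : OpenPartialHomeomorph M (EuclideanSpace ℝ (Fin (n + 2)))} {s : Set _} {A B : _ → _}
    (h : D.IsFrameIn φ s A B) (hG : D.IsGoursat) {u : EuclideanSpace ℝ (Fin (n + 2))} (hu : u ∈ s)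
    (hc : ∀ i, ∀ᶠ v in 𝓝 u, finrank ℝ (wordSpan {A, B} i v) = finrank ℝ (wordSpan {A, B} i u)) :
    ∃ g : ℕ → EuclideanSpace ℝ (Fin (n + 2)) → EuclideanSpace ℝ (Fin (n + 2)),
      IsGoursatFrame n g u ∧ ∀ q, Submodule.span ℝ {g 0 q, g 1 q} = Submodule.span ℝ {A q, B q} := by
  obtain ⟨W, hW⟩ := h.exists_isGoursatFrame_aux hn hG hu hc
  set g₁ : ℕ → EuclideanSpace ℝ (Fin (n + 2)) → EuclideanSpace ℝ (Fin (n + 2)) :=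
    fun j => if j = 0 then A else if j = 1 then B else W j with hg₁
  set g₂ : ℕ → EuclideanSpace ℝ (Fin (n + 2)) → EuclideanSpace ℝ (Fin (n + 2)) :=
    fun j => if j = 0 then B else if j = 1 then A else W j with hg₂
  have h1 := hW g₁ (by simp [hg₁]) fun j hj => by
    simp [hg₁, show j ≠ 0 by omega, show j ≠ 1 by omega]
  have h2 := hW g₂ (by simp [hg₂]) fun j hj => by
    simp [hg₂, show j ≠ 0 by omega, show j ≠ 1 by omega]
  -- If `[g 0, g n]` brings nothing new, then `[g 1, g n]` does, and the two frame fields are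
  -- exchanged. This leaves `g n` alone because `n ≥ 2`.
  by_cases hlast : lieBracket ℝ (g₁ 0) (g₁ n) u ∈ prefixSpan g₁ n u
  · refine ⟨g₂, h2.1 fun hmem => h1.2 ⟨hlast, ?_⟩, fun q => ?_⟩
    · have e1 : g₂ n = g₁ n := by simp [hg₁, hg₂, show n ≠ 0 by omega, show n ≠ 1 by omega]
      have e2 : prefixSpan g₂ n u ≤ prefixSpan g₁ n u := by
        rw [prefixSpan, Submodule.span_le]
        rintro _ ⟨j, hj, rfl⟩
        have hj' : j ≤ n := hj
        rcases Nat.lt_or_ge j 2 with h3 | h3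
        · interval_cases j
          · exact mem_prefixSpan (g := g₁) (j := 1) (by omega) u
          · exact mem_prefixSpan (g := g₁) (j := 0) (by omega) u
        · have : g₂ j = g₁ j := by simp [hg₁, hg₂, show j ≠ 0 by omega, show j ≠ 1 by omega]
          change g₂ j u ∈ _
          rw [this]
          exact mem_prefixSpan hj' u
      rw [e1] at hmem
      exact e2 hmem
    · simp [hg₂, pair_comm]
  · exact ⟨g₁, h1.1 hlast, fun q => by simp [hg₁]⟩

end RankTwoDistribution

/-! ### Submersions and related fields -/

section Related

open VectorField

variable {F F' : Type} [NormedAddCommGroup F] [NormedSpace ℝ F]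
  [NormedAddCommGroup F'] [NormedSpace ℝ F'] {P : F → F'} {u : F}

theorem fderiv_lieBracket_of_related {V W : F → F} {V' W' : F' → F'} (hP : SmoothNear P u)
    (hV : SmoothNear V u) (hW : SmoothNear W u) (hV' : SmoothNear V' (P u))
    (hW' : SmoothNear W' (P u)) (h1 : ∀ᶠ v in 𝓝 u, fderiv ℝ P v (V v) = V' (P v))
    (h2 : ∀ᶠ v in 𝓝 u, fderiv ℝ P v (W v) = W' (P v)) :
    ∀ᶠ v in 𝓝 u, fderiv ℝ P v (lieBracket ℝ V W v) = lieBracket ℝ V' W' (P v) := by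
  filter_upwards [hP.eventually, hV.eventually, hW.eventually,
    hP.continuousAt.eventually hV'.eventually, hP.continuousAt.eventually hW'.eventually,
    h1.eventually_nhds, h2.eventually_nhds] with v e1 e2 e3 e4 e5 e6 e7
  have e6' : (fun q => fderiv ℝ P q (V q)) =ᶠ[𝓝 v] fun q => V' (P q) := e6
  have e7' : (fun q => fderiv ℝ P q (W q)) =ᶠ[𝓝 v] fun q => W' (P q) := e7
  have e8 : fderiv ℝ (fun q => V' (P q)) v = _ := (e4.hasFDerivAt.comp v e1.hasFDerivAt).fderiv
  have e9 : fderiv ℝ (fun q => W' (P q)) v = _ := (e5.hasFDerivAt.comp v e1.hasFDerivAt).fderiv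
  rw [fderiv_apply_lieBracket_of_smoothNear e1 e2 e3, e6'.fderiv_eq, e7'.fderiv_eq, e8, e9,
    ContinuousLinearMap.comp_apply, ContinuousLinearMap.comp_apply, e6.self_of_nhds,
    e7.self_of_nhds]
  rfl

/-- Brackets of related fields are related. The two directions of the correspondence show that the
flag upstairs maps into, and onto, the flag downstairs. -/
theorem exists_related_bracketWords {A B : F → F} {A' B' : F' → F'} (hP : SmoothNear P u)
    (hA : SmoothNear A u) (hB : SmoothNear B u) (hA' : SmoothNear A' (P u))
    (hB' : SmoothNear B' (P u)) (h1 : ∀ᶠ v in 𝓝 u, fderiv ℝ P v (A v) = A' (P v))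
    (h2 : ∀ᶠ v in 𝓝 u, fderiv ℝ P v (B v) = B' (P v)) (i : ℕ) :
    (∀ W ∈ bracketWords {A, B} i, ∃ W' ∈ bracketWords {A', B'} i,
      ∀ᶠ v in 𝓝 u, fderiv ℝ P v (W v) = W' (P v)) ∧
    (∀ W' ∈ bracketWords {A', B'} i, ∃ W ∈ bracketWords {A, B} i,
      ∀ᶠ v in 𝓝 u, fderiv ℝ P v (W v) = W' (P v)) := by
  have hS : ∀ X ∈ ({A, B} : Set _), SmoothNear X u := by rintro _ (rfl | rfl) <;> assumption
  have hS' : ∀ X ∈ ({A', B'} : Set _), SmoothNear X (P u) := by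
    rintro _ (rfl | rfl) <;> assumption
  have b1 : ∀ W ∈ ({A, B} : Set _), ∃ W' ∈ ({A', B'} : Set _),
      ∀ᶠ v in 𝓝 u, fderiv ℝ P v (W v) = W' (P v) := by
    rintro _ (rfl | rfl)
    exacts [⟨A', by simp, h1⟩, ⟨B', by simp, h2⟩]
  have b2 : ∀ W' ∈ ({A', B'} : Set _), ∃ W ∈ ({A, B} : Set _),
      ∀ᶠ v in 𝓝 u, fderiv ℝ P v (W v) = W' (P v) := by
    rintro _ (rfl | rfl)
    exacts [⟨A, by simp, h1⟩, ⟨B, by simp, h2⟩]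
  induction i using Nat.strong_induction_on with
  | _ i ih =>
  match i with
  | 0 => exact ⟨by rintro W ⟨⟩, by rintro W ⟨⟩⟩
  | 1 => exact ⟨b1, b2⟩
  | i + 2 =>
    obtain ⟨ih1, ih2⟩ := ih (i + 1) (by omega)
    constructor
    · rintro _ (hW | ⟨X, hX, W, hW, rfl⟩)
      · obtain ⟨W', hW', h⟩ := ih1 _ hW
        exact ⟨W', Or.inl hW', h⟩
      · obtain ⟨W', hW', h⟩ := ih1 _ hW
        obtain ⟨X', hX', h'⟩ := b1 X hX
        exact ⟨_, Or.inr ⟨X', hX', W', hW', rfl⟩, fderiv_lieBracket_of_related hP (hS X hX)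
          (smoothNear_of_mem_bracketWords hS _ W hW) (hS' X' hX')
          (smoothNear_of_mem_bracketWords hS' _ W' hW') h' h⟩
    · rintro _ (hW' | ⟨X', hX', W', hW', rfl⟩)
      · obtain ⟨W, hW, h⟩ := ih2 _ hW'
        exact ⟨W, Or.inl hW, h⟩
      · obtain ⟨W, hW, h⟩ := ih2 _ hW'
        obtain ⟨X, hX, h'⟩ := b2 X' hX'
        exact ⟨_, Or.inr ⟨X, hX, W, hW, rfl⟩, fderiv_lieBracket_of_related hP (hS X hX)
          (smoothNear_of_mem_bracketWords hS _ W hW) (hS' X' hX')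
          (smoothNear_of_mem_bracketWords hS' _ W' hW') h' h⟩

theorem map_wordSpan_of_related {A B : F → F} {A' B' : F' → F'} (hP : SmoothNear P u)
    (hA : SmoothNear A u) (hB : SmoothNear B u) (hA' : SmoothNear A' (P u))
    (hB' : SmoothNear B' (P u)) (h1 : ∀ᶠ v in 𝓝 u, fderiv ℝ P v (A v) = A' (P v))
    (h2 : ∀ᶠ v in 𝓝 u, fderiv ℝ P v (B v) = B' (P v)) (i : ℕ) :
    (wordSpan {A, B} i u).map (fderiv ℝ P u).toLinearMap = wordSpan {A', B'} i (P u) := by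
  obtain ⟨r1, r2⟩ := exists_related_bracketWords hP hA hB hA' hB' h1 h2 i
  rw [wordSpan, Submodule.map_span]
  apply le_antisymm
  · rw [Submodule.span_le]
    rintro _ ⟨_, ⟨W, hW, rfl⟩, rfl⟩
    obtain ⟨W', hW', h⟩ := r1 W hW
    have := h.self_of_nhds
    change fderiv ℝ P u (W u) ∈ _
    rw [this]
    exact apply_mem_wordSpan hW' _
  · rw [wordSpan, Submodule.span_le]
    rintro _ ⟨W', hW', rfl⟩
    obtain ⟨W, hW, h⟩ := r2 W' hW'
    exact Submodule.subset_span ⟨W u, ⟨W, hW, rfl⟩, h.self_of_nhds⟩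

/-- A field along a map with values in the image of a plane field can be lifted to it. -/
theorem exists_lift [FiniteDimensional ℝ F'] {A B : F → F} {L : F → F →L[ℝ] F'} {C : F → F'}
    (hA : SmoothNear A u) (hB : SmoothNear B u) (hL : SmoothNear L u) (hC : SmoothNear C u)
    (hli : LinearIndependent ℝ ![L u (A u), L u (B u)])
    (hmem : ∀ᶠ v in 𝓝 u, C v ∈ Submodule.span ℝ {L v (A v), L v (B v)}) :
    ∃ T : F → F, SmoothNear T u ∧ T ∈ LocGen {A, B} u ∧
      ∀ᶠ v in 𝓝 u, T v ∈ Submodule.span ℝ {A v, B v} ∧ L v (T v) = C v := by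
  set k : Fin 2 → F → F' := ![fun v => L v (A v), fun v => L v (B v)] with hk
  have sk : ∀ i, SmoothNear (k i) u := by
    intro i
    fin_cases i
    exacts [hL.clm_apply hA, hL.clm_apply hB]
  have e : ∀ v, (fun i => k i v) = ![L v (A v), L v (B v)] := by
    intro v
    funext i
    fin_cases i <;> rfl
  obtain ⟨θ, hθ, hθk⟩ := exists_coframe sk (by rw [e]; exact hli)
  have sθ : ∀ i : Fin 2, SmoothNear (fun v => θ v (C v) i) u := fun i =>
    (hθ.clm_apply hC).clm (ContinuousLinearMap.proj (R := ℝ) i)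
  refine ⟨fun v => θ v (C v) 0 • A v + θ v (C v) 1 • B v,
    ((sθ 0).smul hA).add ((sθ 1).smul hB),
    add_mem (LocGen.smul (sθ 0) (LocGen.of_mem (by simp)))
      (LocGen.smul (sθ 1) (LocGen.of_mem (by simp))), ?_⟩
  filter_upwards [hθk, hmem] with v h1 h2
  refine ⟨Submodule.mem_span_pair.2 ⟨_, _, rfl⟩, ?_⟩
  have h3 : C v ∈ Submodule.span ℝ (range fun i => k i v) := by
    refine Submodule.span_mono ?_ h2
    rintro _ (rfl | rfl)
    exacts [⟨0, rfl⟩, ⟨1, rfl⟩]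
  have h4 := eq_sum_coframe h1 h3
  rw [Fin.sum_univ_two] at h4
  rw [map_add, map_smul, map_smul]
  exact h4.symm

end Related

/-! ### The differential of the quotient map in charts -/

section Kernel

variable {d e : ℕ} {M N : Type*} [TopologicalSpace M] [TopologicalSpace N] {U : Set M} {π : M → N}

theorem isOpen_chart_domain (hU : IsOpen U) (hπ : ContinuousOn π U)
    (φ : OpenPartialHomeomorph M (EuclideanSpace ℝ (Fin d)))
    (ψ : OpenPartialHomeomorph N (EuclideanSpace ℝ (Fin e))) :
    IsOpen (U ∩ π ⁻¹' ψ.source ∩ φ.source) :=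
  (hπ.isOpen_inter_preimage hU ψ.open_source).inter φ.open_source

variable [ChartedSpace (EuclideanSpace ℝ (Fin d)) M] [ChartedSpace (EuclideanSpace ℝ (Fin e)) N]

theorem smoothNear_comp_charts (hU : IsOpen U) (hπ : ContMDiffOn (𝓡 d) (𝓡 e) ∞ π U)
    {φ : OpenPartialHomeomorph M (EuclideanSpace ℝ (Fin d))}
    {ψ : OpenPartialHomeomorph N (EuclideanSpace ℝ (Fin e))}
    (hφ : φ ∈ IsManifold.maximalAtlas (𝓡 d) ∞ M) (hψ : ψ ∈ IsManifold.maximalAtlas (𝓡 e) ∞ N)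
    {q : M} (hq : q ∈ U ∩ π ⁻¹' ψ.source ∩ φ.source) :
    SmoothNear (ψ ∘ π ∘ φ.symm) (φ q) := by
  have hO := isOpen_chart_domain hU hπ.continuousOn φ ψ
  have hev : ∀ᶠ u in 𝓝 (φ q), u ∈ φ.target ∧ φ.symm u ∈ U ∩ π ⁻¹' ψ.source ∩ φ.source :=
    Filter.Eventually.and (φ.open_target.mem_nhds (φ.map_source hq.2))
      ((φ.continuousAt_symm (φ.map_source hq.2)).preimage_mem_nhds
        (by rw [φ.left_inv hq.2]; exact hO.mem_nhds hq))
  filter_upwards [hev] with u hu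
  have h1 : ContMDiffAt (𝓡 d) (𝓡 d) ∞ φ.symm u :=
    (contMDiffOn_symm_of_mem_maximalAtlas hφ).contMDiffAt (φ.open_target.mem_nhds hu.1)
  have h2 : ContMDiffAt (𝓡 d) (𝓡 e) ∞ π (φ.symm u) := hπ.contMDiffAt (hU.mem_nhds hu.2.1.1)
  have h3 : ContMDiffAt (𝓡 e) (𝓡 e) ∞ ψ (π (φ.symm u)) :=
    (contMDiffOn_of_mem_maximalAtlas hψ).contMDiffAt (ψ.open_source.mem_nhds hu.2.1.2)
  exact contMDiffAt_iff_contDiffAt.1 (h3.comp u (h2.comp u h1))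

theorem fderiv_comp_charts (hU : IsOpen U) (hπ : ContMDiffOn (𝓡 d) (𝓡 e) ∞ π U)
    {φ : OpenPartialHomeomorph M (EuclideanSpace ℝ (Fin d))}
    {ψ : OpenPartialHomeomorph N (EuclideanSpace ℝ (Fin e))}
    (hφ : φ ∈ IsManifold.maximalAtlas (𝓡 d) ∞ M) (hψ : ψ ∈ IsManifold.maximalAtlas (𝓡 e) ∞ N)
    {q : M} (hq : q ∈ U ∩ π ⁻¹' ψ.source ∩ φ.source) (v : TangentSpace (𝓡 d) q) :
    fderiv ℝ (ψ ∘ π ∘ φ.symm) (φ q) (chartDeriv φ q v) =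
      chartDeriv ψ (π q) (mfderiv (𝓡 d) (𝓡 e) π q v) := by
  have hO := isOpen_chart_domain hU hπ.continuousOn φ ψ
  have h1 : MDifferentiableAt (𝓡 d) (𝓡 d) φ q :=
    (mdifferentiable_of_mem_maximalAtlas hφ).mdifferentiableAt hq.2
  have h2 : MDifferentiableAt (𝓡 d) (𝓡 e) π q :=
    (hπ.contMDiffAt (hU.mem_nhds hq.1.1)).mdifferentiableAt (by simp)
  have h3 : MDifferentiableAt (𝓡 e) (𝓡 e) ψ (π q) :=
    (mdifferentiable_of_mem_maximalAtlas hψ).mdifferentiableAt hq.1.2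
  have h4 : MDifferentiableAt (𝓡 d) (𝓡 e) (ψ ∘ π ∘ φ.symm) (φ q) :=
    (smoothNear_comp_charts hU hπ hφ hψ hq).differentiableAt.mdifferentiableAt
  have h5 := h4.hasMFDerivAt.comp q h1.hasMFDerivAt
  have h6 := (h3.hasMFDerivAt.comp q h2.hasMFDerivAt).congr_of_eventuallyEq
    (f₁ := (ψ ∘ π ∘ φ.symm) ∘ φ) (by
      filter_upwards [φ.open_source.mem_nhds hq.2] with q' hq'
      simp [φ.left_inv hq'])
  have h7 := DFunLike.congr_fun (hasMFDerivAt_unique h5 h6) v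
  have h8 : mfderiv (𝓡 d) (𝓡 e) (ψ ∘ π ∘ φ.symm) (φ q) = fderiv ℝ (ψ ∘ π ∘ φ.symm) (φ q) :=
    mfderiv_eq_fderiv
  have h9 : mfderiv (𝓡 d) (𝓡 e) (ψ ∘ π ∘ φ.symm) (φ q) (chartDeriv φ q v) =
      chartDeriv ψ (π q) (mfderiv (𝓡 d) (𝓡 e) π q v) := h7
  exact (DFunLike.congr_fun h8 (chartDeriv φ q v)).symm.trans h9

variable [IsManifold (𝓡 d) ∞ M] {X : VField d M}

/-- A short integral curve through `q` lies in one fibre, so `π` is constant along it; differentiate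
at `q`. -/
theorem IsQuotientByIntegralCurves.mfderiv_apply_eq_zero [T2Space M]
    (h : IsQuotientByIntegralCurves (e := e) X U π) (hU : IsOpen U) (hX : X.SmoothOn U) {q : M}
    (hq : q ∈ U) : mfderiv (𝓡 d) (𝓡 e) π q (X q) = 0 := by
  have : IsManifold (𝓡 d) 1 M := IsManifold.of_le (n := ∞) (by simp)
  have hX1 : ContMDiffAt (𝓡 d) (𝓡 d).tangent 1 (fun x => (⟨x, X x⟩ : TangentBundle (𝓡 d) M)) q :=
    (hX.contMDiffAt (hU.mem_nhds hq)).of_le (by simp)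
  obtain ⟨γ, hγ0, hγ⟩ := exists_isMIntegralCurveAt_of_contMDiffAt_boundaryless (t₀ := (0 : ℝ)) hX1
  have hγ' := hγ.self_of_nhds
  rw [hγ0] at hγ'
  have hcont : ContinuousAt γ 0 := hγ'.continuousAt
  have hUγ : ∀ᶠ t in 𝓝 (0 : ℝ), γ t ∈ U := hcont.preimage_mem_nhds (hU.mem_nhds (by rwa [hγ0]))
  obtain ⟨ε, hε, hball⟩ := Metric.eventually_nhds_iff_ball.1 (Filter.Eventually.and hγ hUγ)
  have hconst : ∀ᶠ t in 𝓝 (0 : ℝ), (π ∘ γ) t = (fun _ => π q) t := by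
    filter_upwards [Metric.ball_mem_nhds (0 : ℝ) hε] with t ht
    have hsub : uIcc 0 t ⊆ Metric.ball 0 ε :=
      (convex_ball (0 : ℝ) ε).ordConnected.uIcc_subset (Metric.mem_ball_self hε) ht
    refine ((h.fibres q hq (γ t) (hball t ht).2).2 ⟨γ, 0, t, fun s hs => (hball s (hsub hs)).2,
      fun s hs => ?_, hγ0, rfl⟩).symm
    exact (hball s (hsub hs)).1.hasMFDerivWithinAt
  have hπ : MDifferentiableAt (𝓡 d) (𝓡 e) π (γ 0) := by
    rw [hγ0]
    exact (h.smooth.contMDiffAt (hU.mem_nhds hq)).mdifferentiableAt (by simp)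
  have h1 := hπ.hasMFDerivAt.comp (0 : ℝ) hγ.self_of_nhds
  have h2 : HasMFDerivAt 𝓘(ℝ, ℝ) (𝓡 e) (π ∘ γ) 0 0 :=
    (hasMFDerivAt_const (π q) (0 : ℝ)).congr_of_eventuallyEq hconst
  have h3 := hasMFDerivAt_unique h1 h2
  have h4 : mfderiv (𝓡 d) (𝓡 e) π (γ 0) ((1 : ℝ) • X (γ 0)) = 0 := DFunLike.congr_fun h3 (1 : ℝ)
  rwa [one_smul, hγ0] at h4

/-- The kernel contains the nonzero vector of `X`, and a surjection from dimension `e + 1` to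
dimension `e` has a one-dimensional kernel. -/
theorem IsQuotientByIntegralCurves.ker_fderiv_comp_charts [T2Space M]
    {φ : OpenPartialHomeomorph M (EuclideanSpace ℝ (Fin d))}
    {ψ : OpenPartialHomeomorph N (EuclideanSpace ℝ (Fin e))} (hde : d = e + 1)
    (h : IsQuotientByIntegralCurves (e := e) X U π) (hU : IsOpen U) (hX : X.SmoothOn U)
    (hφ : φ ∈ IsManifold.maximalAtlas (𝓡 d) ∞ M) (hψ : ψ ∈ IsManifold.maximalAtlas (𝓡 e) ∞ N)
    {q : M} (hq : q ∈ U ∩ π ⁻¹' ψ.source ∩ φ.source) :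
    LinearMap.ker (fderiv ℝ (ψ ∘ π ∘ φ.symm) (φ q)).toLinearMap =
        Submodule.span ℝ {chartDeriv φ q (X q)} ∧
      LinearMap.range (fderiv ℝ (ψ ∘ π ∘ φ.symm) (φ q)).toLinearMap = ⊤ ∧
      chartDeriv φ q (X q) ≠ 0 := by
  set L := fderiv ℝ (ψ ∘ π ∘ φ.symm) (φ q) with hL
  have h0 : chartDeriv φ q (X q) ≠ 0 := fun h0 =>
    h.ne_zero q hq.1.1 ((chartDeriv_bijective hφ hq.2).1 (h0.trans (map_zero _).symm))
  have hrange : LinearMap.range L.toLinearMap = ⊤ := by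
    rw [LinearMap.range_eq_top]
    intro w
    obtain ⟨v', rfl⟩ : ∃ v' : TangentSpace (𝓡 e) (π q), chartDeriv ψ (π q) v' = w :=
      (chartDeriv_bijective hψ hq.1.2).2 w
    obtain ⟨v, rfl⟩ := h.submersion q hq.1.1 v'
    exact ⟨chartDeriv φ q v, fderiv_comp_charts hU h.smooth hφ hψ hq v⟩
  refine ⟨?_, hrange, h0⟩
  have h1 := LinearMap.finrank_range_add_finrank_ker L.toLinearMap
  rw [hrange, finrank_top, finrank_euclideanSpace_fin, finrank_euclideanSpace_fin] at h1
  symm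
  refine Submodule.eq_of_le_of_finrank_eq ?_ (by rw [finrank_span_singleton h0]; omega)
  rw [Submodule.span_le, singleton_subset_iff]
  have h2 := fderiv_comp_charts hU h.smooth hφ hψ hq (X q)
  rw [h.mfderiv_apply_eq_zero hU hX hq.1.1] at h2
  exact h2.trans (map_zero (chartDeriv ψ (π q)))

end Kernel

/-! ### The distribution of a Lagrangian -/

section Lagrangian

open VectorField

/-- Antisymmetry leaves only `[B, A]` in length two, and its brackets with `A` and `B` in length
three. -/
theorem wordSpan_three {F : Type} [NormedAddCommGroup F] [NormedSpace ℝ F] (A B : F → F) (u : F) :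
    wordSpan {A, B} 3 u = Submodule.span ℝ {A u, B u, lieBracket ℝ B A u,
      lieBracket ℝ A (lieBracket ℝ B A) u, lieBracket ℝ B (lieBracket ℝ B A) u} := by
  set C := lieBracket ℝ B A with hC
  have hAB : lieBracket ℝ A B = -C := funext fun _ => lieBracket_swap
  have hneg : ∀ V : F → F, lieBracket ℝ V (-C) u = -lieBracket ℝ V C u := by
    intro V
    simp only [lieBracket, fderiv_neg, Pi.neg_apply, neg_apply, map_neg]
    abel
  have h0 : ∀ V : F → F, lieBracket ℝ V 0 u = 0 := by
    intro V
    simp [lieBracket]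
  have h2 : ∀ W ∈ bracketWords {A, B} 2, W = A ∨ W = B ∨ W = C ∨ W = -C ∨ W = 0 := by
    rintro W (hW | ⟨X, hX, Y, hY, rfl⟩)
    · rcases hW with rfl | rfl <;> simp
    · rcases hX with rfl | rfl <;> rcases hY with rfl | rfl
      · simp
      · simp [hAB]
      · simp [hC]
      · simp
  apply le_antisymm
  · rw [wordSpan, Submodule.span_le]
    have m : ∀ v ∈ ({A u, B u, C u, lieBracket ℝ A C u, lieBracket ℝ B C u} : Set F),
        v ∈ Submodule.span ℝ {A u, B u, C u, lieBracket ℝ A C u, lieBracket ℝ B C u} :=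
      fun v hv => Submodule.subset_span hv
    have key : ∀ W ∈ bracketWords {A, B} 2,
        W u ∈ Submodule.span ℝ {A u, B u, C u, lieBracket ℝ A C u, lieBracket ℝ B C u} := by
      intro W hW
      rcases h2 W hW with rfl | rfl | rfl | rfl | rfl
      · exact m _ (by simp)
      · exact m _ (by simp)
      · exact m _ (by simp)
      · exact neg_mem (m _ (by simp))
      · exact zero_mem _
    rintro _ ⟨W, (hW | ⟨X, hX, W, hW, rfl⟩), rfl⟩
    · exact key W hW
    · have hXC : lieBracket ℝ X C u ∈
          Submodule.span ℝ {A u, B u, C u, lieBracket ℝ A C u, lieBracket ℝ B C u} := by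
        rcases hX with rfl | rfl <;> exact m _ (by simp)
      change lieBracket ℝ X W u ∈ _
      rcases h2 W hW with rfl | rfl | rfl | rfl | rfl
      · exact key _ (lieBracket_mem_bracketWords le_rfl hX (by simp [bracketWords]))
      · exact key _ (lieBracket_mem_bracketWords le_rfl hX (by simp [bracketWords]))
      · exact hXC
      · rw [hneg]
        exact neg_mem hXC
      · rw [h0]
        exact zero_mem _
  · rw [Submodule.span_le]
    have hA : A ∈ bracketWords {A, B} 1 := by simp [bracketWords]
    have hB : B ∈ bracketWords {A, B} 1 := by simp [bracketWords]
    have hC2 : C ∈ bracketWords {A, B} 2 :=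
      lieBracket_mem_bracketWords le_rfl (by simp) hA
    rintro _ (rfl | rfl | rfl | rfl | rfl)
    · exact apply_mem_wordSpan (bracketWords_mono _ (by omega : 1 ≤ 3) hA) u
    · exact apply_mem_wordSpan (bracketWords_mono _ (by omega : 1 ≤ 3) hB) u
    · exact apply_mem_wordSpan (bracketWords_mono _ (by omega : 2 ≤ 3) hC2) u
    · exact apply_mem_wordSpan (lieBracket_mem_bracketWords (i := 2) (by omega) (by simp) hC2) u
    · exact apply_mem_wordSpan (lieBracket_mem_bracketWords (i := 2) (by omega) (by simp) hC2) u

variable {n : ℕ}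

/-- The projection to the jet space as a continuous linear map. -/
def jetPartL (n : ℕ) : EuclideanSpace ℝ (Fin (n + 3)) →L[ℝ] ℝ × (Fin (n + 1) → ℝ) :=
  (EuclideanSpace.proj (𝕜 := ℝ) (0 : Fin (n + 3))).prod
    (ContinuousLinearMap.pi fun i : Fin (n + 1) => EuclideanSpace.proj (𝕜 := ℝ) i.castSucc.succ)

/-- The linear part `∑ y_{i+1} ∂/∂y_i` of the total derivative. -/
def jetShift (n : ℕ) : EuclideanSpace ℝ (Fin (n + 3)) →L[ℝ] EuclideanSpace ℝ (Fin (n + 3)) :=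
  ∑ i : Fin n, (EuclideanSpace.proj (𝕜 := ℝ) (i.succ.castSucc.succ : Fin (n + 3))).smulRight
    (EuclideanSpace.single (i.castSucc.castSucc.succ : Fin (n + 3)) (1 : ℝ))

/-- Index convention: `x` is coordinate `0`, `y_i` is coordinate `i + 1`, and `z` is coordinate `n +
2`. So the entries `1, …, n` are those of `y_0, …, y_{n-1}`. -/
theorem jetShift_apply (w : EuclideanSpace ℝ (Fin (n + 3))) (k : Fin (n + 3)) :
    jetShift n w k = if h : 1 ≤ k.val ∧ k.val ≤ n then w ⟨k.val + 1, by omega⟩ else 0 := by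
  have e : jetShift n w k = ∑ i : Fin n, if k.val = i.val + 1 then w i.succ.castSucc.succ else 0 := by
    simp only [jetShift, sum_apply, ContinuousLinearMap.smulRight_apply]
    rw [WithLp.ofLp_sum, Finset.sum_apply]
    refine Finset.sum_congr rfl fun i _ => ?_
    simp [Fin.ext_iff]
  rw [e]
  split_ifs with h
  · rw [Finset.sum_eq_single (⟨k.val - 1, by omega⟩ : Fin n)]
    · rw [if_pos (by simp; omega)]
      exact congrArg w.ofLp (Fin.ext (by simp; omega))
    · intro i _ hi
      rw [if_neg]
      intro hk
      exact hi (by ext; simp; omega)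
    · simp
  · refine Finset.sum_eq_zero fun i _ => ?_
    rw [if_neg]
    intro hk
    have := i.2
    exact h ⟨by omega, by omega⟩

/-- The direction of the last coordinate. -/
def lastDir (n : ℕ) : EuclideanSpace ℝ (Fin (n + 3)) := EuclideanSpace.single (Fin.last (n + 2)) 1

theorem lagrangianField₁_eq (f : ℝ × (Fin (n + 1) → ℝ) → ℝ) (w : EuclideanSpace ℝ (Fin (n + 3))) :
    lagrangianField₁ f w =
      EuclideanSpace.single 0 1 + jetShift n w + f (jetPart w) • lastDir n := by
  simp only [lagrangianField₁, jetShift, sum_apply, ContinuousLinearMap.smulRight_apply, lastDir]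
  rfl

theorem lastDir_apply (k : Fin (n + 3)) : lastDir n k = if k.val = n + 2 then 1 else 0 := by
  simp [lastDir, Fin.ext_iff]

theorem lagrangianField₂_apply (k : Fin (n + 3)) :
    lagrangianField₂ n k = if k.val = n + 1 then 1 else 0 := by
  simp [lagrangianField₂, Fin.ext_iff]

theorem single_zero_apply (k : Fin (n + 3)) :
    (EuclideanSpace.single 0 1 : EuclideanSpace ℝ (Fin (n + 3))) k = if k.val = 0 then 1 else 0 :=
  (PiLp.single_apply 2 ℝ 0 1 k).trans (if_congr Fin.ext_iff rfl rfl)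

theorem jetShift_lastDir : jetShift n (lastDir n) = 0 := by
  ext k
  rw [jetShift_apply]
  split_ifs with h
  · rw [lastDir_apply, if_neg (by simp; omega)]
    rfl
  · rfl

theorem jetPart_lastDir : jetPartL n (lastDir n) = 0 := by
  refine Prod.ext ?_ (funext fun i => ?_)
  · change lastDir n 0 = 0
    rw [lastDir_apply, if_neg (by simp)]
  · change lastDir n i.castSucc.succ = 0
    rw [lastDir_apply, if_neg (by simp; omega)]

theorem jetShift_lagrangianField₂_apply (hn : 1 ≤ n) (k : Fin (n + 3)) :
    jetShift n (lagrangianField₂ n) k = if k.val = n then 1 else 0 := by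
  rw [jetShift_apply]
  split_ifs with h h' h'
  · rw [lagrangianField₂_apply, if_pos (by simp; omega)]
  · rw [lagrangianField₂_apply, if_neg (by simp; omega)]
  · omega
  · rfl

theorem jetShift_jetShift_lagrangianField₂_apply (hn : 2 ≤ n) (k : Fin (n + 3)) :
    jetShift n (jetShift n (lagrangianField₂ n)) k = if k.val + 1 = n then 1 else 0 := by
  rw [jetShift_apply]
  split_ifs with h h' h'
  · rw [jetShift_lagrangianField₂_apply (by omega), if_pos (by simp; omega)]
  · rw [jetShift_lagrangianField₂_apply (by omega), if_neg (by simp; omega)]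
  · omega
  · rfl

variable {f : ℝ × (Fin (n + 1) → ℝ) → ℝ} {w : EuclideanSpace ℝ (Fin (n + 3))}

theorem SmoothNear.jetPart_comp (hf : SmoothNear f (jetPart w)) :
    SmoothNear (fun w => f (jetPart w)) w :=
  SmoothNear.comp (f := jetPartL n) hf (jetPartL n).contDiff.smoothNear

theorem smoothNear_lagrangianField₁ (hf : SmoothNear f (jetPart w)) :
    SmoothNear (lagrangianField₁ f) w := by
  refine SmoothNear.congr (f := fun w => EuclideanSpace.single 0 1 + jetShift n w +
    f (jetPart w) • lastDir n) ?_ (Filter.Eventually.of_forall (lagrangianField₁_eq f))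
  exact ((SmoothNear.const _).add (jetShift n).contDiff.smoothNear).add
    (hf.jetPart_comp.smul (SmoothNear.const _))

theorem fderiv_lagrangianField₁ (hf : SmoothNear f (jetPart w))
    (v : EuclideanSpace ℝ (Fin (n + 3))) :
    fderiv ℝ (lagrangianField₁ f) w v =
      jetShift n v + fderiv ℝ (fun w => f (jetPart w)) w v • lastDir n := by
  have e : lagrangianField₁ f = fun w => EuclideanSpace.single 0 1 + jetShift n w +
      f (jetPart w) • lastDir n := funext (lagrangianField₁_eq f)
  have h : HasFDerivAt (fun w => EuclideanSpace.single 0 1 + jetShift n w +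
      f (jetPart w) • lastDir n) _ w :=
    ((jetShift n).hasFDerivAt.const_add (EuclideanSpace.single 0 1)).add
      (hf.jetPart_comp.hasFDerivAt.smul_const (lastDir n))
  rw [e, h.fderiv]
  simp

theorem lieBracket_lagrangianField (hf : SmoothNear f (jetPart w)) :
    lieBracket ℝ (fun _ => lagrangianField₂ n) (lagrangianField₁ f) w =
      jetShift n (lagrangianField₂ n) +
        fderiv ℝ (fun w => f (jetPart w)) w (lagrangianField₂ n) • lastDir n := by
  simp [lieBracket, fderiv_lagrangianField₁ hf]

theorem eventually_smoothNear_jetPart (hf : SmoothNear f (jetPart w)) :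
    ∀ᶠ v in 𝓝 w, SmoothNear f (jetPart v) :=
  (jetPartL n).continuous.continuousAt.eventually hf.eventually

theorem fderiv_lieBracket_lagrangianField (hf : SmoothNear f (jetPart w))
    (v : EuclideanSpace ℝ (Fin (n + 3))) :
    fderiv ℝ (lieBracket ℝ (fun _ => lagrangianField₂ n) (lagrangianField₁ f)) w v =
      fderiv ℝ (fun u => fderiv ℝ (fun w => f (jetPart w)) u (lagrangianField₂ n)) w v •
        lastDir n := by
  have e : lieBracket ℝ (fun _ => lagrangianField₂ n) (lagrangianField₁ f) =ᶠ[𝓝 w]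
      fun u => jetShift n (lagrangianField₂ n) +
        fderiv ℝ (fun w => f (jetPart w)) u (lagrangianField₂ n) • lastDir n := by
    filter_upwards [eventually_smoothNear_jetPart hf] with u hu
    exact lieBracket_lagrangianField hu
  have h1 : SmoothNear (fun u => fderiv ℝ (fun w => f (jetPart w)) u (lagrangianField₂ n)) w :=
    hf.jetPart_comp.fderiv_apply (SmoothNear.const _)
  have h : HasFDerivAt (fun u => jetShift n (lagrangianField₂ n) +
        fderiv ℝ (fun w => f (jetPart w)) u (lagrangianField₂ n) • lastDir n) _ w :=
    (h1.hasFDerivAt.smul_const (lastDir n)).const_add (jetShift n (lagrangianField₂ n))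
  rw [e.fderiv_eq, h.fderiv]
  simp

/-- Both sides are the second derivative of `f` along the line through `w` in the direction
`∂/∂y_n`, parametrized by the value of `y_n`. -/
theorem secondTopPartial_jetPart (hf : SmoothNear f (jetPart w)) :
    secondTopPartial f (jetPart w) =
      fderiv ℝ (fun u => fderiv ℝ (fun w => f (jetPart w)) u (lagrangianField₂ n)) w
        (lagrangianField₂ n) := by
  set a := lagrangianField₂ n with ha
  set c : ℝ := (jetPart w).2 (Fin.last n) with hc
  set l : ℝ → EuclideanSpace ℝ (Fin (n + 3)) := fun t => w + (t - c) • a with hl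
  have hl' : ∀ t, HasDerivAt l a t := fun t => by
    have := (((hasDerivAt_id t).sub_const c).smul_const a).const_add w
    rwa [one_smul] at this
  have hlc : l c = w := by simp [hl]
  have hjet : ∀ t, jetPart (l t) = ((jetPart w).1, Function.update (jetPart w).2 (Fin.last n) t) := by
    intro t
    refine Prod.ext ?_ (funext fun i => ?_)
    · change w 0 + (t - c) * a 0 = w 0
      rw [ha, lagrangianField₂_apply, if_neg (by simp)]
      simp
    · change w i.castSucc.succ + (t - c) * a i.castSucc.succ =
        Function.update (jetPart w).2 (Fin.last n) t i
      rw [ha, lagrangianField₂_apply]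
      rcases eq_or_ne i (Fin.last n) with rfl | hi
      · rw [if_pos (by simp), Function.update_self, hc]
        change w _ + (t - w _) * 1 = t
        ring
      · rw [Function.update_of_ne hi, if_neg]
        · simp [jetPart]
        · intro h
          refine hi (Fin.ext ?_)
          simpa using h
  have hlw : Filter.Tendsto l (𝓝 c) (𝓝 w) := by
    have := (hl' c).continuousAt.tendsto
    rwa [hlc] at this
  have e1 : (fun t : ℝ => f ((jetPart w).1, Function.update (jetPart w).2 (Fin.last n) t)) =
      fun t => f (jetPart (l t)) := funext fun t => by rw [hjet]
  have e2 : deriv (fun t => f (jetPart (l t))) =ᶠ[𝓝 c]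
      fun t => fderiv ℝ (fun w => f (jetPart w)) (l t) a := by
    filter_upwards [hlw.eventually hf.jetPart_comp.eventually] with t ht
    exact (ht.hasFDerivAt.comp_hasDerivAt t (hl' t)).deriv
  have h1 : SmoothNear (fun u => fderiv ℝ (fun w => f (jetPart w)) u a) (l c) := by
    rw [hlc]
    exact hf.jetPart_comp.fderiv_apply (SmoothNear.const _)
  have e3 : deriv (fun t => fderiv ℝ (fun w => f (jetPart w)) (l t) a) c = _ :=
    (h1.hasFDerivAt.comp_hasDerivAt c (hl' c)).deriv
  rw [secondTopPartial, iteratedDeriv_succ, iteratedDeriv_one, e1, ← hc, e2.deriv_eq, e3, hlc]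

/-- In `[X₂, X₁]` only the coefficient `∂f/∂y_n` of `∂/∂z` depends on the point, so bracketing again
with `X₂` leaves a multiple of `∂/∂z`. Here the nondegeneracy of the Lagrangian becomes a condition
on `D^3`. -/
theorem lieBracket_lagrangianField₂ (hf : SmoothNear f (jetPart w)) :
    lieBracket ℝ (fun _ => lagrangianField₂ n)
      (lieBracket ℝ (fun _ => lagrangianField₂ n) (lagrangianField₁ f)) w =
      secondTopPartial f (jetPart w) • lastDir n := by
  rw [secondTopPartial_jetPart hf, ← fderiv_lieBracket_lagrangianField hf]
  nth_rewrite 1 [lieBracket]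
  simp

/-- Bracketing with the total derivative moves `∂/∂y_{n-1}` to `-∂/∂y_{n-2}`. The coefficient of
`∂/∂z` need not be known, since for nondegenerate `f` this direction is already supplied by the
other triple bracket. -/
theorem lieBracket_lagrangianField₁ (hf : SmoothNear f (jetPart w)) :
    ∃ c : ℝ, lieBracket ℝ (lagrangianField₁ f)
      (lieBracket ℝ (fun _ => lagrangianField₂ n) (lagrangianField₁ f)) w =
      c • lastDir n - jetShift n (jetShift n (lagrangianField₂ n)) := by
  refine ⟨fderiv ℝ (fun u => fderiv ℝ (fun w => f (jetPart w)) u (lagrangianField₂ n)) w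
    (lagrangianField₁ f w) - fderiv ℝ (fun w => f (jetPart w)) w
      (lieBracket ℝ (fun _ => lagrangianField₂ n) (lagrangianField₁ f) w), ?_⟩
  nth_rewrite 1 [lieBracket]
  rw [fderiv_lieBracket_lagrangianField hf, fderiv_lagrangianField₁ hf]
  have e : jetShift n (lieBracket ℝ (fun _ => lagrangianField₂ n) (lagrangianField₁ f) w) =
      jetShift n (jetShift n (lagrangianField₂ n)) := by
    rw [lieBracket_lagrangianField hf, map_add, map_smul, jetShift_lastDir, smul_zero, add_zero]
  rw [e]
  module

theorem finrank_wordSpan_lagrangianField_le (hf : SmoothNear f (jetPart w))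
    (h : secondTopPartial f (jetPart w) = 0) :
    finrank ℝ (wordSpan {lagrangianField₁ f, fun _ => lagrangianField₂ n} 3 w) ≤ 4 := by
  classical
  rw [wordSpan_three, lieBracket_lagrangianField₂ hf, h, zero_smul]
  set A := lagrangianField₁ f w
  set C := lieBracket ℝ (fun _ => lagrangianField₂ n) (lagrangianField₁ f) with hC
  have hle : Submodule.span ℝ {A, lagrangianField₂ n, C w,
      lieBracket ℝ (lagrangianField₁ f) C w, 0} ≤
      Submodule.span ℝ (({A, lagrangianField₂ n, C w,
        lieBracket ℝ (lagrangianField₁ f) C w} : Finset _) : Set _) := by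
    rw [Submodule.span_le]
    rintro _ (rfl | rfl | rfl | rfl | rfl)
    · exact Submodule.subset_span (by simp)
    · exact Submodule.subset_span (by simp)
    · exact Submodule.subset_span (by simp)
    · exact Submodule.subset_span (by simp)
    · exact zero_mem _
  exact (Submodule.finrank_mono hle).trans ((finrank_span_finset_le_card _).trans Finset.card_le_four)

theorem finrank_wordSpan_lagrangianField (hn : 2 ≤ n) (hf : SmoothNear f (jetPart w))
    (h : secondTopPartial f (jetPart w) ≠ 0) :
    finrank ℝ (wordSpan {lagrangianField₁ f, fun _ => lagrangianField₂ n} 3 w) = 5 := by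
  obtain ⟨c, hc⟩ := lieBracket_lagrangianField₁ hf
  rw [wordSpan_three, lieBracket_lagrangianField₂ hf, hc, lieBracket_lagrangianField hf,
    lagrangianField₁_eq]
  set b := fderiv ℝ (fun w => f (jetPart w)) w (lagrangianField₂ n)
  set r := secondTopPartial f (jetPart w)
  set v : Fin 5 → EuclideanSpace ℝ (Fin (n + 3)) :=
    ![EuclideanSpace.single 0 1 + jetShift n w + f (jetPart w) • lastDir n, lagrangianField₂ n,
      jetShift n (lagrangianField₂ n) + b • lastDir n,
      c • lastDir n - jetShift n (jetShift n (lagrangianField₂ n)), r • lastDir n] with hv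
  have hrange : ({EuclideanSpace.single 0 1 + jetShift n w + f (jetPart w) • lastDir n,
      lagrangianField₂ n, jetShift n (lagrangianField₂ n) + b • lastDir n,
      c • lastDir n - jetShift n (jetShift n (lagrangianField₂ n)), r • lastDir n} : Set _) =
      range v := by
    simp only [hv, Matrix.range_cons, Matrix.range_empty, union_empty, singleton_union]
  rw [hrange]
  have hli : LinearIndependent ℝ v := by
    rw [Fintype.linearIndependent_iff]
    intro g hg
    have hcoord : ∀ k : Fin (n + 3),
        g 0 * ((if k.val = 0 then 1 else 0) + jetShift n w k +
          f (jetPart w) * (if k.val = n + 2 then 1 else 0)) +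
        g 1 * (if k.val = n + 1 then 1 else 0) +
        g 2 * ((if k.val = n then 1 else 0) + b * (if k.val = n + 2 then 1 else 0)) +
        g 3 * (c * (if k.val = n + 2 then 1 else 0) - (if k.val + 1 = n then 1 else 0)) +
        g 4 * (r * (if k.val = n + 2 then 1 else 0)) = 0 := by
      intro k
      have h1 := congrArg (fun u : EuclideanSpace ℝ (Fin (n + 3)) => u k) hg
      simp only [Fin.sum_univ_five] at h1
      simp only [hv, PiLp.add_apply, PiLp.smul_apply, PiLp.sub_apply, PiLp.zero_apply,
        Matrix.cons_val, smul_eq_mul, single_zero_apply, lastDir_apply, lagrangianField₂_apply,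
        jetShift_lagrangianField₂_apply (show 1 ≤ n by omega),
        jetShift_jetShift_lagrangianField₂_apply hn] at h1
      exact h1
    -- Read in the order `x`, `y_n`, `y_{n-1}`, `y_{n-2}`, `z`, the coordinates form a triangular
    -- system; `y_{n-2}` exists because `n ≥ 2`.
    have s0 : g 0 = 0 := by
      have h1 := hcoord ⟨0, by omega⟩
      rw [jetShift_apply] at h1
      simpa [show ¬ 0 = n by omega, show ¬ 1 = n by omega] using h1
    have s1 : g 1 = 0 := by
      have h1 := hcoord ⟨n + 1, by omega⟩
      simpa [s0, show ¬ n + 1 + 1 = n by omega] using h1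
    have s2 : g 2 = 0 := by
      have h1 := hcoord ⟨n, by omega⟩
      simpa [s0, s1] using h1
    have s3 : g 3 = 0 := by
      have h1 := hcoord ⟨n - 1, by omega⟩
      simpa [s0, s1, s2, show n - 1 + 1 = n by omega, show ¬ n - 1 = n + 2 by omega] using h1
    have s4 : g 4 = 0 := by
      have h1 := hcoord ⟨n + 2, by omega⟩
      simpa [s0, s1, s2, s3, h] using h1
    intro i
    fin_cases i
    exacts [s0, s1, s2, s3, s4]
  rw [finrank_span_eq_card hli, Fintype.card_fin]

theorem lastDir_mem_wordSpan (hf : SmoothNear f (jetPart w))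
    (h : secondTopPartial f (jetPart w) ≠ 0) :
    lastDir n ∈ wordSpan {lagrangianField₁ f, fun _ => lagrangianField₂ n} 3 w := by
  rw [wordSpan_three, lieBracket_lagrangianField₂ hf]
  have h1 : secondTopPartial f (jetPart w) • lastDir n ∈ Submodule.span ℝ
      {lagrangianField₁ f w, lagrangianField₂ n,
        lieBracket ℝ (fun _ => lagrangianField₂ n) (lagrangianField₁ f) w,
        lieBracket ℝ (lagrangianField₁ f)
          (lieBracket ℝ (fun _ => lagrangianField₂ n) (lagrangianField₁ f)) w,
        secondTopPartial f (jetPart w) • lastDir n} := Submodule.subset_span (by simp)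
  exact (Submodule.smul_mem_iff _ h).1 h1

theorem linearIndependent_lagrangianFields (w : EuclideanSpace ℝ (Fin (n + 3))) :
    LinearIndependent ℝ ![lagrangianField₁ f w, lagrangianField₂ n] := by
  rw [LinearIndependent.pair_iff]
  intro s t hst
  have hcoord : ∀ k : Fin (n + 3), s * ((if k.val = 0 then 1 else 0) + jetShift n w k +
      f (jetPart w) * (if k.val = n + 2 then 1 else 0)) + t * (if k.val = n + 1 then 1 else 0) =
      0 := by
    intro k
    have h1 := congrArg (fun u : EuclideanSpace ℝ (Fin (n + 3)) => u k) hst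
    simp only [lagrangianField₁_eq, PiLp.add_apply, PiLp.smul_apply, PiLp.zero_apply, smul_eq_mul,
      single_zero_apply, lastDir_apply, lagrangianField₂_apply] at h1
    exact h1
  have s0 : s = 0 := by
    have h1 := hcoord ⟨0, by omega⟩
    rw [jetShift_apply] at h1
    simpa using h1
  refine ⟨s0, ?_⟩
  have h1 := hcoord ⟨n + 1, by omega⟩
  simpa [s0] using h1

end Lagrangian

/-! ### Coordinates adapted to a symmetry -/

section Adapted

open VectorField

variable {F : Type} [NormedAddCommGroup F] [NormedSpace ℝ F]

/-- In `[X, f H] = f [X, H] + X(f) H` no coefficient of `X` is differentiated, so, unlike for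
general brackets, the value of `X` need not lie in `P`. -/
theorem LocGen.lieBracket_apply_mem_of_symmetry {ℋ : Set (F → F)} {X Z : F → F} {w : F}
    {P : Submodule ℝ F} (hX : SmoothNear X w) (hℋ : ∀ H ∈ ℋ, SmoothNear H w)
    (h1 : ∀ H ∈ ℋ, H w ∈ P) (h2 : ∀ H ∈ ℋ, VectorField.lieBracket ℝ X H w ∈ P)
    (hZ : Z ∈ LocGen ℋ w) : VectorField.lieBracket ℝ X Z w ∈ P := by
  have s : ∀ {Z}, Z ∈ LocGen ℋ w → SmoothNear Z w := fun hZ => smoothNear hZ hℋ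
  induction hZ using Submodule.span_induction with
  | mem Z hZ =>
    obtain ⟨f, hf, H, rfl | hH, e⟩ := hZ
    · have e' : Z =ᶠ[𝓝 w] fun _ => (0 : F) := by filter_upwards [e] with v hv; simp [hv]
      have : VectorField.lieBracket ℝ X Z w = 0 := by
        simp only [VectorField.lieBracket, e'.fderiv_eq, e'.eq_of_nhds]
        simp
      rw [this]
      exact zero_mem _
    · have e1 := Filter.EventuallyEq.lieBracket_vectorField_eq (𝕜 := ℝ)
        (Filter.EventuallyEq.refl (𝓝 w) X) e
      have e2 := (LocGen.lieBracket_smul_smul (SmoothNear.const (1 : ℝ)) hf hX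
        (hℋ H hH)).eq_of_nhds
      simp only [one_smul, one_mul, fderiv_fun_const, Pi.zero_apply, zero_apply, mul_zero,
        zero_smul, sub_zero] at e2
      rw [e1]
      exact e2 ▸ P.add_mem (P.smul_mem _ (h2 H hH)) (P.smul_mem _ (h1 H hH))
  | zero => rw [VectorField.lieBracket_zero_right]; exact zero_mem _
  | add V W hV hW h3 h4 =>
    rw [lieBracket_add_right (s hV).differentiableAt (s hW).differentiableAt]
    exact add_mem h3 h4
  | smul c V hV h3 =>
    rw [lieBracket_const_smul_right (s hV).differentiableAt]
    exact P.smul_mem c h3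

/-- Two commuting fields that are independent at a point can be rectified simultaneously; the first
coordinate of the rectification. -/
theorem exists_coordinate_of_commute [FiniteDimensional ℝ F] {X Y : F → F} {u : F}
    (hX : SmoothNear X u) (hY : SmoothNear Y u) (hli : LinearIndependent ℝ ![X u, Y u])
    (hc : ∀ᶠ q in 𝓝 u, lieBracket ℝ X Y q = 0) :
    ∃ z : F → ℝ, SmoothNear z u ∧ ∀ᶠ q in 𝓝 u, fderiv ℝ z q (X q) = 1 ∧ fderiv ℝ z q (Y q) = 0 := by
  set k : Fin 2 → F → F := ![X, Y] with hk
  have sk : ∀ i, SmoothNear (k i) u := by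
    intro i
    fin_cases i
    exacts [hX, hY]
  have e : ∀ q, (fun i => k i q) = ![X q, Y q] := by
    intro q
    funext i
    fin_cases i <;> rfl
  obtain ⟨P, hP⟩ := exists_leftInverse_frameMap (k := k) (p := u) (by rw [e]; exact hli)
  have hZ := SmoothNear.frameMap sk
  have hZv : ∀ q v, frameMap k q v = v 0 • X q + v 1 • Y q := fun q v => by
    rw [frameMap_apply, Fin.sum_univ_two]
    rfl
  obtain ⟨Ψ, h1, -, h3⟩ := exists_rectification hZ hP (by
    filter_upwards [hZ.eventually, hX.eventually, hY.eventually, hc] with q sZ sX sY hq v w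
    have hd : ∀ a b, fderiv ℝ (frameMap k) q b a =
        a 0 • fderiv ℝ X q b + a 1 • fderiv ℝ Y q b := by
      intro a b
      have e1 : HasFDerivAt (fun q => frameMap k q a)
          ((ContinuousLinearMap.apply ℝ F a).comp (fderiv ℝ (frameMap k) q)) q :=
        (ContinuousLinearMap.apply ℝ F a).hasFDerivAt.comp q sZ.hasFDerivAt
      have e2 : HasFDerivAt (fun q => frameMap k q a)
          (a 0 • fderiv ℝ X q + a 1 • fderiv ℝ Y q) q :=
        ((sX.hasFDerivAt.const_smul (a 0)).add (sY.hasFDerivAt.const_smul (a 1))).congr_of_eventuallyEq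
          (Filter.Eventually.of_forall fun q => hZv q a)
      exact DFunLike.congr_fun (e1.unique e2) b
    have hq' : fderiv ℝ Y q (X q) = fderiv ℝ X q (Y q) := sub_eq_zero.1 hq
    rw [hd, hd, hZv, hZv]
    simp only [map_add, map_smul, hq']
    module)
  refine ⟨fun q => P (Ψ q) 0,
    (h1.clm P).clm (ContinuousLinearMap.proj (R := ℝ) (φ := fun _ : Fin 2 => ℝ) 0), ?_⟩
  filter_upwards [h1.eventually, h3] with q sΨ hq
  have e1 : HasFDerivAt (fun q => P (Ψ q) 0) ((ContinuousLinearMap.proj (R := ℝ)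
      (φ := fun _ : Fin 2 => ℝ) 0).comp (P.comp (fderiv ℝ Ψ q))) q :=
    (ContinuousLinearMap.proj (R := ℝ) (φ := fun _ : Fin 2 => ℝ) 0).hasFDerivAt.comp q
      (P.hasFDerivAt.comp q sΨ.hasFDerivAt)
  have e2 : ∀ v, fderiv ℝ (fun q => P (Ψ q) 0) q (frameMap k q v) = v 0 := by
    intro v
    rw [e1.fderiv]
    change P (fderiv ℝ Ψ q (frameMap k q v)) 0 = v 0
    rw [hq]
    exact congrFun (DFunLike.congr_fun hP v) 0
  have e3 := e2 (Pi.single 0 1)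
  have e4 := e2 (Pi.single 1 1)
  rw [frameMap_single] at e3 e4
  exact ⟨e3.trans (by simp), e4.trans (by simp)⟩

/-- On `D` the pair `(dx, dy_n)` is an isomorphism onto the plane, and `T`, `Y` are the preimages of
the standard basis. Both commute with the symmetry `X`, so rectifying the commuting fields `X` and
`Y` yields `z`. -/
theorem exists_adapted_frame [FiniteDimensional ℝ F] {n : ℕ} {A B X : F → F} {x : F → ℝ}
    {y : ℕ → F → ℝ} {u : F} (hA : SmoothNear A u) (hB : SmoothNear B u) (hX : SmoothNear X u)
    (hx : SmoothNear x u) (hy : ∀ k, SmoothNear (y k) u) (hAB : LinearIndependent ℝ ![A u, B u])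
    (hXD : X u ∉ Submodule.span ℝ {A u, B u}) (hxX : ∀ᶠ q in 𝓝 u, fderiv ℝ x q (X q) = 0)
    (hyX : ∀ᶠ q in 𝓝 u, ∀ k ≤ n, fderiv ℝ (y k) q (X q) = 0)
    (hker : ∀ v, fderiv ℝ x u v = 0 → (∀ k ≤ n, fderiv ℝ (y k) u v = 0) →
      v ∈ Submodule.span ℝ {X u})
    (hD : ∀ᶠ q in 𝓝 u, ∀ v ∈ Submodule.span ℝ {A q, B q}, ∀ k < n,
      fderiv ℝ (y k) q v = y (k + 1) q * fderiv ℝ x q v)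
    (hXA : ∀ᶠ q in 𝓝 u, lieBracket ℝ X A q ∈ Submodule.span ℝ {A q, B q})
    (hXB : ∀ᶠ q in 𝓝 u, lieBracket ℝ X B q ∈ Submodule.span ℝ {A q, B q}) :
    ∃ (T Y : F → F) (z : F → ℝ), SmoothNear T u ∧ SmoothNear Y u ∧ SmoothNear z u ∧
      ∀ᶠ q in 𝓝 u, Submodule.span ℝ {T q, Y q} = Submodule.span ℝ {A q, B q} ∧
        fderiv ℝ x q (T q) = 1 ∧ fderiv ℝ (y n) q (T q) = 0 ∧ fderiv ℝ x q (Y q) = 0 ∧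
        fderiv ℝ (y n) q (Y q) = 1 ∧ fderiv ℝ z q (X q) = 1 ∧ fderiv ℝ z q (Y q) = 0 ∧
        lieBracket ℝ X T q = 0 := by
  set Q : F → ℝ × ℝ := fun q => (x q, y n q) with hQdef
  have hQ : SmoothNear Q u := hx.prodMk (hy n)
  have hL : SmoothNear (fderiv ℝ Q) u := hQ.fderiv
  have hQd : ∀ᶠ q in 𝓝 u, ∀ v, fderiv ℝ Q q v = (fderiv ℝ x q v, fderiv ℝ (y n) q v) := by
    filter_upwards [hx.eventually, (hy n).eventually] with q h1 h2 v
    have : HasFDerivAt Q ((fderiv ℝ x q).prod (fderiv ℝ (y n) q)) q :=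
      h1.hasFDerivAt.prodMk h2.hasFDerivAt
    rw [this.fderiv]
    rfl
  -- A vector of `D` killed by `dx` and `dy_n` is killed by all `dy_k` through the contact
  -- relations, hence is a multiple of `X`; it vanishes because `X` is not in `D`.
  have hli : LinearIndependent ℝ ![fderiv ℝ Q u (A u), fderiv ℝ Q u (B u)] := by
    rw [LinearIndependent.pair_iff] at hAB ⊢
    intro s t hst
    rw [← map_smul, ← map_smul, ← map_add, hQd.self_of_nhds] at hst
    obtain ⟨e1, e2⟩ := Prod.mk.inj (show _ = ((0 : ℝ), (0 : ℝ)) from hst)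
    have hmem : s • A u + t • B u ∈ Submodule.span ℝ {A u, B u} :=
      Submodule.mem_span_pair.2 ⟨s, t, rfl⟩
    have h1 := hker (s • A u + t • B u) e1 fun k hk => by
      rcases hk.lt_or_eq with hk | rfl
      · rw [hD.self_of_nhds _ hmem k hk, e1, mul_zero]
      · exact e2
    obtain ⟨c, hc⟩ := Submodule.mem_span_singleton.1 h1
    rcases eq_or_ne c 0 with rfl | hc0
    · rw [zero_smul] at hc
      exact hAB s t hc.symm
    · rw [← hc] at hmem
      exact absurd ((Submodule.smul_mem_iff _ hc0).1 hmem) hXD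
  have hli' : ∀ᶠ q in 𝓝 u, LinearIndependent ℝ ![fderiv ℝ Q q (A q), fderiv ℝ Q q (B q)] := by
    have e : ∀ q, (fun i : Fin 2 => (![fun q => fderiv ℝ Q q (A q),
        fun q => fderiv ℝ Q q (B q)] : Fin 2 → F → ℝ × ℝ) i q) =
        ![fderiv ℝ Q q (A q), fderiv ℝ Q q (B q)] := by
      intro q
      funext i
      fin_cases i <;> rfl
    have h1 := SmoothNear.eventually_linearIndependent (p := u)
      (k := ![fun q => fderiv ℝ Q q (A q), fun q => fderiv ℝ Q q (B q)]) (fun i => by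
        fin_cases i
        exacts [hL.clm_apply hA, hL.clm_apply hB]) (by rw [e]; exact hli)
    filter_upwards [h1] with q hq
    rwa [e] at hq
  have htop : ∀ᶠ q in 𝓝 u, ∀ v : ℝ × ℝ,
      v ∈ Submodule.span ℝ {fderiv ℝ Q q (A q), fderiv ℝ Q q (B q)} := by
    filter_upwards [hli'] with q hq v
    have h1 := hq.span_eq_top_of_card_eq_finrank' (by simp)
    rw [Matrix.range_cons, Matrix.range_cons, Matrix.range_empty, union_empty] at h1
    have h2 : v ∈ (⊤ : Submodule ℝ (ℝ × ℝ)) := trivial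
    rw [← h1] at h2
    exact h2
  have hinj : ∀ᶠ q in 𝓝 u, ∀ v ∈ Submodule.span ℝ {A q, B q}, fderiv ℝ Q q v = 0 → v = 0 := by
    filter_upwards [hli'] with q hq v hv h0
    obtain ⟨s, t, rfl⟩ := Submodule.mem_span_pair.1 hv
    rw [map_add, map_smul, map_smul] at h0
    obtain ⟨rfl, rfl⟩ := LinearIndependent.pair_iff.1 hq s t h0
    simp
  obtain ⟨T, hT, hTgen, hTL⟩ := exists_lift hA hB hL (SmoothNear.const ((1, 0) : ℝ × ℝ)) hli
    (htop.mono fun q hq => hq _)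
  obtain ⟨Y, hY, hYgen, hYL⟩ := exists_lift hA hB hL (SmoothNear.const ((0, 1) : ℝ × ℝ)) hli
    (htop.mono fun q hq => hq _)
  -- `[X, Z]` lies in `D` by symmetry. It is killed by `dx` and `dy_n`, since these are constant on
  -- `Z` and zero on `X`. By injectivity on `D` it vanishes.
  have hbr : ∀ (Z : F → F) (c : ℝ × ℝ), SmoothNear Z u → Z ∈ LocGen {A, B} u →
      (∀ᶠ q in 𝓝 u, Z q ∈ Submodule.span ℝ {A q, B q} ∧ fderiv ℝ Q q (Z q) = c) →
      ∀ᶠ q in 𝓝 u, lieBracket ℝ X Z q = 0 := by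
    intro Z c hZ hZgen hZc
    filter_upwards [hX.eventually, hA.eventually, hB.eventually, hZ.eventually,
      LocGen.eventually hZgen, hinj, hXA, hXB, hQ.eventually, hQd.eventually_nhds,
      hxX.eventually_nhds, hyX.eventually_nhds, hZc.eventually_nhds]
      with q sX sA sB sZ gZ hi h1 h2 sQ h3 h4 h5 h6
    refine hi _ (LocGen.lieBracket_apply_mem_of_symmetry (ℋ := {A, B}) sX ?_ ?_ ?_ gZ) ?_
    · rintro _ (rfl | rfl) <;> assumption
    · rintro _ (rfl | rfl) <;> exact Submodule.subset_span (by simp)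
    · rintro _ (rfl | rfl) <;> assumption
    · have e1 : (fun v => fderiv ℝ Q v (Z v)) =ᶠ[𝓝 q] fun _ => c := h6.mono fun v hv => hv.2
      have e2 : (fun v => fderiv ℝ Q v (X v)) =ᶠ[𝓝 q] fun _ => 0 := by
        filter_upwards [h3, h4, h5] with v h7 h8 h9
        rw [h7, h8, h9 n le_rfl]
        rfl
      rw [fderiv_apply_lieBracket_of_smoothNear sQ sX sZ, e1.fderiv_eq, e2.fderiv_eq]
      simp
  have hXT := hbr T _ hT hTgen hTL
  have hXY := hbr Y _ hY hYgen hYL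
  have hXYli : LinearIndependent ℝ ![X u, Y u] := by
    rw [LinearIndependent.pair_iff]
    intro s t hst
    have hYu := hYL.self_of_nhds
    rcases eq_or_ne s 0 with rfl | hs
    · refine ⟨rfl, ?_⟩
      rw [zero_smul, zero_add] at hst
      have := congrArg (fderiv ℝ Q u) hst
      rw [map_smul, hYu.2, map_zero] at this
      simpa using congrArg Prod.snd this
    · refine absurd ((Submodule.smul_mem_iff _ hs).1 ?_) hXD
      rw [eq_neg_of_add_eq_zero_left hst]
      exact neg_mem (Submodule.smul_mem _ _ hYu.1)
  obtain ⟨z, hz, hzd⟩ := exists_coordinate_of_commute hX hY hXYli hXY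
  refine ⟨T, Y, z, hT, hY, hz, ?_⟩
  filter_upwards [hTL, hYL, hzd, hXT, hQd, hinj] with q h1 h2 h3 h4 h5 h6
  have eT := h1.2
  have eY := h2.2
  rw [h5] at eT eY
  obtain ⟨t1, t2⟩ := Prod.mk.inj eT
  obtain ⟨y1, y2⟩ := Prod.mk.inj eY
  refine ⟨le_antisymm ?_ fun v hv => ?_, t1, t2, y1, y2, h3.1, h3.2, h4⟩
  · rw [Submodule.span_le]
    rintro _ (rfl | rfl)
    exacts [h1.1, h2.1]
  · have h7 := h6 (v - (fderiv ℝ x q v • T q + fderiv ℝ (y n) q v • Y q))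
      (sub_mem hv (add_mem (Submodule.smul_mem _ _ h1.1) (Submodule.smul_mem _ _ h2.1))) (by
        rw [h5]
        simp [t1, t2, y1, y2])
    rw [sub_eq_zero.1 h7]
    exact Submodule.mem_span_pair.2 ⟨_, _, rfl⟩

end Adapted

/-! ### Lagrangian coordinates from an adapted frame -/

section Coordinates

open VectorField

variable {n : ℕ}

/-- The point with coordinates `(x, y_0, …, y_n)` and `z`. -/
def jetEmbed (n : ℕ) : ((ℝ × (Fin (n + 1) → ℝ)) × ℝ) →L[ℝ] EuclideanSpace ℝ (Fin (n + 3)) :=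
  LinearMap.toContinuousLinearMap
    { toFun := fun j => WithLp.toLp 2 (Fin.cons j.1.1 (Fin.snoc j.1.2 j.2 : Fin (n + 2) → ℝ))
      map_add' := fun j j' => by
        ext i
        refine Fin.cases ?_ (fun i => ?_) i
        · simp
        · refine Fin.lastCases ?_ (fun i => ?_) i <;> simp
      map_smul' := fun c j => by
        ext i
        refine Fin.cases ?_ (fun i => ?_) i
        · simp
        · refine Fin.lastCases ?_ (fun i => ?_) i <;> simp }

theorem jetEmbed_apply (j : (ℝ × (Fin (n + 1) → ℝ)) × ℝ) :
    jetEmbed n j = WithLp.toLp 2 (Fin.cons j.1.1 (Fin.snoc j.1.2 j.2 : Fin (n + 2) → ℝ)) := rfl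

theorem jetPart_jetEmbed (j : (ℝ × (Fin (n + 1) → ℝ)) × ℝ) : jetPart (jetEmbed n j) = j.1 := by
  refine Prod.ext ?_ (funext fun i => ?_)
  · simp [jetPart, jetEmbed_apply]
  · simp [jetPart, jetEmbed_apply]

theorem jetEmbed_apply_last (j : (ℝ × (Fin (n + 1) → ℝ)) × ℝ) :
    jetEmbed n j (Fin.last (n + 2)) = j.2 := by
  have : Fin.last (n + 2) = (Fin.last (n + 1)).succ := rfl
  rw [this]
  simp [jetEmbed_apply]

theorem jetEmbed_jetPart (w : EuclideanSpace ℝ (Fin (n + 3))) :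
    jetEmbed n (jetPart w, w (Fin.last (n + 2))) = w := by
  ext i
  refine Fin.cases ?_ (fun i => ?_) i
  · simp [jetPart, jetEmbed_apply]
  · refine Fin.lastCases ?_ (fun i => ?_) i
    · simp [jetEmbed_apply]
    · simp [jetPart, jetEmbed_apply]

theorem jetEmbed_zero_one : jetEmbed n (0, 1) = lastDir n := by
  rw [← jetEmbed_jetPart (lastDir n)]
  refine congrArg _ (Prod.ext ?_ ?_)
  · exact (jetPart_lastDir (n := n)).symm
  · simp [lastDir]

theorem jetEmbed_add_smul_lastDir (j : ℝ × (Fin (n + 1) → ℝ)) (s t : ℝ) :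
    jetEmbed n (j, t) = jetEmbed n (j, s) + (t - s) • lastDir n := by
  rw [← jetEmbed_zero_one, ← map_smul, ← map_add]
  simp

theorem lagrangianField₁_eq_jetEmbed {f : ℝ × (Fin (n + 1) → ℝ) → ℝ}
    (w : EuclideanSpace ℝ (Fin (n + 3))) {a : Fin (n + 1) → ℝ}
    (h : ∀ i : Fin n, a i.castSucc = (jetPart w).2 i.succ) (hl : a (Fin.last n) = 0) :
    lagrangianField₁ f w = jetEmbed n ((1, a), f (jetPart w)) := by
  have hk : ∀ k : Fin (n + 3), lagrangianField₁ f w k = (if k.val = 0 then 1 else 0) +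
      jetShift n w k + f (jetPart w) * (if k.val = n + 2 then 1 else 0) := fun k => by
    rw [lagrangianField₁_eq, PiLp.add_apply, PiLp.add_apply, PiLp.smul_apply, single_zero_apply,
      lastDir_apply, smul_eq_mul]
  rw [← jetEmbed_jetPart (lagrangianField₁ f w)]
  refine congrArg _ (Prod.ext (Prod.ext ?_ (funext fun i => ?_)) ?_)
  · refine (hk _).trans ?_
    simp [jetShift_apply]
  · refine (hk _).trans ?_
    rw [jetShift_apply]
    refine Fin.lastCases ?_ (fun i => ?_) i
    · simp [hl]
    · refine Eq.trans ?_ (h i).symm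
      rw [dif_pos (by simp)]
      have := i.2
      simp [jetPart, show ¬ (i : ℕ) = n + 1 by omega]
      rfl
  · refine (hk _).trans ?_
    simp [jetShift_apply]

theorem lagrangianField₂_eq_jetEmbed {a : Fin (n + 1) → ℝ}
    (h : ∀ i : Fin n, a i.castSucc = 0) (hl : a (Fin.last n) = 1) :
    lagrangianField₂ n = jetEmbed n ((0, a), 0) := by
  have hk : ∀ k : Fin (n + 3), lagrangianField₂ n k = if k.val = n + 1 then 1 else 0 :=
    lagrangianField₂_apply
  rw [← jetEmbed_jetPart (lagrangianField₂ n)]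
  refine congrArg _ (Prod.ext (Prod.ext ?_ (funext fun i => ?_)) ?_)
  · refine (hk 0).trans ?_
    simp
  · refine (hk i.castSucc.succ).trans ?_
    refine Fin.lastCases ?_ (fun i => ?_) i
    · simp [hl]
    · have := i.2
      simp [h, show ¬ (i : ℕ) = n by omega]
  · refine (hk (Fin.last (n + 2))).trans ?_
    simp

/-- In the coordinates `(x, y_0, …, y_n, z)` the field `X` is `∂/∂z`, `Y` is `∂/∂y_n`, and the
contact relations turn `T` into the total derivative plus `(Tz) ∂/∂z`. The Lagrangian is `Tz`, once
it is known not to depend on `z`. -/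
theorem exists_lagrangian_chart {A B X T Y : EuclideanSpace ℝ (Fin (n + 3)) → EuclideanSpace ℝ (Fin (n + 3))}
    {x z : EuclideanSpace ℝ (Fin (n + 3)) → ℝ} {y : ℕ → EuclideanSpace ℝ (Fin (n + 3)) → ℝ}
    {u : EuclideanSpace ℝ (Fin (n + 3))} (hX : SmoothNear X u) (hT : SmoothNear T u)
    (hx : SmoothNear x u) (hy : ∀ k, SmoothNear (y k) u) (hz : SmoothNear z u)
    (hxX : ∀ᶠ q in 𝓝 u, fderiv ℝ x q (X q) = 0)
    (hyX : ∀ᶠ q in 𝓝 u, ∀ k ≤ n, fderiv ℝ (y k) q (X q) = 0)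
    (hker : ∀ v, fderiv ℝ x u v = 0 → (∀ k ≤ n, fderiv ℝ (y k) u v = 0) →
      v ∈ Submodule.span ℝ {X u})
    (hD : ∀ᶠ q in 𝓝 u, ∀ v ∈ Submodule.span ℝ {A q, B q}, ∀ k < n,
      fderiv ℝ (y k) q v = y (k + 1) q * fderiv ℝ x q v)
    (h : ∀ᶠ q in 𝓝 u, Submodule.span ℝ {T q, Y q} = Submodule.span ℝ {A q, B q} ∧
        fderiv ℝ x q (T q) = 1 ∧ fderiv ℝ (y n) q (T q) = 0 ∧ fderiv ℝ x q (Y q) = 0 ∧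
        fderiv ℝ (y n) q (Y q) = 1 ∧ fderiv ℝ z q (X q) = 1 ∧ fderiv ℝ z q (Y q) = 0 ∧
        lieBracket ℝ X T q = 0) {O : Set (EuclideanSpace ℝ (Fin (n + 3)))} (hO : O ∈ 𝓝 u) :
    ∃ (e : OpenPartialHomeomorph (EuclideanSpace ℝ (Fin (n + 3))) (EuclideanSpace ℝ (Fin (n + 3))))
      (Ω : Set (ℝ × (Fin (n + 1) → ℝ))) (f : ℝ × (Fin (n + 1) → ℝ) → ℝ),
      u ∈ e.source ∧ e.source ⊆ O ∧ ContDiffOn ℝ ∞ e e.source ∧ ContDiffOn ℝ ∞ e.symm e.target ∧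
      IsOpen Ω ∧ ContDiffOn ℝ ∞ f Ω ∧ (∀ q ∈ e.source, jetPart (e q) ∈ Ω) ∧
      (∀ j ∈ Ω, ∃ q ∈ e.source, jetPart (e q) = j) ∧
      ∀ q ∈ e.source, (Submodule.span ℝ {A q, B q}).map (fderiv ℝ e q).toLinearMap =
        Submodule.span ℝ {lagrangianField₁ f (e q), lagrangianField₂ n} := by
  set κ : EuclideanSpace ℝ (Fin (n + 3)) → EuclideanSpace ℝ (Fin (n + 3)) := fun q =>
    jetEmbed n ((x q, fun i : Fin (n + 1) => y i q), z q) with hκdef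
  have hκ : SmoothNear κ u :=
    ((hx.prodMk (SmoothNear.pi fun i : Fin (n + 1) => hy i)).prodMk hz).clm (jetEmbed n)
  have hκd : ∀ᶠ q in 𝓝 u, ∀ v, fderiv ℝ κ q v =
      jetEmbed n ((fderiv ℝ x q v, fun i : Fin (n + 1) => fderiv ℝ (y i) q v), fderiv ℝ z q v) := by
    have hy' : ∀ᶠ q in 𝓝 u, ∀ i : Fin (n + 1), SmoothNear (y i) q :=
      Filter.eventually_all.2 fun i => (hy i).eventually
    filter_upwards [hx.eventually, hy', hz.eventually] with q h1 h2 h3 v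
    have e1 : HasFDerivAt (fun q => fun i : Fin (n + 1) => y i q)
        (ContinuousLinearMap.pi fun i : Fin (n + 1) => fderiv ℝ (y i) q) q :=
      hasFDerivAt_pi.2 fun i => (h2 i).hasFDerivAt
    have e2 := (jetEmbed n).hasFDerivAt.comp q ((h1.hasFDerivAt.prodMk e1).prodMk h3.hasFDerivAt)
    have e3 : HasFDerivAt κ _ q := e2
    rw [e3.fderiv]
    rfl
  have jinj : ∀ j : (ℝ × (Fin (n + 1) → ℝ)) × ℝ, jetEmbed n j = 0 → j = 0 := by
    intro j hj
    refine Prod.ext ?_ ?_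
    · rw [← jetPart_jetEmbed j, hj]
      rfl
    · rw [← jetEmbed_apply_last j, hj]
      rfl
  have hinj : Function.Injective (fderiv ℝ κ u) := by
    refine (injective_iff_map_eq_zero _).2 fun v hv => ?_
    rw [hκd.self_of_nhds] at hv
    have h1 := jinj _ hv
    have h2 : fderiv ℝ x u v = 0 := congrArg (fun j : (ℝ × (Fin (n + 1) → ℝ)) × ℝ => j.1.1) h1
    have h3 : ∀ i : Fin (n + 1), fderiv ℝ (y i) u v = 0 := fun i =>
      congrArg (fun j : (ℝ × (Fin (n + 1) → ℝ)) × ℝ => j.1.2 i) h1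
    have h4 : fderiv ℝ z u v = 0 := congrArg (fun j : (ℝ × (Fin (n + 1) → ℝ)) × ℝ => j.2) h1
    obtain ⟨c, rfl⟩ := Submodule.mem_span_singleton.1
      (hker v h2 fun k hk => h3 ⟨k, Nat.lt_succ_of_le hk⟩)
    rw [map_smul, h.self_of_nhds.2.2.2.2.2.1, smul_eq_mul, mul_one] at h4
    rw [h4, zero_smul]
  have hinv : (fderiv ℝ κ u).IsInvertible :=
    ⟨(LinearEquiv.ofInjectiveEndo (fderiv ℝ κ u).toLinearMap hinj).toContinuousLinearEquiv, by
      ext1 v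
      rfl⟩
  obtain ⟨e₀, he, hu, he1, he2, -⟩ := hκ.exists_localInverse hinv
  -- `X(Tz) = T(Xz) + [X, T] z`, where `Xz = 1` and `[X, T] = 0`.
  have hXT : ∀ᶠ q in 𝓝 u, fderiv ℝ (fun q => fderiv ℝ z q (T q)) q (X q) = 0 := by
    filter_upwards [hz.eventually, hX.eventually, hT.eventually, h.eventually_nhds]
      with q sz sX sT hq
    have h1 := fderiv_apply_lieBracket_of_smoothNear sz sX sT
    have h2 : (fun v => fderiv ℝ z v (X v)) =ᶠ[𝓝 q] fun _ => 1 :=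
      hq.mono fun v hv => hv.2.2.2.2.2.1
    rw [hq.self_of_nhds.2.2.2.2.2.2.2, map_zero, h2.fderiv_eq] at h1
    simpa using h1.symm
  have hzT : SmoothNear (fun q => fderiv ℝ z q (T q)) u := hz.fderiv_apply hT
  obtain ⟨s, hs, hso, hus⟩ := eventually_nhds_iff.1
    (((((((hκd.and hxX).and hyX).and hD).and h).and hXT).and hzT.eventually).and hO)
  set w₀ := e₀ u with hw₀
  have hW : e₀.target ∩ e₀.symm ⁻¹' s ∈ 𝓝 w₀ :=
    (e₀.isOpen_inter_preimage_symm hso).mem_nhds ⟨e₀.map_source hu, by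
      rwa [mem_preimage, e₀.left_inv hu]⟩
  have hW' : jetEmbed n ⁻¹' (e₀.target ∩ e₀.symm ⁻¹' s) ∈
      𝓝 (jetPart w₀, w₀ (Fin.last (n + 2))) :=
    (jetEmbed n).continuous.continuousAt.preimage_mem_nhds (by rwa [jetEmbed_jetPart])
  obtain ⟨ε, hε, hball⟩ := Metric.mem_nhds_iff.1 hW'
  rw [← ball_prod_same] at hball
  -- The chart is shrunk to a product of a ball in the jet space and an interval in `z`, so that a
  -- function with zero `z`-derivative descends to the ball.
  set Ω := Metric.ball (jetPart w₀) ε with hΩ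
  set t₀ := w₀ (Fin.last (n + 2)) with ht₀
  set W : Set (EuclideanSpace ℝ (Fin (n + 3))) :=
    {w | jetPart w ∈ Ω ∧ w (Fin.last (n + 2)) ∈ Metric.ball t₀ ε} with hWdef
  have hWo : IsOpen W :=
    (Metric.isOpen_ball.preimage (jetPartL n).continuous).inter (Metric.isOpen_ball.preimage
      (EuclideanSpace.proj (𝕜 := ℝ) (Fin.last (n + 2))).continuous)
  have hWsub : ∀ w ∈ W, w ∈ e₀.target ∧ e₀.symm w ∈ s := by
    intro w hw
    have h1 : jetEmbed n (jetPart w, w (Fin.last (n + 2))) ∈ e₀.target ∩ e₀.symm ⁻¹' s :=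
      hball ⟨hw.1, hw.2⟩
    rwa [jetEmbed_jetPart] at h1
  have hemb : ∀ j ∈ Ω, ∀ t ∈ Metric.ball t₀ ε, jetEmbed n (j, t) ∈ W := by
    intro j hj t ht
    refine ⟨?_, ?_⟩
    · rwa [jetPart_jetEmbed]
    · rwa [jetEmbed_apply_last]
  set g : EuclideanSpace ℝ (Fin (n + 3)) → ℝ := fun w =>
    fderiv ℝ z (e₀.symm w) (T (e₀.symm w)) with hg
  have hgs : ContDiffOn ℝ ∞ g W := by
    intro w hw
    have h1 := hWsub w hw
    exact ((hs _ h1.2).1.2.contDiffAt.comp w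
      (he2.contDiffAt (e₀.open_target.mem_nhds h1.1))).contDiffWithinAt
  have hgd : ∀ w ∈ W, fderiv ℝ g w (lastDir n) = 0 := by
    intro w hw
    obtain ⟨h1, h2⟩ := hWsub w hw
    obtain ⟨⟨⟨⟨⟨⟨⟨k1, k2⟩, k3⟩, k4⟩, k5⟩, k6⟩, k7⟩, k8⟩ := hs _ h2
    set q := e₀.symm w with hq
    have hqs : q ∈ e₀.source := e₀.map_target h1
    have hqw : e₀ q = w := e₀.right_inv h1
    have e1 : (fun q => fderiv ℝ z q (T q)) =ᶠ[𝓝 q] g ∘ e₀ := by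
      filter_upwards [e₀.open_source.mem_nhds hqs] with v hv
      simp [hg, e₀.left_inv hv]
    have e2 : HasFDerivAt (g ∘ e₀) ((fderiv ℝ g (e₀ q)).comp (fderiv ℝ e₀ q)) q :=
      ((hgs.contDiffAt (hWo.mem_nhds (by rwa [hqw]))).differentiableAt (by simp)).hasFDerivAt.comp q
        ((he1.contDiffAt (e₀.open_source.mem_nhds hqs)).differentiableAt (by simp)).hasFDerivAt
    have e3 : fderiv ℝ e₀ q (X q) = lastDir n := by
      rw [he, k1, k2, k5.2.2.2.2.2.1, ← jetEmbed_zero_one]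
      refine congrArg (fun j => jetEmbed n (j, 1)) (Prod.ext rfl (funext fun i => ?_))
      exact k3 i (Nat.le_of_lt_succ i.2)
    rw [e1.fderiv_eq, e2.fderiv, ContinuousLinearMap.comp_apply, e3, hqw] at k6
    exact k6
  set f : ℝ × (Fin (n + 1) → ℝ) → ℝ := fun j => g (jetEmbed n (j, t₀)) with hf
  -- The segments in the `z` direction are intervals contained in the domain, so `g` is constant
  -- along them and may be evaluated at `z = t₀`.
  have hgf : ∀ w ∈ W, g w = f (jetPart w) := by
    intro w hw
    have hd : ∀ t ∈ Metric.ball t₀ ε, HasDerivAt (fun t => g (jetEmbed n (jetPart w, t))) 0 t := by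
      intro t ht
      have e1 : HasDerivAt (fun t => jetEmbed n (jetPart w, t)) (lastDir n) t := by
        have e2 : HasDerivAt (fun t => jetEmbed n (jetPart w, t₀) + (t - t₀) • lastDir n)
            (lastDir n) t := by
          have := (((hasDerivAt_id t).sub_const t₀).smul_const (lastDir n)).const_add
            (jetEmbed n (jetPart w, t₀))
          rwa [one_smul] at this
        exact e2.congr_of_eventuallyEq (Filter.Eventually.of_forall fun t =>
          jetEmbed_add_smul_lastDir _ _ _)
      have hm := hemb _ hw.1 t ht
      have e3 := ((hgs.contDiffAt (hWo.mem_nhds hm)).differentiableAt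
        (by simp)).hasFDerivAt.comp_hasDerivAt t e1
      rwa [hgd _ hm] at e3
    have h1 := (convex_ball t₀ ε).is_const_of_fderivWithin_eq_zero (𝕜 := ℝ)
      (f := fun t => g (jetEmbed n (jetPart w, t)))
      (fun t ht => (hd t ht).differentiableAt.differentiableWithinAt) (fun t ht => by
        rw [fderivWithin_of_isOpen Metric.isOpen_ball ht, (hd t ht).hasFDerivAt.fderiv]
        simp) hw.2 (Metric.mem_ball_self hε)
    simp only [jetEmbed_jetPart] at h1
    exact h1
  have hesub : ∀ q ∈ e₀.source, e₀ q ∈ W → q ∈ s := fun q hq hqW => by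
    have := (hWsub _ hqW).2
    rwa [e₀.left_inv hq] at this
  refine ⟨e₀ ≫ₕ OpenPartialHomeomorph.ofSet W hWo, Ω, f, ?_, ?_, ?_, ?_, Metric.isOpen_ball, ?_,
    ?_, ?_, ?_⟩
  · exact ⟨hu, Metric.mem_ball_self hε, Metric.mem_ball_self hε⟩
  · exact fun q hq => (hs q (hesub q hq.1 hq.2)).2
  · exact he1.mono inter_subset_left
  · exact he2.mono fun w hw => hw.2
  · refine hgs.comp ((jetEmbed n).contDiff.comp (contDiff_id.prodMk contDiff_const)).contDiffOn ?_
    exact fun j hj => hemb j hj t₀ (Metric.mem_ball_self hε)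
  · exact fun q hq => hq.2.1
  · intro j hj
    have hm := hemb j hj t₀ (Metric.mem_ball_self hε)
    have h1 := hWsub _ hm
    refine ⟨e₀.symm (jetEmbed n (j, t₀)), ⟨e₀.map_target h1.1, ?_⟩, ?_⟩
    · change e₀ (e₀.symm _) ∈ W
      rwa [e₀.right_inv h1.1]
    · change jetPart (e₀ (e₀.symm _)) = j
      rw [e₀.right_inv h1.1, jetPart_jetEmbed]
  · intro q hq
    change (Submodule.span ℝ {A q, B q}).map (fderiv ℝ e₀ q).toLinearMap =
      Submodule.span ℝ {lagrangianField₁ f (e₀ q), lagrangianField₂ n}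
    have hqW : e₀ q ∈ W := hq.2
    obtain ⟨⟨⟨⟨⟨⟨⟨k1, k2⟩, k3⟩, k4⟩, k5⟩, k6⟩, k7⟩, k8⟩ := hs q (hesub q hq.1 hqW)
    obtain ⟨m1, m2, m3, m4, m5, m6, m7, m8⟩ := k5
    have hTm : T q ∈ Submodule.span ℝ {A q, B q} := m1 ▸ Submodule.subset_span (by simp)
    have hYm : Y q ∈ Submodule.span ℝ {A q, B q} := m1 ▸ Submodule.subset_span (by simp)
    have eT : fderiv ℝ e₀ q (T q) = lagrangianField₁ f (e₀ q) := by
      rw [lagrangianField₁_eq_jetEmbed (e₀ q) (a := fun i : Fin (n + 1) => fderiv ℝ (y i) q (T q))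
        (fun i => ?_) m3, he, k1, m2, ← he, ← hgf _ hqW]
      · simp only [hg]
        rw [e₀.left_inv hq.1]
      · rw [he, hκdef, jetPart_jetEmbed]
        refine (k4 _ hTm i i.2).trans ?_
        rw [m2, mul_one]
        rfl
    have eY : fderiv ℝ e₀ q (Y q) = lagrangianField₂ n := by
      rw [lagrangianField₂_eq_jetEmbed (a := fun i : Fin (n + 1) => fderiv ℝ (y i) q (Y q))
        (fun i => ?_) m5, he, k1, m4, m7]
      refine (k4 _ hYm i i.2).trans ?_
      rw [m4, mul_zero]
    rw [← m1, Submodule.map_span, image_pair]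
    exact congrArg₂ (fun a b => Submodule.span ℝ {a, b}) eT eY

end Coordinates

/-! ### Lifting frames along the quotient map -/

section LinearAlgebra

variable {F F' : Type} [AddCommGroup F] [Module ℝ F] [AddCommGroup F'] [Module ℝ F']

theorem finrank_eq_finrank_map_add_one [FiniteDimensional ℝ F] {L : F →ₗ[ℝ] F'} {S : Submodule ℝ F}
    {x : F} (hker : LinearMap.ker L = Submodule.span ℝ {x}) (hx : x ≠ 0) (hxS : x ∈ S) :
    finrank ℝ S = finrank ℝ (S.map L) + 1 := by
  have h1 := LinearMap.finrank_range_add_finrank_ker (L.domRestrict S)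
  rw [LinearMap.range_domRestrict] at h1
  have h2 : LinearMap.ker (L.domRestrict S) = Submodule.span ℝ {(⟨x, hxS⟩ : S)} := by
    ext v
    rw [LinearMap.mem_ker, LinearMap.domRestrict_apply, ← LinearMap.mem_ker, hker,
      Submodule.mem_span_singleton, Submodule.mem_span_singleton]
    exact exists_congr fun c => ⟨fun h => Subtype.ext h, fun h => congrArg Subtype.val h⟩
  have h3 : finrank ℝ (Submodule.span ℝ {(⟨x, hxS⟩ : S)}) = 1 :=
    finrank_span_singleton fun h => hx (congrArg Subtype.val h)
  rw [h2, h3] at h1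
  exact h1.symm

theorem linearIndependent_pair_of_span_eq {a b c d : F}
    (h : Submodule.span ℝ {a, b} = Submodule.span ℝ {c, d}) (hcd : LinearIndependent ℝ ![c, d]) :
    LinearIndependent ℝ ![a, b] := by
  have hr : ∀ a b : F, range ![a, b] = {a, b} := fun a b => by
    rw [Matrix.range_cons, Matrix.range_cons, Matrix.range_empty, union_empty]
    rfl
  have h1 := finrank_span_eq_card hcd
  rw [linearIndependent_iff_card_eq_finrank_span, Set.finrank, hr, h, ← hr, h1]

theorem span_pair_eq_of_linearIndependent {a b c d : F} (hab : LinearIndependent ℝ ![a, b])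
    (ha : a ∈ Submodule.span ℝ {c, d}) (hb : b ∈ Submodule.span ℝ {c, d}) :
    Submodule.span ℝ {a, b} = Submodule.span ℝ {c, d} := by
  classical
  have h1 := finrank_span_eq_card hab
  rw [Matrix.range_cons, Matrix.range_cons, Matrix.range_empty, union_empty, Fintype.card_fin] at h1
  replace h1 : finrank ℝ (Submodule.span ℝ {a, b}) = 2 := h1
  have h2 : finrank ℝ (Submodule.span ℝ ((({c, d} : Finset F) : Set F))) ≤ 2 :=
    (finrank_span_finset_le_card _).trans Finset.card_le_two
  rw [Finset.coe_pair] at h2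
  have : FiniteDimensional ℝ (Submodule.span ℝ ({c, d} : Set F)) :=
    FiniteDimensional.span_of_finite ℝ (toFinite _)
  refine Submodule.eq_of_le_of_finrank_le ?_ (by rw [h1]; exact h2)
  rw [Submodule.span_le]
  rintro _ (rfl | rfl) <;> assumption

end LinearAlgebra

section Lift

open VectorField RankTwoDistribution

variable {d e : ℕ} {M N : Type*} [TopologicalSpace M] [ChartedSpace (EuclideanSpace ℝ (Fin d)) M]
  [IsManifold (𝓡 d) ∞ M] [TopologicalSpace N] [ChartedSpace (EuclideanSpace ℝ (Fin e)) N]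
  [IsManifold (𝓡 e) ∞ N] {D : RankTwoDistribution d M} {E : RankTwoDistribution e N} {U : Set M}
  {π : M → N} {φ : OpenPartialHomeomorph M (EuclideanSpace ℝ (Fin d))}
  {ψ : OpenPartialHomeomorph N (EuclideanSpace ℝ (Fin e))} {s : Set (EuclideanSpace ℝ (Fin d))}
  {s' : Set (EuclideanSpace ℝ (Fin e))}
  {A B : EuclideanSpace ℝ (Fin d) → EuclideanSpace ℝ (Fin d)}
  {A' B' : EuclideanSpace ℝ (Fin e) → EuclideanSpace ℝ (Fin e)}

theorem RankTwoDistribution.IsFrameIn.span_pair_comp_charts (h : D.IsFrameIn φ s A B)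
    (h' : E.IsFrameIn ψ s' A' B') (hU : IsOpen U) (hπ : ContMDiffOn (𝓡 d) (𝓡 e) ∞ π U)
    (hDE : ∀ q ∈ U, (D.fiber q).map (mfderiv (𝓡 d) (𝓡 e) π q).toLinearMap = E.fiber (π q))
    {q : M} (hq : q ∈ U ∩ π ⁻¹' ψ.source ∩ φ.source) (hqs : φ q ∈ s) (hqs' : ψ (π q) ∈ s') :
    Submodule.span ℝ {fderiv ℝ (ψ ∘ π ∘ φ.symm) (φ q) (A (φ q)),
      fderiv ℝ (ψ ∘ π ∘ φ.symm) (φ q) (B (φ q))} =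
      Submodule.span ℝ {A' (ψ (π q)), B' (ψ (π q))} := by
  have hlift : ∀ w, ∃ v : TangentSpace (𝓡 d) q, chartDeriv φ q v = w :=
    (chartDeriv_bijective h.mem hq.2).2
  apply le_antisymm
  · rw [Submodule.span_le]
    have key : ∀ w ∈ Submodule.span ℝ {A (φ q), B (φ q)},
        fderiv ℝ (ψ ∘ π ∘ φ.symm) (φ q) w ∈ Submodule.span ℝ {A' (ψ (π q)), B' (ψ (π q))} := by
      intro w hw
      obtain ⟨v, rfl⟩ := hlift w
      rw [fderiv_comp_charts hU hπ h.mem h'.mem hq, h'.chartDeriv_mem_span_iff hq.1.2 hqs',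
        ← hDE q hq.1.1]
      exact Submodule.mem_map_of_mem ((h.chartDeriv_mem_span_iff hq.2 hqs).1 hw)
    rintro _ (rfl | rfl) <;> exact key _ (Submodule.subset_span (by simp))
  · have key : ∀ w ∈ Submodule.span ℝ {A' (ψ (π q)), B' (ψ (π q))},
        w ∈ Submodule.span ℝ {fderiv ℝ (ψ ∘ π ∘ φ.symm) (φ q) (A (φ q)),
          fderiv ℝ (ψ ∘ π ∘ φ.symm) (φ q) (B (φ q))} := by
      intro w hw
      obtain ⟨v', rfl⟩ : ∃ v' : TangentSpace (𝓡 e) (π q), chartDeriv ψ (π q) v' = w :=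
        (chartDeriv_bijective h'.mem hq.1.2).2 w
      rw [h'.chartDeriv_mem_span_iff hq.1.2 hqs', ← hDE q hq.1.1] at hw
      obtain ⟨v, hv, rfl⟩ := hw
      have h1 := fderiv_comp_charts hU hπ h.mem h'.mem hq v
      have h2 := (h.chartDeriv_mem_span_iff hq.2 hqs).2 hv
      obtain ⟨a, b, hab⟩ := Submodule.mem_span_pair.1 h2
      rw [← hab, map_add, map_smul, map_smul] at h1
      exact Submodule.mem_span_pair.2 ⟨a, b, h1⟩
    exact fun w hw => key w hw

/-- A local frame of the image distribution lifts to a local frame of `D`. -/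
theorem exists_isFrameIn_related (h' : E.IsFrameIn ψ s' A' B') (hU : IsOpen U)
    (hπ : ContMDiffOn (𝓡 d) (𝓡 e) ∞ π U)
    (hDE : ∀ q ∈ U, (D.fiber q).map (mfderiv (𝓡 d) (𝓡 e) π q).toLinearMap = E.fiber (π q))
    (hφ : φ ∈ IsManifold.maximalAtlas (𝓡 d) ∞ M) {p : M}
    (hp : p ∈ U ∩ π ⁻¹' ψ.source ∩ φ.source) (hps : ψ (π p) ∈ s') :
    ∃ s T₁ T₂, φ p ∈ s ∧ D.IsFrameIn φ s T₁ T₂ ∧ ∀ u ∈ s,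
      φ.symm u ∈ U ∩ π ⁻¹' ψ.source ∩ φ.source ∧ (ψ ∘ π ∘ φ.symm) u ∈ s' ∧
      fderiv ℝ (ψ ∘ π ∘ φ.symm) u (T₁ u) = A' ((ψ ∘ π ∘ φ.symm) u) ∧
      fderiv ℝ (ψ ∘ π ∘ φ.symm) u (T₂ u) = B' ((ψ ∘ π ∘ φ.symm) u) := by
  obtain ⟨s, A, B, hpsA, h⟩ := D.exists_isFrameIn hφ hp.2
  set P := ψ ∘ π ∘ φ.symm with hPdef
  have hP : SmoothNear P (φ p) := smoothNear_comp_charts hU hπ hφ h'.mem hp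
  have hPp : P (φ p) = ψ (π p) := by simp [hPdef, φ.left_inv hp.2]
  have hPs : P (φ p) ∈ s' := by rwa [hPp]
  have hO := isOpen_chart_domain hU hπ.continuousOn φ ψ
  have hdom : ∀ᶠ u in 𝓝 (φ p), u ∈ s ∧ φ.symm u ∈ U ∩ π ⁻¹' ψ.source ∩ φ.source :=
    h.eventually_symm_mem hO hpsA (by rwa [φ.left_inv hp.2])
  have hs' : ∀ᶠ u in 𝓝 (φ p), P u ∈ s' := hP.continuousAt.preimage_mem_nhds (h'.isOpen.mem_nhds hPs)
  have hspan : ∀ᶠ u in 𝓝 (φ p), Submodule.span ℝ {fderiv ℝ P u (A u), fderiv ℝ P u (B u)} =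
      Submodule.span ℝ {A' (P u), B' (P u)} := by
    filter_upwards [hdom, hs'] with u hu hu'
    have h1 := h.span_pair_comp_charts h' hU hπ hDE hu.2
    rw [φ.right_inv (h.subset hu.1)] at h1
    exact h1 hu.1 hu'
  have sA := h.smoothNear hpsA A (by simp)
  have sB := h.smoothNear hpsA B (by simp)
  have sA' := h'.smoothNear hPs A' (by simp)
  have sB' := h'.smoothNear hPs B' (by simp)
  have hli := linearIndependent_pair_of_span_eq hspan.self_of_nhds (h'.linearIndependent _ hPs)
  obtain ⟨T₁, sT₁, -, hT₁⟩ := exists_lift (C := fun u => A' (P u)) sA sB hP.fderiv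
    (SmoothNear.comp sA' hP) hli (by
      filter_upwards [hspan] with u hu
      rw [hu]
      exact Submodule.subset_span (by simp))
  obtain ⟨T₂, sT₂, -, hT₂⟩ := exists_lift (C := fun u => B' (P u)) sA sB hP.fderiv
    (SmoothNear.comp sB' hP) hli (by
      filter_upwards [hspan] with u hu
      rw [hu]
      exact Submodule.subset_span (by simp))
  obtain ⟨s₁, h1, ho, hp1⟩ := eventually_nhds_iff.1
    (((((hdom.and hs').and hT₁).and hT₂).and sT₁).and sT₂)
  have hliT : ∀ u ∈ s₁, LinearIndependent ℝ ![T₁ u, T₂ u] := by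
    intro u hu
    obtain ⟨⟨⟨⟨⟨k1, k2⟩, k3⟩, k4⟩, k5⟩, k6⟩ := h1 u hu
    have k7 := h'.linearIndependent _ k2
    rw [LinearIndependent.pair_iff] at k7 ⊢
    intro a b hab
    have := congrArg (fderiv ℝ P u) hab
    rw [map_add, map_smul, map_smul, map_zero, k3.2, k4.2] at this
    exact k7 a b this
  refine ⟨s₁, T₁, T₂, hp1, ⟨hφ, ho, fun u hu => h.subset (h1 u hu).1.1.1.1.1.1,
    fun u hu => (h1 u hu).1.2.contDiffWithinAt, fun u hu => (h1 u hu).2.contDiffWithinAt, hliT,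
    fun u hu => ?_⟩, fun u hu => ?_⟩
  · obtain ⟨⟨⟨⟨⟨k1, k2⟩, k3⟩, k4⟩, k5⟩, k6⟩ := h1 u hu
    rw [h.map_fiber u k1.1]
    exact (span_pair_eq_of_linearIndependent (hliT u hu) k3.1 k4.1).symm
  · obtain ⟨⟨⟨⟨⟨k1, k2⟩, k3⟩, k4⟩, k5⟩, k6⟩ := h1 u hu
    exact ⟨k1.2, k2, k3.2, k4.2⟩

end Lift

/-! ### From Goursat quotients to Lagrangians -/

section ToLagrangian

open VectorField RankTwoDistribution

theorem RankTwoDistribution.isFrameIn_lagrangianFields {n : ℕ} {M : Type*} [TopologicalSpace M]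
    [ChartedSpace (EuclideanSpace ℝ (Fin (n + 3))) M] [IsManifold (𝓡 (n + 3)) ∞ M]
    {D : RankTwoDistribution (n + 3) M} {Ω : Set (ℝ × (Fin (n + 1) → ℝ))}
    {f : ℝ × (Fin (n + 1) → ℝ) → ℝ} (hΩ : IsOpen Ω) (hf : ContDiffOn ℝ ∞ f Ω)
    {φ : OpenPartialHomeomorph M (EuclideanSpace ℝ (Fin (n + 3)))}
    (hφ : φ ∈ IsManifold.maximalAtlas (𝓡 (n + 3)) ∞ M)
    (h : ∀ q ∈ φ.source, jetPart (φ q) ∈ Ω ∧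
        (D.fiber q).map (chartDeriv φ q).toLinearMap =
          Submodule.span ℝ {lagrangianField₁ f (φ q), lagrangianField₂ n}) :
    D.IsFrameIn φ φ.target (lagrangianField₁ f) (fun _ => lagrangianField₂ n) := by
  refine ⟨hφ, φ.open_target, Subset.rfl, fun u hu => ?_, contDiffOn_const,
    fun u _ => linearIndependent_lagrangianFields u, fun u hu => ?_⟩
  · have h1 := (h _ (φ.map_target hu)).1
    rw [φ.right_inv hu] at h1
    exact (smoothNear_lagrangianField₁
      (hf.smoothNear (hΩ.mem_nhds h1))).contDiffAt.contDiffWithinAt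
  · have h1 := (h _ (φ.map_target hu)).2
    rw [φ.right_inv hu] at h1
    exact h1

variable {n : ℕ} {M N : Type*} [TopologicalSpace M]
  [ChartedSpace (EuclideanSpace ℝ (Fin (n + 3))) M]
  [IsManifold (𝓡 (n + 3)) ∞ M] [TopologicalSpace N] [ChartedSpace (EuclideanSpace ℝ (Fin (n + 2))) N]
  [IsManifold (𝓡 (n + 2)) ∞ N] {D : RankTwoDistribution (n + 3) M}
  {E : RankTwoDistribution (n + 2) N} {U : Set M} {X : VField (n + 3) M}
  {π : M → N} {φ : OpenPartialHomeomorph M (EuclideanSpace ℝ (Fin (n + 3)))}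
  {ψ : OpenPartialHomeomorph N (EuclideanSpace ℝ (Fin (n + 2)))}
  {s : Set (EuclideanSpace ℝ (Fin (n + 3)))} {s' : Set (EuclideanSpace ℝ (Fin (n + 2)))}
  {A B : EuclideanSpace ℝ (Fin (n + 3)) → EuclideanSpace ℝ (Fin (n + 3))}
  {A' B' : EuclideanSpace ℝ (Fin (n + 2)) → EuclideanSpace ℝ (Fin (n + 2))}

/-- The small growth vector of a Goursat quotient is locally constant at the image of a generic
point. -/
theorem eventually_finrank_wordSpan_of_related [T2Space M] (hn : 1 ≤ n) (hE : E.IsGoursat)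
    (hπ : IsQuotientByIntegralCurves (e := n + 2) X U π) (hU : IsOpen U) (hX : X.SmoothOn U)
    (hX3 : ∀ q ∈ U, X q ∈ D.derivedFlag 3 q)
    (h : D.IsFrameIn φ s A B) (h' : E.IsFrameIn ψ s' A' B')
    (hrel : ∀ u ∈ s, φ.symm u ∈ U ∩ π ⁻¹' ψ.source ∩ φ.source ∧ (ψ ∘ π ∘ φ.symm) u ∈ s' ∧
      fderiv ℝ (ψ ∘ π ∘ φ.symm) u (A u) = A' ((ψ ∘ π ∘ φ.symm) u) ∧
      fderiv ℝ (ψ ∘ π ∘ φ.symm) u (B u) = B' ((ψ ∘ π ∘ φ.symm) u))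
    {p : M} (hpg : p ∈ D.genericPoints) (hp : p ∈ φ.source) (hps : φ p ∈ s) (i : ℕ) :
    ∀ᶠ v in 𝓝 ((ψ ∘ π ∘ φ.symm) (φ p)), finrank ℝ (wordSpan {A', B'} i v) =
      finrank ℝ (wordSpan {A', B'} i ((ψ ∘ π ∘ φ.symm) (φ p))) := by
  have hPs := (hrel _ hps).2.1
  have hs' := h'.isOpen.mem_nhds hPs
  match i with
  | 0 =>
    have h0 : ∀ v, wordSpan {A', B'} 0 v = ⊥ := fun v => by simp [wordSpan, bracketWords]
    exact Filter.Eventually.of_forall fun v => by rw [h0, h0]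
  | 1 =>
    filter_upwards [hs'] with v hv
    rw [h'.finrank_wordSpan_one hv, h'.finrank_wordSpan_one hPs]
  -- The second term coincides with the second Lie square, whose rank is `3` by the Goursat
  -- condition.
  | 2 =>
    have key : ∀ v ∈ s', finrank ℝ (wordSpan {A', B'} 2 v) = 3 := by
      intro v hv
      have h1 := h'.finrank_derivedFlag 2 (ψ.map_target (h'.subset hv))
        (by rwa [ψ.right_inv (h'.subset hv)])
      rw [ψ.right_inv (h'.subset hv)] at h1
      rw [← h1, derivedFlag_two]
      exact hE 2 (by omega) (by omega) _
    filter_upwards [hs'] with v hv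
    rw [key v hv, key _ hPs]
  | i + 3 =>
    set P := ψ ∘ π ∘ φ.symm with hP
    -- From the third term on, the flag contains `X`, which spans the kernel of the projection; the
    -- projection therefore lowers the rank by exactly one.
    have hrank : ∀ u ∈ s, finrank ℝ (wordSpan {A, B} (i + 3) u) =
        finrank ℝ (wordSpan {A', B'} (i + 3) (P u)) + 1 := by
      intro u hu
      have hu1 := (hrel u hu).1
      have hut := h.subset hu
      have sP := smoothNear_comp_charts hU hπ.smooth h.mem h'.mem hu1
      obtain ⟨k1, -, k3⟩ := hπ.ker_fderiv_comp_charts rfl hU hX h.mem h'.mem hu1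
      have k4 : chartDeriv φ (φ.symm u) (X (φ.symm u)) ∈
          wordSpan {A, B} (i + 3) (φ (φ.symm u)) := by
        rw [← h.map_derivedFlag (i + 3) hu1.2 (by rwa [φ.right_inv hut])]
        exact Submodule.mem_map_of_mem
          (D.derivedFlag_mono _ (show 3 ≤ i + 3 by omega) (hX3 _ hu1.1.1))
      have k5 := finrank_eq_finrank_map_add_one k1 k3 k4
      rw [φ.right_inv hut] at k5 sP
      rw [k5, map_wordSpan_of_related sP (h.smoothNear hu A (by simp)) (h.smoothNear hu B (by simp))
        (h'.smoothNear (hrel u hu).2.1 A' (by simp)) (h'.smoothNear (hrel u hu).2.1 B' (by simp))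
        (by filter_upwards [h.isOpen.mem_nhds hu] with v hv using (hrel v hv).2.2.1)
        (by filter_upwards [h.isOpen.mem_nhds hu] with v hv using (hrel v hv).2.2.2)]
    obtain ⟨V, hV, hpV, hVr⟩ := hpg
    have hconst : ∀ᶠ u in 𝓝 (φ p), finrank ℝ (wordSpan {A', B'} (i + 3) (P u)) =
        finrank ℝ (wordSpan {A', B'} (i + 3) (P (φ p))) := by
      filter_upwards [h.eventually_symm_mem hV hps (by rwa [φ.left_inv hp])] with u hu
      have h1 := hVr (i + 3) _ hu.2
      rw [h.finrank_derivedFlag _ hp hps, h.finrank_derivedFlag _ (φ.map_target (h.subset hu.1))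
        (by rw [φ.right_inv (h.subset hu.1)]; exact hu.1), φ.right_inv (h.subset hu.1),
        hrank _ hu.1, hrank _ hps] at h1
      omega
    have hp1 := (hrel _ hps).1
    rw [φ.left_inv hp] at hp1
    have sP : SmoothNear P (φ p) := smoothNear_comp_charts hU hπ.smooth h.mem h'.mem hp1
    -- A submersion maps neighbourhoods onto neighbourhoods, so local constancy upstairs descends to
    -- the quotient.
    have hmap : Filter.map P (𝓝 (φ p)) = 𝓝 (P (φ p)) :=
      (sP.contDiffAt.hasStrictFDerivAt (by simp)).map_nhds_eq_of_surj
        (hπ.ker_fderiv_comp_charts rfl hU hX h.mem h'.mem hp1).2.1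
    rw [← hmap]
    exact hconst

/-- Jet coordinates of the quotient are pulled back along `π` and completed by a coordinate `z`
along the symmetry. The dimension of `D^3` is used only at the end, for the nondegeneracy of the
resulting Lagrangian. -/
theorem isLagrangianNear_of_isGoursat [T2Space M] (hn : 2 ≤ n) {p : M} (hpg : p ∈ D.genericPoints)
    (hU : IsOpen U) (hpU : p ∈ U) (h5 : ∀ q ∈ U, finrank ℝ (D.derivedFlag 3 q) = 5)
    (hX : D.IsInfinitesimalSymmetryOn U X) (hX3 : ∀ q ∈ U, X q ∈ D.derivedFlag 3 q)
    (hπ : IsQuotientByIntegralCurves (e := n + 2) X U π)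
    (hDE : ∀ q ∈ U,
      (D.fiber q).map (mfderiv (𝓡 (n + 3)) (𝓡 (n + 2)) π q).toLinearMap = E.fiber (π q))
    (hE : E.IsGoursat) : IsLagrangianNear D p := by
  have hφ : chartAt (EuclideanSpace ℝ (Fin (n + 3))) p ∈ IsManifold.maximalAtlas (𝓡 (n + 3)) ∞ M :=
    IsManifold.chart_mem_maximalAtlas p
  have hψ : chartAt (EuclideanSpace ℝ (Fin (n + 2))) (π p) ∈
      IsManifold.maximalAtlas (𝓡 (n + 2)) ∞ N := IsManifold.chart_mem_maximalAtlas (π p)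
  have hpφ := mem_chart_source (EuclideanSpace ℝ (Fin (n + 3))) p
  have hpψ := mem_chart_source (EuclideanSpace ℝ (Fin (n + 2))) (π p)
  set φ := chartAt (EuclideanSpace ℝ (Fin (n + 3))) p
  set ψ := chartAt (EuclideanSpace ℝ (Fin (n + 2))) (π p)
  have hp : p ∈ U ∩ π ⁻¹' ψ.source ∩ φ.source := ⟨⟨hpU, hpψ⟩, hpφ⟩
  obtain ⟨s', A', B', hps', h'⟩ := E.exists_isFrameIn hψ hpψ
  obtain ⟨s, A, B, hps, h, hrel⟩ := exists_isFrameIn_related h' hU hπ.smooth hDE hφ hp hps'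
  have hc := eventually_finrank_wordSpan_of_related (by omega) hE hπ hU hX.1 hX3 h h' hrel hpg hpφ
    hps
  obtain ⟨g, hg, hgs⟩ := h'.exists_isGoursatFrame hn hE (hrel _ hps).2.1 hc
  obtain ⟨x', y', sx', sy', hxy, hjet⟩ := hg.exists_jet_coordinates (by omega)
  set P := ψ ∘ π ∘ φ.symm with hPdef
  set X₀ := pushField φ X with hX₀
  have sP : SmoothNear P (φ p) := smoothNear_comp_charts hU hπ.smooth hφ hψ hp
  have hkerP : ∀ u ∈ s, LinearMap.ker (fderiv ℝ P u).toLinearMap = Submodule.span ℝ {X₀ u} ∧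
      X₀ u ≠ 0 := by
    intro u hu
    obtain ⟨k1, -, k3⟩ := hπ.ker_fderiv_comp_charts rfl hU hX.1 hφ hψ (hrel u hu).1
    rw [φ.right_inv (h.subset hu)] at k1
    exact ⟨k1, k3⟩
  have hPX : ∀ u ∈ s, fderiv ℝ P u (X₀ u) = 0 := by
    intro u hu
    have : X₀ u ∈ LinearMap.ker (fderiv ℝ P u).toLinearMap := by
      rw [(hkerP u hu).1]
      exact Submodule.mem_span_singleton_self _
    exact this
  have hsn : ∀ᶠ u in 𝓝 (φ p), u ∈ s := h.isOpen.mem_nhds hps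
  have hcomp : ∀ {a : EuclideanSpace ℝ (Fin (n + 2)) → ℝ}, SmoothNear a (P (φ p)) →
      ∀ᶠ u in 𝓝 (φ p), ∀ v, fderiv ℝ (fun u => a (P u)) u v =
        fderiv ℝ a (P u) (fderiv ℝ P u v) := by
    intro a ha
    filter_upwards [sP.eventually, sP.continuousAt.eventually ha.eventually] with u h1 h2 v
    have h3 : HasFDerivAt (fun u => a (P u)) _ u := h2.hasFDerivAt.comp u h1.hasFDerivAt
    rw [h3.fderiv]
    rfl
  have hcompy : ∀ᶠ u in 𝓝 (φ p), ∀ k : Fin (n + 1), ∀ v, fderiv ℝ (fun u => y' k (P u)) u v =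
        fderiv ℝ (y' k) (P u) (fderiv ℝ P u v) := Filter.eventually_all.2 fun k => hcomp (sy' k)
  have sX : SmoothNear X₀ (φ p) := smoothNear_pushField hφ hU hX.1 hpφ hpU
  have sA := h.smoothNear hps A (by simp)
  have sB := h.smoothNear hps B (by simp)
  -- The projection kills `X` but carries the frame of `D` to an independent pair.
  have hXD : X₀ (φ p) ∉ Submodule.span ℝ {A (φ p), B (φ p)} := by
    intro hmem
    obtain ⟨a, b, hab⟩ := Submodule.mem_span_pair.1 hmem
    have h1 := hPX _ hps
    rw [← hab, map_add, map_smul, map_smul, (hrel _ hps).2.2.1, (hrel _ hps).2.2.2] at h1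
    obtain ⟨rfl, rfl⟩ := LinearIndependent.pair_iff.1
      (h'.linearIndependent _ (hrel _ hps).2.1) a b h1
    rw [zero_smul, zero_smul, add_zero] at hab
    exact (hkerP _ hps).2 hab.symm
  have hxX : ∀ᶠ u in 𝓝 (φ p), fderiv ℝ (fun u => x' (P u)) u (X₀ u) = 0 := by
    filter_upwards [hcomp sx', hsn] with u h1 h2
    rw [h1, hPX u h2, map_zero]
  have hyX : ∀ᶠ u in 𝓝 (φ p), ∀ k ≤ n, fderiv ℝ (fun u => y' k (P u)) u (X₀ u) = 0 := by
    filter_upwards [hcompy, hsn] with u h1 h2 k hk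
    rw [h1 ⟨k, Nat.lt_succ_of_le hk⟩, hPX u h2, map_zero]
  have hker : ∀ v, fderiv ℝ (fun u => x' (P u)) (φ p) v = 0 →
      (∀ k ≤ n, fderiv ℝ (fun u => y' k (P u)) (φ p) v = 0) → v ∈ Submodule.span ℝ {X₀ (φ p)} := by
    intro v hv hvk
    rw [← (hkerP _ hps).1]
    refine hxy _ ?_ fun k hk => ?_
    · exact ((hcomp sx').self_of_nhds v).symm.trans hv
    · have := hcompy.self_of_nhds ⟨k, Nat.lt_succ_of_le hk⟩ v
      exact this.symm.trans (hvk k hk)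
  have hD : ∀ᶠ u in 𝓝 (φ p), ∀ v ∈ Submodule.span ℝ {A u, B u}, ∀ k < n,
      fderiv ℝ (fun u => y' k (P u)) u v =
        y' (k + 1) (P u) * fderiv ℝ (fun u => x' (P u)) u v := by
    filter_upwards [hcomp sx', hcompy, hsn, sP.continuousAt.eventually hjet] with u h1 h2 h3 h4 v hv
      k hk
    have h6 : fderiv ℝ P u v ∈ Submodule.span ℝ {g 0 (P u), g 1 (P u)} := by
      rw [hgs]
      obtain ⟨a, b, rfl⟩ := Submodule.mem_span_pair.1 hv
      rw [map_add, map_smul, map_smul, (hrel u h3).2.2.1, (hrel u h3).2.2.2]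
      exact Submodule.mem_span_pair.2 ⟨a, b, rfl⟩
    rw [h1, ← h4 _ h6 k hk]
    exact h2 ⟨k, by omega⟩ v
  have hsym : ∀ W ∈ ({A, B} : Set _), ∀ᶠ u in 𝓝 (φ p),
      lieBracket ℝ X₀ W u ∈ Submodule.span ℝ {A u, B u} := by
    intro W hW
    filter_upwards [hsn] with u hu
    have hO : IsOpen (U ∩ (φ.source ∩ φ ⁻¹' s)) := hU.inter (φ.isOpen_inter_preimage h.isOpen)
    have hut := h.subset hu
    have hq : φ.symm u ∈ U ∩ (φ.source ∩ φ ⁻¹' s) :=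
      ⟨(hrel u hu).1.1.1, (hrel u hu).1.2, by rwa [mem_preimage, φ.right_inv hut]⟩
    have hsec := h.isSectionOn_pullField W hW
    have hsec' : D.IsSectionOn (U ∩ (φ.source ∩ φ ⁻¹' s)) (pullField φ W) :=
      ⟨fun x hx => (hsec.1 x hx.2).mono inter_subset_right, fun x hx => hsec.2 x hx.2⟩
    have h1 := hX.2 _ hO inter_subset_left _ hsec' _ hq
    rw [← h.chartDeriv_mem_span_iff hq.2.1 hq.2.2] at h1
    have h2 := pushField_mlieBracket hφ hO (fun x hx => (hX.1 x hx.1).mono inter_subset_left)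
      hsec'.1 hut hq
    have h3 : lieBracket ℝ X₀ (pushField φ (pullField φ W)) u = lieBracket ℝ X₀ W u := by
      refine Filter.EventuallyEq.lieBracket_vectorField_eq (Filter.EventuallyEq.refl _ _) ?_
      filter_upwards [h.isOpen.mem_nhds hu] with v hv
      exact pushField_pullField hφ W (h.subset hv)
    rw [← h3, ← h2]
    rw [φ.right_inv hut] at h1
    exact h1
  have sx : SmoothNear (fun u => x' (P u)) (φ p) := SmoothNear.comp sx' sP
  have sy : ∀ k, SmoothNear (fun u => y' k (P u)) (φ p) := fun k => SmoothNear.comp (sy' k) sP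
  obtain ⟨T, Y, z, sT, sY, sz, hTY⟩ := exists_adapted_frame (n := n) (y := fun k u => y' k (P u))
    sA sB sX sx sy (h.linearIndependent _ hps) hXD hxX hyX hker hD (hsym A (by simp))
    (hsym B (by simp))
  obtain ⟨e, Ω, f, he, heO, he1, he2, hΩ, hf, hjΩ, hΩj, hspan⟩ := exists_lagrangian_chart
    (y := fun k u => y' k (P u)) sX sT sx sy sz hxX hyX hker hD hTY (h.isOpen.mem_nhds hps)
  have hφ' := trans_mem_maximalAtlas hφ he1 he2
  have hfib : ∀ q ∈ (φ ≫ₕ e).source, jetPart ((φ ≫ₕ e) q) ∈ Ω ∧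
      (D.fiber q).map (chartDeriv (φ ≫ₕ e) q).toLinearMap =
        Submodule.span ℝ {lagrangianField₁ f ((φ ≫ₕ e) q), lagrangianField₂ n} := by
    intro q hq
    rw [φ.trans_source] at hq
    refine ⟨hjΩ _ hq.2, ?_⟩
    have h1 : ∀ v, chartDeriv (φ ≫ₕ e) q v = fderiv ℝ e (φ q) (chartDeriv φ q v) := by
      intro v
      have k1 : MDifferentiableAt (𝓡 (n + 3)) (𝓡 (n + 3)) φ q :=
        (mdifferentiable_of_mem_maximalAtlas hφ).mdifferentiableAt hq.1
      have k2 : MDifferentiableAt (𝓡 (n + 3)) (𝓡 (n + 3)) e (φ q) :=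
        ((he1.contDiffAt (e.open_source.mem_nhds hq.2)).differentiableAt
          (by simp)).mdifferentiableAt
      have k3 : mfderiv (𝓡 (n + 3)) (𝓡 (n + 3)) e (φ q) = fderiv ℝ e (φ q) := mfderiv_eq_fderiv
      have k4 := DFunLike.congr_fun (mfderiv_comp q k2 k1) v
      exact k4.trans (DFunLike.congr_fun k3 (chartDeriv φ q v))
    have hqs := heO hq.2
    have h2 := hspan _ hq.2
    change _ = Submodule.span ℝ {lagrangianField₁ f (e (φ q)), lagrangianField₂ n}
    rw [← h2]
    have h3 := h.map_fiber _ hqs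
    rw [φ.left_inv hq.1] at h3
    rw [← h3]
    apply le_antisymm
    · rintro _ ⟨v, hv, rfl⟩
      exact ⟨chartDeriv φ q v, ⟨v, hv, rfl⟩, (h1 v).symm⟩
    · rintro _ ⟨_, ⟨v, hv, rfl⟩, rfl⟩
      exact ⟨v, hv, h1 v⟩
  -- Every jet in `Ω` comes from a point of the chart domain, which projects back into `U`; if the
  -- second derivative vanished there, `D^3` would have dimension at most four.
  refine ⟨Ω, f, hΩ, hf, fun j hj h0 => ?_, φ ≫ₕ e, hφ', ⟨hpφ, he⟩, hfib⟩
  obtain ⟨u, hu, rfl⟩ := hΩj j hj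
  have hus := heO hu
  have hq : φ.symm u ∈ (φ ≫ₕ e).source := by
    rw [φ.trans_source]
    exact ⟨(hrel u hus).1.2, by rwa [mem_preimage, φ.right_inv (h.subset hus)]⟩
  have hfr := isFrameIn_lagrangianFields hΩ hf hφ' hfib
  have h1 := hfr.finrank_derivedFlag 3 hq ((φ ≫ₕ e).map_source hq)
  have h2 : (φ ≫ₕ e) (φ.symm u) = e u := congrArg e (φ.right_inv (h.subset hus))
  rw [h5 _ (hrel u hus).1.1.1, h2] at h1
  have h3 := finrank_wordSpan_lagrangianField_le (hf.smoothNear (hΩ.mem_nhds hj)) h0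
  omega

end ToLagrangian

/-! ### The contact distribution on the jet space -/

section Contact

open VectorField RankTwoDistribution

variable {n : ℕ}

/-- The linear part `∑ y_{i+1} ∂/∂y_i` of the total derivative on the jet space. -/
def contactShift (n : ℕ) : EuclideanSpace ℝ (Fin (n + 2)) →L[ℝ] EuclideanSpace ℝ (Fin (n + 2)) :=
  LinearMap.toContinuousLinearMap
    { toFun := fun v => WithLp.toLp 2 fun k : Fin (n + 2) =>
        if h : 1 ≤ k.val ∧ k.val ≤ n then v ⟨k.val + 1, by omega⟩ else 0
      map_add' := fun v w => by
        ext k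
        by_cases h : 1 ≤ k.val ∧ k.val ≤ n <;> simp [h]
      map_smul' := fun c v => by
        ext k
        by_cases h : 1 ≤ k.val ∧ k.val ≤ n <;> simp [h] }

theorem contactShift_apply (v : EuclideanSpace ℝ (Fin (n + 2))) (k : Fin (n + 2)) :
    contactShift n v k = if h : 1 ≤ k.val ∧ k.val ≤ n then v ⟨k.val + 1, by omega⟩ else 0 := rfl

/-- The total derivative `∂/∂x + ∑ y_{i+1} ∂/∂y_i` on the jet space. -/
def contactField (n : ℕ) (v : EuclideanSpace ℝ (Fin (n + 2))) : EuclideanSpace ℝ (Fin (n + 2)) :=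
  EuclideanSpace.single 0 1 + contactShift n v

/-- The field `∂/∂y_n` on the jet space. -/
def contactVert (n : ℕ) : EuclideanSpace ℝ (Fin (n + 2)) :=
  EuclideanSpace.single (Fin.last (n + 1)) 1

theorem contactVert_apply (k : Fin (n + 2)) : contactVert n k = if k.val = n + 1 then 1 else 0 := by
  simp [contactVert, Fin.ext_iff]

/-- The iterates run through `∂/∂y_n, ∂/∂y_{n-1}, …, ∂/∂y_0`, the field `∂/∂y_{n-j}` having index `n
+ 1 - j`. -/
theorem iterate_contactShift_apply (j : ℕ) (hj : j ≤ n) (k : Fin (n + 2)) :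
    (contactShift n)^[j] (contactVert n) k = if k.val + j = n + 1 then 1 else 0 := by
  induction j generalizing k with
  | zero => exact contactVert_apply k
  | succ j ih =>
    rw [Function.iterate_succ_apply', contactShift_apply]
    split_ifs with h h' h'
    · rw [ih (by omega), if_pos (by simp; omega)]
    · rw [ih (by omega), if_neg (by simp; omega)]
    · omega
    · rfl

theorem contDiff_contactField : ContDiff ℝ ∞ (contactField n) :=
  contDiff_const.add (contactShift n).contDiff

theorem lieBracket_contactField (c : EuclideanSpace ℝ (Fin (n + 2))) :
    lieBracket ℝ (contactField n) (fun _ => c) = fun _ => -contactShift n c := by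
  funext v
  have h : HasFDerivAt (contactField n) (contactShift n) v :=
    (contactShift n).hasFDerivAt.const_add (EuclideanSpace.single 0 1)
  simp [lieBracket, h.fderiv]

theorem lieBracket_contactField' (c : EuclideanSpace ℝ (Fin (n + 2))) :
    lieBracket ℝ (fun _ => c) (contactField n) = fun _ => contactShift n c := by
  funext v
  rw [lieBracket_swap, lieBracket_contactField, neg_neg]

/-- The values of a frame of the `i`-th Lie square of the contact distribution. -/
def contactFrame (n i : ℕ) (v : EuclideanSpace ℝ (Fin (n + 2))) :
    Fin (i + 1) → EuclideanSpace ℝ (Fin (n + 2)) :=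
  Fin.cons (contactField n v) fun j : Fin i => (contactShift n)^[j] (contactVert n)

theorem linearIndependent_contactFrame {i : ℕ} (hi : i ≤ n + 1)
    (v : EuclideanSpace ℝ (Fin (n + 2))) : LinearIndependent ℝ (contactFrame n i v) := by
  have hcoord : ∀ j : Fin i, ∀ k : Fin (n + 2),
      (contactShift n)^[j] (contactVert n) k = if k.val + j = n + 1 then 1 else 0 := fun j k =>
    iterate_contactShift_apply j (by omega) k
  rw [contactFrame, linearIndependent_finCons]
  constructor
  · refine linearIndependent_of_dual
      (fun j => EuclideanSpace.proj (𝕜 := ℝ) (⟨n + 1 - j, by omega⟩ : Fin (n + 2))) fun j k => ?_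
    refine (hcoord j _).trans ?_
    refine if_congr ?_ rfl rfl
    rw [Fin.ext_iff]
    constructor
    · intro h
      simp only at h
      omega
    · intro h
      simp only
      omega
  · intro hmem
    have h0 : Submodule.span ℝ (range fun j : Fin i => (contactShift n)^[j] (contactVert n)) ≤
        LinearMap.ker (EuclideanSpace.proj (𝕜 := ℝ) (0 : Fin (n + 2))).toLinearMap := by
      rw [Submodule.span_le]
      rintro _ ⟨j, rfl⟩
      refine (hcoord j 0).trans (if_neg ?_)
      simp
      omega
    have h1 : contactField n v 0 = 0 := h0 hmem
    have h2 : contactField n v 0 = 1 := by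
      change (EuclideanSpace.single (0 : Fin (n + 2)) (1 : ℝ)) 0 + contactShift n v 0 = 1
      rw [contactShift_apply]
      simp
    rw [h2] at h1
    exact one_ne_zero h1

theorem linearIndependent_pair_contact (v : EuclideanSpace ℝ (Fin (n + 2))) :
    LinearIndependent ℝ ![contactField n v, contactVert n] := by
  have h := linearIndependent_contactFrame (n := n) (i := 1) (by omega) v
  have e : contactFrame n 1 v = ![contactField n v, contactVert n] := by
    funext j
    fin_cases j <;> rfl
  rwa [e] at h

variable {N : Type*} [TopologicalSpace N] [ChartedSpace (EuclideanSpace ℝ (Fin (n + 2))) N]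
  [IsManifold (𝓡 (n + 2)) ∞ N] {E : RankTwoDistribution (n + 2) N}

/-- The contact distribution on the jet space is a Goursat distribution. -/
theorem isGoursat_of_contactField {ψ : OpenPartialHomeomorph N (EuclideanSpace ℝ (Fin (n + 2)))}
    {s : Set (EuclideanSpace ℝ (Fin (n + 2)))}
    (h : E.IsFrameIn ψ s (contactField n) (fun _ => contactVert n))
    (hs : ∀ x, x ∈ ψ.source ∧ ψ x ∈ s) : E.IsGoursat := by
  intro i hi hin x
  obtain ⟨hx, hxs⟩ := hs x
  -- The `i`-th family consists of the total derivative and `∂/∂y_n, …, ∂/∂y_{n+1-i}`. Coordinate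
  -- fields commute and the total derivative shifts them by one, so brackets of one family lie in
  -- the next.
  set 𝒢 : ℕ → Set (EuclideanSpace ℝ (Fin (n + 2)) → EuclideanSpace ℝ (Fin (n + 2))) := fun i =>
    insert (contactField n) ((fun (j : ℕ) _ => (contactShift n)^[j] (contactVert n)) '' Iio i)
    with h𝒢
  have hT : ∀ i, contactField n ∈ 𝒢 i := fun i => mem_insert _ _
  have hV : ∀ i j, j < i → (fun _ => (contactShift n)^[j] (contactVert n)) ∈ 𝒢 i := fun i j hj =>
    mem_insert_of_mem _ ⟨j, hj, rfl⟩
  have hle := h.map_lieSquareFlag_le (𝒢 := 𝒢) hx hxs (by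
      rintro i _ (rfl | ⟨j, -, rfl⟩)
      exacts [contDiff_contactField.smoothNear, SmoothNear.const _])
    (LocGen.of_mem (hT 1)) (LocGen.of_mem (hV 1 0 one_pos)) (by
      rintro i _ (rfl | ⟨j, hj, rfl⟩)
      exacts [LocGen.of_mem (hT _), LocGen.of_mem (hV _ _ (lt_trans hj (Nat.lt_succ_self _)))]) (by
      rintro i _ (rfl | ⟨j, hj, rfl⟩) _ (rfl | ⟨k, hk, rfl⟩)
      · rw [lieBracket_self]
        exact zero_mem _
      · rw [lieBracket_contactField, ← Function.iterate_succ_apply' (contactShift n)]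
        exact neg_mem (LocGen.of_mem (hV (i + 2) (k + 1) (Nat.succ_lt_succ hk)))
      · rw [lieBracket_contactField', ← Function.iterate_succ_apply' (contactShift n)]
        exact LocGen.of_mem (hV (i + 2) (j + 1) (Nat.succ_lt_succ hj))
      · refine LocGen.of_eventuallyEq_zero (Filter.Eventually.of_forall fun v => ?_)
        simp [lieBracket]) i
  have hrange : (fun G => G (ψ x)) '' 𝒢 i ⊆ range (contactFrame n i (ψ x)) := by
    rintro _ ⟨_, (rfl | ⟨j, hj, rfl⟩), rfl⟩
    · exact ⟨0, rfl⟩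
    · exact ⟨Fin.succ ⟨j, hj⟩, rfl⟩
  -- For the lower bound the iterated brackets of the total derivative with `∂/∂y_n` suffice; each
  -- bracket changes the sign, hence the nonzero factor `c`.
  have hword : ∀ j, ∃ c : ℝ, c ≠ 0 ∧ (fun _ => c • (contactShift n)^[j] (contactVert n)) ∈
      bracketWords {contactField n, fun _ => contactVert n} (j + 1) := by
    intro j
    induction j with
    | zero => exact ⟨1, one_ne_zero, by simp [bracketWords]⟩
    | succ j ih =>
      obtain ⟨c, hc, hmem⟩ := ih
      refine ⟨-c, neg_ne_zero.2 hc, ?_⟩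
      have h1 := lieBracket_mem_bracketWords (S := {contactField n, fun _ => contactVert n})
        (Nat.succ_pos j) (A := contactField n) (by simp) hmem
      rw [lieBracket_contactField, map_smul, ← Function.iterate_succ_apply' (contactShift n)] at h1
      simpa using h1
  have hlower : Submodule.span ℝ (range (contactFrame n i (ψ x))) ≤
      (E.lieSquareFlag i x).map (chartDeriv ψ x).toLinearMap := by
    refine le_trans ?_ (Submodule.map_mono (E.derivedFlag_le_lieSquareFlag i x))
    rw [h.map_derivedFlag i hx hxs, Submodule.span_le]
    rintro _ ⟨k, rfl⟩
    refine Fin.cases ?_ (fun j => ?_) k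
    · exact apply_mem_wordSpan (bracketWords_mono _ hi (show contactField n ∈ _ by
        simp [bracketWords])) _
    · obtain ⟨c, hc, hmem⟩ := hword j
      exact (Submodule.smul_mem_iff _ hc).1
        (apply_mem_wordSpan (bracketWords_mono _ (show (j : ℕ) + 1 ≤ i by omega) hmem) (ψ x))
  have heq : (E.lieSquareFlag i x).map (chartDeriv ψ x).toLinearMap =
      Submodule.span ℝ (range (contactFrame n i (ψ x))) :=
    le_antisymm (hle.trans (Submodule.span_mono hrange)) hlower
  have h1 := finrank_span_eq_card (linearIndependent_contactFrame (show i ≤ n + 1 by omega) (ψ x))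
  rw [Fintype.card_fin, ← heq] at h1
  exact (Submodule.equivMapOfInjective (chartDeriv ψ x).toLinearMap
    (chartDeriv_bijective h.mem hx).1 (E.lieSquareFlag i x)).finrank_eq.trans h1

/-- The distribution spanned by the contact fields in a global chart. -/
def contactDistribution {N : Type*} [TopologicalSpace N]
    [ChartedSpace (EuclideanSpace ℝ (Fin (n + 2))) N] [IsManifold (𝓡 (n + 2)) ∞ N]
    (ψ : OpenPartialHomeomorph N (EuclideanSpace ℝ (Fin (n + 2))))
    (hψ : ψ ∈ IsManifold.maximalAtlas (𝓡 (n + 2)) ∞ N) (hs : ψ.source = univ) :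
    RankTwoDistribution (n + 2) N where
  fiber x := Submodule.span ℝ {pullField ψ (contactField n) x, pullField ψ (fun _ => contactVert n) x}
  exists_frame p := by
    have e : ψ.source ∩ ψ ⁻¹' univ = univ := by rw [hs, preimage_univ, univ_inter]
    refine ⟨univ, isOpen_univ, mem_univ p, pullField ψ (contactField n),
      pullField ψ fun _ => contactVert n, ?_, ?_, fun x _ => ⟨?_, rfl⟩⟩
    · exact e ▸ smoothOn_pullField hψ isOpen_univ contDiff_contactField.contDiffOn
    · exact e ▸ smoothOn_pullField hψ isOpen_univ contDiffOn_const
    · have hx : x ∈ ψ.source := hs ▸ mem_univ x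
      have h1 := LinearIndependent.pair_iff.1 (linearIndependent_pair_contact (ψ x))
      rw [LinearIndependent.pair_iff]
      intro a b hab
      have h2 := congrArg (chartDeriv ψ x) hab
      rw [map_add, map_smul, map_smul, map_zero, chartDeriv_pullField hψ _ hx,
        chartDeriv_pullField hψ _ hx] at h2
      exact h1 a b h2

theorem isFrameIn_contactDistribution
    (ψ : OpenPartialHomeomorph N (EuclideanSpace ℝ (Fin (n + 2))))
    (hψ : ψ ∈ IsManifold.maximalAtlas (𝓡 (n + 2)) ∞ N) (hs : ψ.source = univ) :
    (contactDistribution ψ hψ hs).IsFrameIn ψ ψ.target (contactField n) fun _ => contactVert n := by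
  refine ⟨hψ, ψ.open_target, Subset.rfl, contDiff_contactField.contDiffOn, contDiffOn_const,
    fun v _ => linearIndependent_pair_contact v, fun v hv => ?_⟩
  have hx := ψ.map_target hv
  change (Submodule.span ℝ {pullField ψ (contactField n) (ψ.symm v),
    pullField ψ (fun _ => contactVert n) (ψ.symm v)}).map _ = _
  rw [Submodule.map_span, image_pair]
  have h1 := chartDeriv_pullField hψ (contactField n) hx
  have h2 := chartDeriv_pullField hψ (fun _ => contactVert n) hx
  rw [ψ.right_inv hv] at h1
  exact congrArg₂ (fun a b => Submodule.span ℝ {a, b}) h1 h2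

end Contact

/-! ### From Lagrangians to Goursat quotients -/

section FromLagrangian

open VectorField RankTwoDistribution

variable {n : ℕ}

/-- The projection forgetting the last coordinate. -/
def jetProj (n : ℕ) : EuclideanSpace ℝ (Fin (n + 3)) →L[ℝ] EuclideanSpace ℝ (Fin (n + 2)) :=
  LinearMap.toContinuousLinearMap
    { toFun := fun w => WithLp.toLp 2 fun k : Fin (n + 2) => w k.castSucc
      map_add' := fun _ _ => rfl
      map_smul' := fun _ _ => rfl }

theorem jetProj_apply (w : EuclideanSpace ℝ (Fin (n + 3))) (k : Fin (n + 2)) :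
    jetProj n w k = w k.castSucc := rfl

/-- The point with a given projection and last coordinate. -/
def jetLift (n : ℕ) : EuclideanSpace ℝ (Fin (n + 2)) × ℝ →L[ℝ] EuclideanSpace ℝ (Fin (n + 3)) :=
  LinearMap.toContinuousLinearMap
    { toFun := fun v => WithLp.toLp 2 (Fin.snoc v.1 v.2 : Fin (n + 3) → ℝ)
      map_add' := fun v w => by
        ext k
        refine Fin.lastCases ?_ (fun k => ?_) k <;> simp
      map_smul' := fun c v => by
        ext k
        refine Fin.lastCases ?_ (fun k => ?_) k <;> simp }

theorem jetLift_apply (v : EuclideanSpace ℝ (Fin (n + 2)) × ℝ) :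
    jetLift n v = WithLp.toLp 2 (Fin.snoc v.1 v.2 : Fin (n + 3) → ℝ) := rfl

theorem jetProj_jetLift (v : EuclideanSpace ℝ (Fin (n + 2)) × ℝ) :
    jetProj n (jetLift n v) = v.1 := by
  ext k
  simp [jetProj_apply, jetLift_apply]

theorem jetLift_apply_last (v : EuclideanSpace ℝ (Fin (n + 2)) × ℝ) :
    jetLift n v (Fin.last (n + 2)) = v.2 := by
  simp [jetLift_apply]

theorem jetLift_jetProj (w : EuclideanSpace ℝ (Fin (n + 3))) :
    jetLift n (jetProj n w, w (Fin.last (n + 2))) = w := by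
  ext k
  refine Fin.lastCases ?_ (fun k => ?_) k <;> simp [jetProj_apply, jetLift_apply]

theorem jetProj_lastDir : jetProj n (lastDir n) = 0 := by
  ext k
  have hk := k.2
  exact (lastDir_apply k.castSucc).trans (if_neg (by simp; omega))

theorem lastDir_apply_last : lastDir n (Fin.last (n + 2)) = 1 :=
  (lastDir_apply _).trans (if_pos rfl)

theorem lastDir_ne_zero : lastDir n ≠ 0 := fun h => by
  have h1 := lastDir_apply_last (n := n)
  rw [h] at h1
  exact zero_ne_one h1

theorem jetProj_lagrangianField₁ (f : ℝ × (Fin (n + 1) → ℝ) → ℝ)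
    (w : EuclideanSpace ℝ (Fin (n + 3))) :
    jetProj n (lagrangianField₁ f w) = contactField n (jetProj n w) := by
  rw [lagrangianField₁_eq, map_add, map_add, map_smul, jetProj_lastDir, smul_zero, add_zero,
    contactField]
  congr 1
  · ext k
    refine (single_zero_apply k.castSucc).trans ?_
    exact ((PiLp.single_apply 2 ℝ 0 1 k).trans (if_congr Fin.ext_iff rfl rfl)).symm
  · ext k
    rw [jetProj_apply, jetShift_apply, contactShift_apply]
    rfl

theorem jetProj_lagrangianField₂ : jetProj n (lagrangianField₂ n) = contactVert n := by
  ext k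
  exact (lagrangianField₂_apply k.castSucc).trans (contactVert_apply k).symm

/-- Neither `f` nor the total derivative involves `z`. -/
theorem lieBracket_lastDir_lagrangianField₁ {f : ℝ × (Fin (n + 1) → ℝ) → ℝ}
    {w : EuclideanSpace ℝ (Fin (n + 3))} (hf : SmoothNear f (jetPart w)) :
    lieBracket ℝ (fun _ => lastDir n) (lagrangianField₁ f) w = 0 := by
  have h1 : HasFDerivAt (fun w => f (jetPart w)) ((fderiv ℝ f (jetPart w)).comp (jetPartL n)) w :=
    HasFDerivAt.comp (f := jetPartL n) w hf.hasFDerivAt (jetPartL n).hasFDerivAt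
  simp only [lieBracket, fderiv_lagrangianField₁ hf, jetShift_lastDir, h1.fderiv,
    ContinuousLinearMap.comp_apply, jetPart_lastDir, map_zero, zero_smul, add_zero,
    fderiv_fun_const, Pi.zero_apply, zero_apply, sub_zero]

/-- The points whose projection lies in a ball and whose last coordinate lies in an interval. -/
def jetCylinder (w₀ : EuclideanSpace ℝ (Fin (n + 3))) (ε : ℝ) :
    Set (EuclideanSpace ℝ (Fin (n + 3))) :=
  {w | jetProj n w ∈ Metric.ball (jetProj n w₀) ε ∧
    w (Fin.last (n + 2)) ∈ Metric.ball (w₀ (Fin.last (n + 2))) ε}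

theorem isOpen_jetCylinder (w₀ : EuclideanSpace ℝ (Fin (n + 3))) (ε : ℝ) :
    IsOpen (jetCylinder w₀ ε) :=
  (Metric.isOpen_ball.preimage (jetProj n).continuous).inter (Metric.isOpen_ball.preimage
    (EuclideanSpace.proj (𝕜 := ℝ) (Fin.last (n + 2))).continuous)

theorem exists_jetCylinder_subset {w₀ : EuclideanSpace ℝ (Fin (n + 3))}
    {s : Set (EuclideanSpace ℝ (Fin (n + 3)))} (hs : s ∈ 𝓝 w₀) :
    ∃ ε > 0, jetCylinder w₀ ε ⊆ s := by
  have h1 : jetLift n ⁻¹' s ∈ 𝓝 (jetProj n w₀, w₀ (Fin.last (n + 2))) :=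
    (jetLift n).continuous.continuousAt.preimage_mem_nhds (by rwa [jetLift_jetProj])
  obtain ⟨ε, hε, hball⟩ := Metric.mem_nhds_iff.1 h1
  rw [← ball_prod_same] at hball
  refine ⟨ε, hε, fun w hw => ?_⟩
  have h2 : jetLift n (jetProj n w, w (Fin.last (n + 2))) ∈ s := hball ⟨hw.1, hw.2⟩
  rwa [jetLift_jetProj] at h2

variable {M : Type*} [TopologicalSpace M]
  {φ : OpenPartialHomeomorph M (EuclideanSpace ℝ (Fin (n + 3)))}
  {ψ : OpenPartialHomeomorph (EuclideanSpace ℝ (Fin (n + 2))) (EuclideanSpace ℝ (Fin (n + 2)))}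
  {w₀ : EuclideanSpace ℝ (Fin (n + 3))} {ε : ℝ}

/-- The quotient map of a chart domain by the last coordinate field. -/
def jetQuotient (φ : OpenPartialHomeomorph M (EuclideanSpace ℝ (Fin (n + 3))))
    (ψ : OpenPartialHomeomorph (EuclideanSpace ℝ (Fin (n + 2))) (EuclideanSpace ℝ (Fin (n + 2))))
    (q : M) : EuclideanSpace ℝ (Fin (n + 2)) :=
  ψ.symm (jetProj n (φ q))

theorem apply_jetQuotient (ht : ψ.target = Metric.ball (jetProj n w₀) ε) {q : M}
    (hq : q ∈ φ.source ∩ φ ⁻¹' jetCylinder w₀ ε) : ψ (jetQuotient φ ψ q) = jetProj n (φ q) :=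
  ψ.right_inv (by rw [ht]; exact hq.2.1)

variable [ChartedSpace (EuclideanSpace ℝ (Fin (n + 3))) M]

theorem chartDeriv_mfderiv_symm (hφ : φ ∈ IsManifold.maximalAtlas (𝓡 (n + 3)) ∞ M)
    {u : EuclideanSpace ℝ (Fin (n + 3))} (hu : u ∈ φ.target) (v : EuclideanSpace ℝ (Fin (n + 3))) :
    chartDeriv φ (φ.symm u) (mfderiv (𝓡 (n + 3)) (𝓡 (n + 3)) φ.symm u v) = v :=
  DFunLike.congr_fun ((mdifferentiable_of_mem_maximalAtlas hφ).comp_symm_deriv hu) v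

theorem contMDiffOn_jetQuotient (hφ : φ ∈ IsManifold.maximalAtlas (𝓡 (n + 3)) ∞ M)
    (hψ : ψ ∈ IsManifold.maximalAtlas (𝓡 (n + 2)) ∞ (EuclideanSpace ℝ (Fin (n + 2))))
    (ht : ψ.target = Metric.ball (jetProj n w₀) ε) :
    ContMDiffOn (𝓡 (n + 3)) (𝓡 (n + 2)) ∞ (jetQuotient φ ψ)
      (φ.source ∩ φ ⁻¹' jetCylinder w₀ ε) := by
  intro q hq
  have h1 : ContMDiffAt (𝓡 (n + 3)) (𝓡 (n + 3)) ∞ φ q :=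
    (contMDiffOn_of_mem_maximalAtlas hφ).contMDiffAt (φ.open_source.mem_nhds hq.1)
  have h2 : ContMDiffAt (𝓡 (n + 3)) (𝓡 (n + 2)) ∞ (jetProj n) (φ q) :=
    (jetProj n).contDiff.contDiffAt.contMDiffAt
  have h3 : ContMDiffAt (𝓡 (n + 2)) (𝓡 (n + 2)) ∞ ψ.symm (jetProj n (φ q)) :=
    (contMDiffOn_symm_of_mem_maximalAtlas hψ).contMDiffAt (ψ.open_target.mem_nhds (by
      rw [ht]
      exact hq.2.1))
  exact (h3.comp q (h2.comp q h1)).contMDiffWithinAt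

/-- In a chart, the integral curves of the last coordinate field are the vertical segments. -/
theorem jetProj_eq_iff_sameIntegralCurve (hφ : φ ∈ IsManifold.maximalAtlas (𝓡 (n + 3)) ∞ M)
    (hW : jetCylinder w₀ ε ⊆ φ.target) {q q' : M}
    (hq : q ∈ φ.source ∩ φ ⁻¹' jetCylinder w₀ ε) (hq' : q' ∈ φ.source ∩ φ ⁻¹' jetCylinder w₀ ε) :
    jetProj n (φ q) = jetProj n (φ q') ↔
      SameIntegralCurve (pullField φ fun _ => lastDir n) (φ.source ∩ φ ⁻¹' jetCylinder w₀ ε) q q' := by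
  constructor
  · intro heq
    -- The vertical line through `φ q`, parametrized by its last coordinate; between the two points
    -- it stays in the cylinder because an interval is convex.
    set l : ℝ → EuclideanSpace ℝ (Fin (n + 3)) := fun t => jetLift n (jetProj n (φ q), t) with hl
    have hd : ∀ t, HasFDerivAt l ((1 : ℝ →L[ℝ] ℝ).smulRight (lastDir n)) t := by
      intro t
      have h1 := (jetLift n).hasFDerivAt.comp t
        ((hasFDerivAt_const (jetProj n (φ q)) t).prodMk (hasFDerivAt_id t))
      refine h1.congr_fderiv ?_
      ext1
      change jetLift n (0, 1) = (1 : ℝ) • lastDir n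
      rw [one_smul, ← jetLift_jetProj (lastDir n), jetProj_lastDir, lastDir_apply_last]
    have hmem : ∀ t ∈ uIcc (φ q (Fin.last (n + 2))) (φ q' (Fin.last (n + 2))),
        l t ∈ jetCylinder w₀ ε := by
      intro t ht
      refine ⟨?_, ?_⟩
      · rw [hl, jetProj_jetLift]
        exact hq.2.1
      · rw [hl, jetLift_apply_last]
        exact (convex_ball _ ε).ordConnected.uIcc_subset hq.2.2 hq'.2.2 ht
    refine ⟨fun t => φ.symm (l t), φ q (Fin.last (n + 2)), φ q' (Fin.last (n + 2)), fun t ht => ?_,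
      fun t ht => ?_, ?_, ?_⟩
    · have h1 := hW (hmem t ht)
      exact ⟨φ.map_target h1, by rw [mem_preimage, φ.right_inv h1]; exact hmem t ht⟩
    · have h1 := hW (hmem t ht)
      have h2 : HasMFDerivAt 𝓘(ℝ, ℝ) (𝓡 (n + 3)) l t
          ((1 : ℝ →L[ℝ] ℝ).smulRight (lastDir n)) := (hd t).hasMFDerivAt
      have h3 := ((mdifferentiable_of_mem_maximalAtlas hφ).symm.mdifferentiableAt
        h1).hasMFDerivAt.comp t h2
      have h4 : mfderiv (𝓡 (n + 3)) (𝓡 (n + 3)) φ.symm (l t) (lastDir n) =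
          pullField φ (fun _ => lastDir n) (φ.symm (l t)) := by
        refine (chartDeriv_bijective hφ (φ.map_target h1)).1 ?_
        rw [chartDeriv_mfderiv_symm hφ h1, chartDeriv_pullField hφ _ (φ.map_target h1)]
      refine HasMFDerivAt.hasMFDerivWithinAt ?_
      rw [← h4]
      refine h3.congr_mfderiv ?_
      ext1
      exact map_smul (mfderiv (𝓡 (n + 3)) (𝓡 (n + 3)) φ.symm (l t)) (1 : ℝ) (lastDir n)
    · simp only [hl]
      rw [jetLift_jetProj, φ.left_inv hq.1]
    · simp only [hl]
      rw [heq, jetLift_jetProj, φ.left_inv hq'.1]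
  · rintro ⟨γ, a, b, hU, hγ, rfl, rfl⟩
    -- Conversely, along an integral curve the projected point has zero velocity and is therefore
    -- constant.
    have hd : ∀ t ∈ uIcc a b, HasDerivWithinAt (fun t => jetProj n (φ (γ t))) 0 (uIcc a b) t := by
      intro t ht
      have h1 := (((mdifferentiable_of_mem_maximalAtlas hφ).mdifferentiableAt
        (hU t ht).1).hasMFDerivAt.comp_hasMFDerivWithinAt t (hγ t ht)).hasFDerivWithinAt
      have h2 := ((jetProj n).hasFDerivAt.comp_hasFDerivWithinAt t h1).hasDerivWithinAt
      refine h2.congr_deriv ?_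
      change jetProj n (chartDeriv φ (γ t) ((1 : ℝ) • pullField φ (fun _ => lastDir n) (γ t))) = 0
      rw [one_smul, chartDeriv_pullField hφ _ (hU t ht).1, jetProj_lastDir]
    have h1 := (convex_uIcc a b).norm_image_sub_le_of_norm_hasDerivWithin_le (C := 0) hd
      (fun _ _ => by simp) right_mem_uIcc left_mem_uIcc
    rw [zero_mul] at h1
    exact sub_eq_zero.1 (norm_le_zero_iff.1 h1)

theorem chartDeriv_mfderiv_jetQuotient (hφ : φ ∈ IsManifold.maximalAtlas (𝓡 (n + 3)) ∞ M)
    (hψ : ψ ∈ IsManifold.maximalAtlas (𝓡 (n + 2)) ∞ (EuclideanSpace ℝ (Fin (n + 2))))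
    (hs : ψ.source = univ) (ht : ψ.target = Metric.ball (jetProj n w₀) ε) {q : M}
    (hq : q ∈ φ.source ∩ φ ⁻¹' jetCylinder w₀ ε) (v : TangentSpace (𝓡 (n + 3)) q) :
    chartDeriv ψ (jetQuotient φ ψ q)
      (mfderiv (𝓡 (n + 3)) (𝓡 (n + 2)) (jetQuotient φ ψ) q v) = jetProj n (chartDeriv φ q v) := by
  have hU : IsOpen (φ.source ∩ φ ⁻¹' jetCylinder w₀ ε) :=
    φ.isOpen_inter_preimage (isOpen_jetCylinder w₀ ε)
  have h1 := fderiv_comp_charts hU (contMDiffOn_jetQuotient hφ hψ ht) hφ hψ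
    (q := q) ⟨⟨hq, by rw [mem_preimage, hs]; trivial⟩, hq.1⟩ v
  have h2 : ψ ∘ jetQuotient φ ψ ∘ φ.symm =ᶠ[𝓝 (φ q)] jetProj n := by
    filter_upwards [φ.open_target.mem_nhds (φ.map_source hq.1),
      (isOpen_jetCylinder w₀ ε).mem_nhds hq.2] with u hu hu'
    have h3 := apply_jetQuotient (φ := φ) (ψ := ψ) ht (q := φ.symm u)
      ⟨φ.map_target hu, by rwa [mem_preimage, φ.right_inv hu]⟩
    rwa [φ.right_inv hu] at h3
  rw [h2.fderiv_eq, (jetProj n).fderiv] at h1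
  exact h1.symm

theorem isQuotientByIntegralCurves_jetQuotient (hφ : φ ∈ IsManifold.maximalAtlas (𝓡 (n + 3)) ∞ M)
    (hψ : ψ ∈ IsManifold.maximalAtlas (𝓡 (n + 2)) ∞ (EuclideanSpace ℝ (Fin (n + 2))))
    (hs : ψ.source = univ) (hε : 0 < ε) (ht : ψ.target = Metric.ball (jetProj n w₀) ε)
    (hW : jetCylinder w₀ ε ⊆ φ.target) :
    IsQuotientByIntegralCurves (e := n + 2) (pullField φ fun _ => lastDir n)
      (φ.source ∩ φ ⁻¹' jetCylinder w₀ ε) (jetQuotient φ ψ) := by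
  have hsrc : ∀ x, x ∈ ψ.source := fun x => hs ▸ mem_univ x
  refine ⟨fun q hq h0 => ?_, contMDiffOn_jetQuotient hφ hψ ht, fun q hq v' => ?_, ?_,
    fun q hq q' hq' => ?_⟩
  · have h1 := chartDeriv_pullField hφ (fun _ => lastDir n) hq.1
    rw [h0, map_zero] at h1
    exact lastDir_ne_zero h1.symm
  · obtain ⟨v, hv⟩ : ∃ v : TangentSpace (𝓡 (n + 3)) q,
        chartDeriv φ q v = jetLift n (chartDeriv ψ (jetQuotient φ ψ q) v', 0) :=
      (chartDeriv_bijective hφ hq.1).2 _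
    refine ⟨v, (chartDeriv_bijective hψ (hsrc _)).1 ?_⟩
    have h1 := chartDeriv_mfderiv_jetQuotient hφ hψ hs ht hq v
    rw [hv, jetProj_jetLift] at h1
    exact h1
  · refine eq_univ_of_forall fun x => ?_
    have hx : ψ x ∈ Metric.ball (jetProj n w₀) ε := ht ▸ ψ.map_source (hsrc x)
    have hw : jetLift n (ψ x, w₀ (Fin.last (n + 2))) ∈ jetCylinder w₀ ε :=
      ⟨by rwa [jetProj_jetLift], by rw [jetLift_apply_last]; exact Metric.mem_ball_self hε⟩
    refine ⟨φ.symm (jetLift n (ψ x, w₀ (Fin.last (n + 2)))),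
      ⟨φ.map_target (hW hw), by rwa [mem_preimage, φ.right_inv (hW hw)]⟩, ?_⟩
    rw [jetQuotient, φ.right_inv (hW hw), jetProj_jetLift, ψ.left_inv (hsrc x)]
  · rw [← jetProj_eq_iff_sameIntegralCurve hφ hW hq hq']
    refine ⟨fun h => ?_, fun h => congrArg ψ.symm h⟩
    have := congrArg ψ h
    rwa [apply_jetQuotient ht hq, apply_jetQuotient ht hq'] at this

variable [IsManifold (𝓡 (n + 3)) ∞ M] {D : RankTwoDistribution (n + 3) M}
  {f : ℝ × (Fin (n + 1) → ℝ) → ℝ}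

theorem map_fiber_jetQuotient
    (h : D.IsFrameIn φ φ.target (lagrangianField₁ f) fun _ => lagrangianField₂ n)
    (hψ : ψ ∈ IsManifold.maximalAtlas (𝓡 (n + 2)) ∞ (EuclideanSpace ℝ (Fin (n + 2))))
    (hs : ψ.source = univ) (ht : ψ.target = Metric.ball (jetProj n w₀) ε) {q : M}
    (hq : q ∈ φ.source ∩ φ ⁻¹' jetCylinder w₀ ε) :
    (D.fiber q).map (mfderiv (𝓡 (n + 3)) (𝓡 (n + 2)) (jetQuotient φ ψ) q).toLinearMap =
      (contactDistribution ψ hψ hs).fiber (jetQuotient φ ψ q) := by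
  have h' := isFrameIn_contactDistribution ψ hψ hs
  have hx : jetQuotient φ ψ q ∈ ψ.source := hs ▸ mem_univ _
  have key := fun v => h'.chartDeriv_mem_span_iff hx (ψ.map_source hx) (v := v)
  rw [apply_jetQuotient ht hq] at key
  have hproj : ∀ a b : ℝ, jetProj n (a • lagrangianField₁ f (φ q) + b • lagrangianField₂ n) =
      a • contactField n (jetProj n (φ q)) + b • contactVert n := by
    intro a b
    rw [map_add, map_smul, map_smul, jetProj_lagrangianField₁, jetProj_lagrangianField₂]
  apply le_antisymm
  · rintro _ ⟨v, hv, rfl⟩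
    obtain ⟨a, b, hab⟩ := Submodule.mem_span_pair.1
      ((h.chartDeriv_mem_span_iff hq.1 (φ.map_source hq.1)).2 hv)
    have h1 := chartDeriv_mfderiv_jetQuotient h.mem hψ hs ht hq v
    rw [← hab, hproj] at h1
    exact (key _).1 (Submodule.mem_span_pair.2 ⟨a, b, h1.symm⟩)
  · intro v' hv'
    obtain ⟨a, b, hab⟩ := Submodule.mem_span_pair.1 ((key v').2 hv')
    obtain ⟨v, hv⟩ : ∃ v : TangentSpace (𝓡 (n + 3)) q,
        chartDeriv φ q v = a • lagrangianField₁ f (φ q) + b • lagrangianField₂ n :=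
      (chartDeriv_bijective h.mem hq.1).2 _
    refine ⟨v, (h.chartDeriv_mem_span_iff hq.1 (φ.map_source hq.1)).1 ?_,
      (chartDeriv_bijective hψ hx).1 ?_⟩
    · rw [hv]
      exact Submodule.mem_span_pair.2 ⟨a, b, rfl⟩
    · have h1 := chartDeriv_mfderiv_jetQuotient h.mem hψ hs ht hq v
      rw [hv, hproj, hab] at h1
      exact h1

/-- `∂/∂z` commutes with both frame fields, so its bracket with a combination of them only
differentiates the coefficients. -/
theorem isInfinitesimalSymmetryOn_lastDir
    (h : D.IsFrameIn φ φ.target (lagrangianField₁ f) fun _ => lagrangianField₂ n)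
    (hf : ∀ u ∈ φ.target, SmoothNear f (jetPart u)) {U : Set M} (hUφ : U ⊆ φ.source) :
    D.IsInfinitesimalSymmetryOn U (pullField φ fun _ => lastDir n) := by
  have hX : (pullField φ fun _ => lastDir n).SmoothOn φ.source := by
    have h1 := smoothOn_pullField h.mem isOpen_univ (W := fun _ => lastDir n) contDiffOn_const
    rwa [preimage_univ, inter_univ] at h1
  refine ⟨fun x hx => (hX x (hUφ hx)).mono hUφ, fun V hV hVU Y hY q hq => ?_⟩
  have hqφ := hUφ (hVU hq)
  have ht := φ.map_source hqφ
  have hq' : φ.symm (φ q) ∈ V := by rwa [φ.left_inv hqφ]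
  rw [← h.chartDeriv_mem_span_iff hqφ ht, ← pushField_apply hqφ,
    pushField_mlieBracket h.mem hV (fun x hx => (hX x (hUφ (hVU hx))).mono (hVU.trans hUφ)) hY.1
      ht hq']
  have h1 : lieBracket ℝ (pushField φ (pullField φ fun _ => lastDir n)) (pushField φ Y) (φ q) =
      lieBracket ℝ (fun _ => lastDir n) (pushField φ Y) (φ q) := by
    refine Filter.EventuallyEq.lieBracket_vectorField_eq ?_ (Filter.EventuallyEq.refl _ _)
    filter_upwards [φ.open_target.mem_nhds ht] with v hv
    exact pushField_pullField h.mem _ hv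
  rw [h1]
  refine LocGen.lieBracket_apply_mem_of_symmetry (SmoothNear.const _) (h.smoothNear ht) ?_ ?_
    (h.pushField_mem_locGen_of_isSectionOn hV ht hq' hY)
  · rintro _ (rfl | rfl) <;> exact Submodule.subset_span (by simp)
  · rintro _ (rfl | rfl)
    · rw [lieBracket_lastDir_lagrangianField₁ (hf _ ht)]
      exact zero_mem _
    · simp [lieBracket]

theorem exists_symmetry_of_isLagrangianNear (hn : 2 ≤ n) {p : M} (h : IsLagrangianNear D p) :
    ∃ U : Set M, IsOpen U ∧ p ∈ U ∧ (∀ q ∈ U, finrank ℝ (D.derivedFlag 3 q) = 5) ∧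
      ∃ X : VField (n + 3) M, D.IsInfinitesimalSymmetryOn U X ∧
        (∀ q ∈ U, X q ∈ D.derivedFlag 3 q) ∧ SendsToGoursat (n + 2) D U X := by
  obtain ⟨Ω, f, hΩ, hf, hf2, φ, hφ, hp, hD⟩ := h
  have hfr := isFrameIn_lagrangianFields hΩ hf hφ hD
  obtain ⟨ε, hε, hW⟩ := exists_jetCylinder_subset (φ.open_target.mem_nhds (φ.map_source hp))
  -- This diffeomorphism identifies the whole Euclidean space with the base of the cylinder. It
  -- allows `N` to be the Euclidean space itself, with `ψ` a global chart, while the quotient map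
  -- stays surjective.
  set ψ : OpenPartialHomeomorph (EuclideanSpace ℝ (Fin (n + 2))) (EuclideanSpace ℝ (Fin (n + 2))) :=
    OpenPartialHomeomorph.univBall (jetProj n (φ p)) ε with hψdef
  have hs : ψ.source = univ := OpenPartialHomeomorph.univBall_source _ _
  have ht : ψ.target = Metric.ball (jetProj n (φ p)) ε :=
    OpenPartialHomeomorph.univBall_target _ hε
  have hψ : ψ ∈ IsManifold.maximalAtlas (𝓡 (n + 2)) ∞ (EuclideanSpace ℝ (Fin (n + 2))) := by
    have h1 := trans_mem_maximalAtlas (e := ψ) (StructureGroupoid.id_mem_maximalAtlas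
      (contDiffGroupoid ∞ (𝓡 (n + 2)))) OpenPartialHomeomorph.contDiff_univBall.contDiffOn
      (ht ▸ OpenPartialHomeomorph.contDiffOn_univBall_symm)
    rwa [OpenPartialHomeomorph.refl_trans] at h1
  have hfn : ∀ q ∈ φ.source, SmoothNear f (jetPart (φ q)) := fun q hq =>
    hf.smoothNear (hΩ.mem_nhds (hD q hq).1)
  refine ⟨φ.source ∩ φ ⁻¹' jetCylinder (φ p) ε,
    φ.isOpen_inter_preimage (isOpen_jetCylinder (φ p) ε),
    ⟨hp, Metric.mem_ball_self hε, Metric.mem_ball_self hε⟩, fun q hq => ?_,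
    pullField φ fun _ => lastDir n,
    isInfinitesimalSymmetryOn_lastDir hfr (fun u hu => ?_) inter_subset_left, fun q hq => ?_,
    EuclideanSpace ℝ (Fin (n + 2)), inferInstance, inferInstance, inferInstance, inferInstance,
    jetQuotient φ ψ, contactDistribution ψ hψ hs,
    isQuotientByIntegralCurves_jetQuotient hφ hψ hs hε ht hW,
    fun q hq => map_fiber_jetQuotient hfr hψ hs ht hq,
    isGoursat_of_contactField (isFrameIn_contactDistribution ψ hψ hs) fun x => ?_⟩
  · rw [hfr.finrank_derivedFlag 3 hq.1 (φ.map_source hq.1)]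
    exact finrank_wordSpan_lagrangianField hn (hfn q hq.1) (hf2 _ (hD q hq.1).1)
  · have h1 := hfn _ (φ.map_target hu)
    rwa [φ.right_inv hu] at h1
  · have h1 := lastDir_mem_wordSpan (hfn q hq.1) (hf2 _ (hD q hq.1).1)
    rw [← hfr.map_derivedFlag 3 hq.1 (φ.map_source hq.1)] at h1
    obtain ⟨v, hv, hv'⟩ := h1
    have h2 := chartDeriv_pullField hφ (fun _ => lastDir n) hq.1
    rwa [(chartDeriv_bijective hφ hq.1).1 (h2.trans hv'.symm)]
  · have hx : x ∈ ψ.source := hs ▸ mem_univ x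
    exact ⟨hx, ψ.map_source hx⟩

end FromLagrangian
end

theorem mainTheorem9 (n : ℕ) (hn : 2 ≤ n) {M : Type*} [TopologicalSpace M] [T2Space M]
    [ChartedSpace (EuclideanSpace ℝ (Fin (n + 3))) M] [IsManifold (𝓡 (n + 3)) ∞ M]
    (D : RankTwoDistribution (n + 3) M) :
    IsOpen D.genericPoints ∧ Dense D.genericPoints ∧
    ∀ p ∈ D.genericPoints,
      (IsLagrangianNear D p ↔
        ∃ U : Set M, IsOpen U ∧ p ∈ U ∧
          (∀ q ∈ U, finrank ℝ (D.derivedFlag 3 q) = 5) ∧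
          ∃ X : VField (n + 3) M,
            D.IsInfinitesimalSymmetryOn U X ∧
            (∀ q ∈ U, X q ∈ D.derivedFlag 3 q) ∧
            SendsToGoursat (n + 2) D U X) := by
  refine ⟨D.isOpen_genericPoints, D.dense_genericPoints, fun p hp =>
    ⟨exists_symmetry_of_isLagrangianNear hn, ?_⟩⟩
  rintro ⟨U, hU, hpU, h5, X, hX, hX3, N, _, _, _, _, π, E, hπ, hDE, hE⟩
  exact isLagrangianNear_of_isGoursat hn hp hU hpU h5 hX hX3 hπ hDE hE
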